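/- Let $d\ge 2$ and $k\ge 0$. Let $\Omega\subset\mathbb R^d$ be a bounded polygonal/polyhedral open set with boundary $\Gamma$, and let $\mathcal T_h$ be a conforming partition of $\Omega$ into nondegenerate $d$-simplices (triangles for $d=2$, tetrahedra for $d=3$), with $\Omega$ the interior of the union of the closed elements. Let $h$ be the largest diameter $h_K$ of an element. Let $f\in L^2(\Omega)$, and let $\kappa$ be measurable with $\kappa_0\le\kappa\le\kappa_1$ a.e. in $\Omega$, where $\kappa_0>0$. Let $(\mathbf q,u)\in \mathbf H(\mathrm{div},\Omega)\times H^1(\Omega)$ solve $$\kappa^{-1}\mathbf q+\nabla u=0,\quad \mathrm{div}\,\mathbf q=f\ \text{ in }\Omega,\qquad u=u_0\ \text{ on }\Gamma$$ (weak derivatives, boundary values in the sense of traces), and assume $\mathbf q\in H^1(\Omega)^d$. Let $\mathcal P_k$ be the polynomials of degree at most $k$ ($\mathcal P_{-1}=0$) and $\mathcal{RT}_k(K)=\mathcal P_k(K)^d\oplus \mathbf x\,\widetilde{\mathcal P}_k(K)$, with $\widetilde{\mathcal P}_k$ the homogeneous polynomials of degree $k$. Put $\mathbf V_h=\prod_K\mathcal{RT}_k(K)$,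 $W_h=\prod_K\mathcal P_k(K)$ and $M_h=\prod_e\mathcal P_k(e)$, the last product being over all faces $e$ of the partition. Let $M_h^\circ$ and $M_h^\Gamma$ be the subspaces of those $\mu\in M_h$ that vanish on the faces contained in $\Gamma$ and on the interior faces, respectively. Write $(\cdot,\cdot)_{\mathcal T_h}=\sum_K\int_K$ and $\langle\cdot,\cdot\rangle_{\partial\mathcal T_h}=\sum_K\int_{\partial K}$, with $\mathbf n$ the outward unit normal of each element. Let $(\mathbf q_h,u_h,\widehat u_h)\in\mathbf V_h\times W_h\times M_h$ solve the hybridized Raviart–Thomas equations $$(\kappa^{-1}\mathbf q_h,\mathbf r)_{\mathcal T_h}-(u_h,\mathrm{div}\,\mathbf r)_{\mathcal T_h}+\langle\widehat u_h,\mathbf r\cdot\mathbf n\rangle_{\partial\mathcal T_h}=0\quad\forall\mathbf r\in\mathbf V_h,$$ $$(\mathrm{div}\,\mathbf q_h,w)_{\mathcal T_h}=(f,w)_{\mathcal T_h}\quad\forall w\in W_h,$$ $$\langle\mathbf q_h\cdot\mathbf n,\mu\rangle_{\partial\mathcal T_h\setminus\Gamma}=0\quad\forall\mu\in M_h^\circ,\qquad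 \langle\widehat u_h,\mu\rangle_\Gamma=\langle u_0,\mu\rangle_\Gamma\quad\forall\mu\in M_h^\Gamma .$$ Let $\boldsymbol\Pi\mathbf q\in\mathbf V_h$ be the Raviart–Thomas projection: on each element $K$, $(\boldsymbol\Pi\mathbf q,\mathbf r)_K=(\mathbf q,\mathbf r)_K$ for all $\mathbf r\in\mathcal P_{k-1}(K)^d$, and $\langle\boldsymbol\Pi\mathbf q\cdot\mathbf n,\mu\rangle_{\partial K}=\langle\mathbf q\cdot\mathbf n,\mu\rangle_{\partial K}$ for all $\mu$ on $\partial K$ with $\mu|_e\in\mathcal P_k(e)$ for each face $e$ of $K$. (i) With $\|\mathbf v\|_{\kappa^{-1}}=(\kappa^{-1}\mathbf v,\mathbf v)_\Omega^{1/2}$, $$\|\boldsymbol\Pi\mathbf q-\mathbf q_h\|_{\kappa^{-1}}\le\|\boldsymbol\Pi\mathbf q-\mathbf q\|_{\kappa^{-1}} .$$ In particular, the bound contains no approximation error of $u$ in $W_h$ or $M_h$, and $u$ is only required to be in $H^1(\Omega)$. (ii) Suppose moreover that $\mathbf q\in H^{k+1}(\Omega)^d$ and that $\mathcal T_h$ is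 shape-regular with constant $\sigma$: $h_K\le\sigma\rho_K$ for every element $K$, where $\rho_K$ is the diameter of the largest ball contained in $K$. Then $$\|\boldsymbol\Pi\mathbf q-\mathbf q_h\|_{L^2(\Omega)}\le C\,h^{k+1}|\mathbf q|_{k+1,\Omega},\qquad \|\mathbf q-\mathbf q_h\|_{L^2(\Omega)}\le C\,h^{k+1}|\mathbf q|_{k+1,\Omega},$$ where $C>0$ depends only on $d,k,\sigma,\kappa_0,\kappa_1$ (in particular, not on $h$). -/

import Mathlib

open MeasureTheory Set
open scoped ContDiff

noncomputable section

namespace RTM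

/-- The ambient Euclidean space of dimension `d`. -/
abbrev E (d : ℕ) : Type := EuclideanSpace ℝ (Fin d)

/-! ### Simplices and meshes

A simplex is given by the finite set of its vertices. -/

/-- The closed simplex (or face) with the given vertices. -/
def cell {d : ℕ} (s : Finset (E d)) : Set (E d) := convexHull ℝ (s : Set (E d))

/-- The faces of codimension one of a simplex with `d + 1` vertices. -/
def faces {d : ℕ} (K : Finset (E d)) : Finset (Finset (E d)) := K.powersetCard d

/-- Surface measure on a face: `(d-1)`-dimensional Hausdorff measure, normalized so that it is
`(d-1)`-dimensional Lebesgue measure on hyperplanes. -/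
def surf {d : ℕ} (e : Finset (E d)) : Measure (E d) :=
  (Measure.euclideanHausdorffMeasure (d - 1)).restrict (cell e)

/-- A nonzero vector orthogonal to the face `e` of `K` that points out of `K`: the component
orthogonal to `e` of a positive multiple of (barycentre of `e`) - (barycentre of `K`). -/
def outwardVec {d : ℕ} (K e : Finset (E d)) : E d :=
  (vectorSpan ℝ (e : Set (E d)))ᗮ.starProjection (∑ x ∈ e, ∑ v ∈ K, (x - v))

/-- The outward unit normal to `K` on its face `e`. -/
def normal {d : ℕ} (K e : Finset (E d)) : E d := ‖outwardVec K e‖⁻¹ • outwardVec K e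

/-- A conforming simplicial mesh: finitely many nondegenerate simplices, any two of which meet
exactly in the simplex spanned by their common vertices. -/
structure Mesh (d : ℕ) where
  /-- the elements of the mesh -/
  elements : Finset (Finset (E d))
  card_eq : ∀ K ∈ elements, K.card = d + 1
  indep : ∀ K ∈ elements, AffineIndependent ℝ ((↑) : K → E d)
  conforming : ∀ K ∈ elements, ∀ L ∈ elements,
    cell K ∩ cell L = convexHull ℝ ((K : Set (E d)) ∩ (L : Set (E d)))

/-- `T` is a mesh of the polyhedral open set `Ω`. -/
def Mesh.IsMeshOf {d : ℕ} (T : Mesh d) (Ω : Set (E d)) : Prop :=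
  Ω = interior (⋃ K ∈ T.elements, cell K)

open Classical in
/-- All faces of the mesh. -/
def Mesh.allFaces {d : ℕ} (T : Mesh d) : Finset (Finset (E d)) := T.elements.biUnion faces

/-- The face `e` lies on the boundary of `Ω`. -/
def OnBoundary {d : ℕ} (Ω : Set (E d)) (e : Finset (E d)) : Prop := cell e ⊆ frontier Ω

/-- The mesh size: the largest diameter of an element. -/
def Mesh.size {d : ℕ} (T : Mesh d) : ℝ := ⨆ K : T.elements, Metric.diam (cell K.1)

/-- The diameter of the largest ball contained in the closed simplex `K`. -/
def inDiam {d : ℕ} (K : Finset (E d)) : ℝ :=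
  sSup {δ | ∃ (x : E d) (r : ℝ), 0 ≤ r ∧ Metric.closedBall x r ⊆ cell K ∧ δ = 2 * r}

/-- Shape regularity with constant `σ`. -/
def Mesh.ShapeRegular {d : ℕ} (T : Mesh d) (σ : ℝ) : Prop :=
  ∀ K ∈ T.elements, Metric.diam (cell K) ≤ σ * inDiam K

/-! ### Weak derivatives, Sobolev spaces, traces -/

/-- The classical partial derivative. -/
def pd {d : ℕ} (i : Fin d) (φ : E d → ℝ) (x : E d) : ℝ :=
  fderiv ℝ φ x (EuclideanSpace.single i 1)

/-- Test functions on `Ω`. -/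
def IsTest {d : ℕ} (Ω : Set (E d)) (φ : E d → ℝ) : Prop :=
  ContDiff ℝ ∞ φ ∧ HasCompactSupport φ ∧ tsupport φ ⊆ Ω

/-- `g` is the weak `i`-th partial derivative of `w` on `Ω`. -/
def IsWeakPartial {d : ℕ} (Ω : Set (E d)) (i : Fin d) (w g : E d → ℝ) : Prop :=
  ∀ φ, IsTest Ω φ → ∫ x in Ω, w x * pd i φ x = -∫ x in Ω, g x * φ x

/-- `f` is the weak divergence of `q` on `Ω`. -/
def IsWeakDiv {d : ℕ} (Ω : Set (E d)) (q : E d → E d) (f : E d → ℝ) : Prop :=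
  ∀ φ, IsTest Ω φ → ∫ x in Ω, ∑ i, q x i * pd i φ x = -∫ x in Ω, f x * φ x

/-- `w` belongs to `H^m(Ω)`, and `D α` is its weak derivative with multi-index `α`, for all `α`
with `|α| ≤ m`. -/
structure IsSobolev {d : ℕ} (Ω : Set (E d)) (m : ℕ) (w : E d → ℝ)
    (D : (Fin d → ℕ) → E d → ℝ) : Prop where
  memLp : ∀ α, ∑ i, α i ≤ m → MemLp (D α) 2 (volume.restrict Ω)
  zero : D 0 =ᵐ[volume.restrict Ω] w
  succ : ∀ α i, ∑ j, α j < m → IsWeakPartial Ω i (D α) (D (α + Pi.single i 1))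

/-- `w ∈ H^m(Ω)`. -/
def MemSobolev {d : ℕ} (Ω : Set (E d)) (m : ℕ) (w : E d → ℝ) : Prop :=
  ∃ D, IsSobolev Ω m w D

/-- The seminorm `|q|_{m,Ω}` of a vector field whose `i`-th component has the weak derivatives
`D i α`. -/
def sobSeminorm {d : ℕ} (Ω : Set (E d)) (m : ℕ) (D : Fin d → (Fin d → ℕ) → E d → ℝ) : ℝ :=
  √(∑ i, ∑ α ∈ Finset.piAntidiag (Finset.univ : Finset (Fin d)) m, ∫ x in Ω, (D i α x) ^ 2)

/-- `g` is the trace on `∂K` of the function `w ∈ H¹(K)`: with `G` the weak gradient of `w` on `K`,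
Green's formula holds against all functions that are smooth up to the boundary. -/
def IsTrace {d : ℕ} (K : Finset (E d)) (w g : E d → ℝ) : Prop :=
  MemLp w 2 (volume.restrict (cell K)) ∧ (∀ e ∈ faces K, MemLp g 2 (surf e)) ∧
  ∃ G : Fin d → E d → ℝ, (∀ i, MemLp (G i) 2 (volume.restrict (cell K))) ∧
    ∀ (i : Fin d) (φ : E d → ℝ), ContDiff ℝ ∞ φ →
      (∫ x in cell K, w x * pd i φ x) + (∫ x in cell K, G i x * φ x) =
        ∑ e ∈ faces K, ∫ x, g x * φ x * normal K e i ∂surf e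

/-! ### Polynomial spaces -/

/-- Polynomials of degree less than `n`: this is `P_{n-1}`, and `{0}` for `n = 0`. -/
def polyLT (d n : ℕ) : Submodule ℝ (MvPolynomial (Fin d) ℝ) :=
  MvPolynomial.restrictSupport ℝ {s | s.degree < n}

/-- Polynomial vector fields. -/
abbrev PolyField (d : ℕ) : Type := Fin d → MvPolynomial (Fin d) ℝ

/-- The Raviart-Thomas space of order `k`: the sum of the vector fields with components in `P_k`
and of the fields `x ↦ p(x) x` with `p` homogeneous of degree `k`. -/
def RTSpace (d k : ℕ) : Submodule ℝ (PolyField d) :=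
  Submodule.pi Set.univ (fun _ => polyLT d (k + 1)) ⊔
    (MvPolynomial.homogeneousSubmodule (Fin d) ℝ k).map
      (LinearMap.pi fun i => LinearMap.mulLeft ℝ (MvPolynomial.X i))

/-- The value of a polynomial at a point. -/
def ev {d : ℕ} (p : MvPolynomial (Fin d) ℝ) (x : E d) : ℝ := MvPolynomial.eval (fun i => x i) p

/-- The value of a polynomial vector field at a point. -/
def evF {d : ℕ} (r : PolyField d) (x : E d) : E d := WithLp.toLp 2 fun i => ev (r i) x

/-- The divergence of a polynomial vector field. -/
def pdiv {d : ℕ} (r : PolyField d) : MvPolynomial (Fin d) ℝ := ∑ i, MvPolynomial.pderiv i (r i)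

/-! ### The Raviart-Thomas projection -/

/-- `p` is the Raviart-Thomas projection of order `k` on `K` of the field `q ∈ H¹(K)^d`. -/
structure IsRTProjection {d : ℕ} (k : ℕ) (K : Finset (E d)) (q : E d → E d) (p : PolyField d) :
    Prop where
  mem : p ∈ RTSpace d k
  inner_eq : ∀ r : PolyField d, (∀ i, r i ∈ polyLT d k) →
    ∫ x in cell K, inner ℝ (evF p x) (evF r x) = ∫ x in cell K, inner ℝ (q x) (evF r x)
  normal_eq : ∃ γ : Fin d → E d → ℝ, (∀ i, IsTrace K (fun x => q x i) (γ i)) ∧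
    ∀ μ : Finset (E d) → MvPolynomial (Fin d) ℝ, (∀ e ∈ faces K, μ e ∈ polyLT d (k + 1)) →
      ∑ e ∈ faces K, ∫ x, inner ℝ (evF p x) (normal K e) * ev (μ e) x ∂surf e =
        ∑ e ∈ faces K, ∫ x, (∑ i, γ i x * normal K e i) * ev (μ e) x ∂surf e

/-! ### Discrete spaces

Discrete fields are families of polynomials, one for each element (or each face). -/

/-- The space `V_h`, the product of the Raviart-Thomas spaces of the elements. -/
def Vh {d : ℕ} (T : Mesh d) (k : ℕ) : Set (Finset (E d) → PolyField d) :=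
  {r | ∀ K ∈ T.elements, r K ∈ RTSpace d k}

/-- The space `W_h`, the product of the spaces `P_k(K)` over the elements. -/
def Wh {d : ℕ} (T : Mesh d) (k : ℕ) : Set (Finset (E d) → MvPolynomial (Fin d) ℝ) :=
  {w | ∀ K ∈ T.elements, w K ∈ polyLT d (k + 1)}

/-- The space `M_h`, the product of the spaces `P_k(e)` over the faces; an element of `P_k(e)` is
the restriction to `e` of a polynomial of degree at most `k`. -/
def Mh {d : ℕ} (T : Mesh d) (k : ℕ) : Set (Finset (E d) → MvPolynomial (Fin d) ℝ) :=
  {μ | ∀ e ∈ T.allFaces, μ e ∈ polyLT d (k + 1)}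

/-- Members of `M_h` that vanish on the boundary. -/
def MhInt {d : ℕ} (T : Mesh d) (Ω : Set (E d)) (k : ℕ) :
    Set (Finset (E d) → MvPolynomial (Fin d) ℝ) :=
  {μ | μ ∈ Mh T k ∧ ∀ e ∈ T.allFaces, OnBoundary Ω e → μ e = 0}

/-- Members of `M_h` that vanish on the interior faces. -/
def MhBdry {d : ℕ} (T : Mesh d) (Ω : Set (E d)) (k : ℕ) :
    Set (Finset (E d) → MvPolynomial (Fin d) ℝ) :=
  {μ | μ ∈ Mh T k ∧ ∀ e ∈ T.allFaces, ¬ OnBoundary Ω e → μ e = 0}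

/-- The norm `(∑_K ∫_K c |v_K|²)^{1/2}` of a field given element by element; elements overlap only
in null sets, so this is the `L²(Ω)` norm with weight `c`. -/
def wNorm {d : ℕ} (T : Mesh d) (c : E d → ℝ) (v : Finset (E d) → E d → E d) : ℝ :=
  √(∑ K ∈ T.elements, ∫ x in cell K, c x * ‖v K x‖ ^ 2)

/-! ### The continuous and the discrete problem -/

/-- `(q, u) ∈ H(div,Ω) × H¹(Ω)` solves `κ⁻¹ q + ∇u = 0` and `div q = f` in `Ω`, with `u = u₀` on
the boundary of `Ω` in the sense of traces. -/
structure IsExactSolution {d : ℕ} (T : Mesh d) (Ω : Set (E d)) (κ f u₀ : E d → ℝ)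
    (q : E d → E d) (u : E d → ℝ) : Prop where
  q_memLp : ∀ i, MemLp (fun x => q x i) 2 (volume.restrict Ω)
  flux : ∃ D, IsSobolev Ω 1 u D ∧
    ∀ i, ∀ᵐ x ∂volume.restrict Ω, (κ x)⁻¹ * q x i + D (Pi.single i 1) x = 0
  div_eq : IsWeakDiv Ω q f
  boundary : ∀ K ∈ T.elements, ∀ e ∈ faces K, OnBoundary Ω e →
    ∃ g, IsTrace K u g ∧ g =ᵐ[surf e] u₀

open Classical in
/-- `(q_h, u_h, û_h) ∈ V_h × W_h × M_h` solves the hybridized Raviart-Thomas equations. -/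
structure IsDiscreteSolution {d : ℕ} (T : Mesh d) (Ω : Set (E d)) (k : ℕ) (κ f u₀ : E d → ℝ)
    (qh : Finset (E d) → PolyField d) (uh uhat : Finset (E d) → MvPolynomial (Fin d) ℝ) :
    Prop where
  q_mem : qh ∈ Vh T k
  u_mem : uh ∈ Wh T k
  uhat_mem : uhat ∈ Mh T k
  flux : ∀ r ∈ Vh T k,
    (∑ K ∈ T.elements, ∫ x in cell K, (κ x)⁻¹ * inner ℝ (evF (qh K) x) (evF (r K) x))
      - (∑ K ∈ T.elements, ∫ x in cell K, ev (uh K) x * ev (pdiv (r K)) x)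
      + (∑ K ∈ T.elements, ∑ e ∈ faces K,
          ∫ x, ev (uhat e) x * inner ℝ (evF (r K) x) (normal K e) ∂surf e) = 0
  balance : ∀ w ∈ Wh T k,
    ∑ K ∈ T.elements, ∫ x in cell K, ev (pdiv (qh K)) x * ev (w K) x =
      ∑ K ∈ T.elements, ∫ x in cell K, f x * ev (w K) x
  continuity : ∀ μ ∈ MhInt T Ω k,
    ∑ K ∈ T.elements, ∑ e ∈ (faces K).filter (fun e => ¬ OnBoundary Ω e),
      ∫ x, inner ℝ (evF (qh K) x) (normal K e) * ev (μ e) x ∂surf e = 0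
  boundary : ∀ μ ∈ MhBdry T Ω k,
    ∑ e ∈ T.allFaces.filter (OnBoundary Ω), ∫ x, ev (uhat e) x * ev (μ e) x ∂surf e =
      ∑ e ∈ T.allFaces.filter (OnBoundary Ω), ∫ x, u₀ x * ev (μ e) x ∂surf e

end RTM

end

/-! Let `r = Πq - q_h`, element by element a Raviart–Thomas field. Two facts make `r` an admissible
test function that sees neither `u_h` nor the interior values of `û_h`. Its divergence vanishes: by
the commuting property `div Πq` and `div q_h` have the same moments as `f` against `P_k`, and the
divergence of a Raviart–Thomas field is itself in `P_k` (`Mesh.pdiv_error_eq_zero`). Its normal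
component does not jump across interior faces: the normal moments of `Πq` are those of `q`, which
cancel because `q` has a weak divergence in `L²`, those of `q_h` cancel by the third discrete
equation, and on a flat face the normal component lies in `P_k(e)`, so that its moments determine it
(`Mesh.normal_jump_eq_zero`).

Testing the first discrete equation with `r` leaves only `u₀` on the boundary. Green's formula for
`u` on each element, with `∇u = -κ⁻¹ q`, leaves the same boundary term. Hence `(κ⁻¹ (q - q_h), r) =
0` (`Mesh.flux_orthogonality`), so `‖r‖² = (κ⁻¹ (Πq - q), r)`, which gives (i) in
`Mesh.wNorm_flux_error_le`. No approximation of `u` is involved.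

The argument rests on traces on simplices, which are defined through Green's formula. Their theory
comes from one identity, `integral_surf_eq`: a face integral is a volume integral over the cone with
the opposite vertex as apex. It yields the divergence theorem and the trace inequality; with the
density of smooth functions (`exists_smooth_seq`) it gives existence of traces (`exists_hasTrace`),
while Green's formula tested with the same cone field gives their uniqueness
(`HasTrace.trace_ae_eq`). Conformity of the mesh gives each interior face exactly two elements with
opposite normals (`Mesh.exists_pair`), and test functions concentrated near one face show that jumps
vanish (`Mesh.jump_ae_eq_zero`).

For (ii), estimate (i) reduces everything to `Πq - q` on one element. The projection reproduces
polynomial fields `w` with components in `P_k`, so `Πq - w` is the projection of `q - w`. Choosing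
`w` with the same means of derivatives up to order `k` as `q` and iterating the Poincaré inequality
bounds `q - w` (`exists_poly_approx`). The projection is stable in a scaled `H¹` norm
(`rt_stability`): unisolvence on the reference simplex supplies bounded dual test functions
(`exists_dual`), and an affine pullback carries the moments to any simplex. The geometry enters only
through the products of the diameter with the norms of the barycentric gradients, which shape
regularity bounds. -/

noncomputable section
namespace RTM
-- Simplices in barycentric coordinates: faces, gradients, normals
variable {d : ℕ}

/-- The vertices of an affine basis. -/
def vset (b : AffineBasis (Fin (d + 1)) ℝ (E d)) : Finset (E d) :=
  Finset.univ.map ⟨b, b.ind.injective⟩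

/-- The vertices of the face opposite to the vertex `j`. -/
def vface (b : AffineBasis (Fin (d + 1)) ℝ (E d)) (j : Fin (d + 1)) : Finset (E d) :=
  (Finset.univ.erase j).map ⟨b, b.ind.injective⟩

theorem coe_vface (b : AffineBasis (Fin (d + 1)) ℝ (E d)) (j : Fin (d + 1)) :
    (vface b j : Set (E d)) = b '' {i | i ≠ j} := by
  ext x
  simp only [vface, SetLike.mem_coe, Finset.mem_map, Finset.mem_erase, Finset.mem_univ, and_true,
    Function.Embedding.coeFn_mk, mem_image, mem_ofPred_eq]

theorem exists_affineBasis {K : Finset (E d)} (hc : K.card = d + 1)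
    (hi : AffineIndependent ℝ ((↑) : K → E d)) :
    ∃ b : AffineBasis (Fin (d + 1)) ℝ (E d), vset b = K := by
  have e : K ≃ Fin (d + 1) := K.equivFinOfCardEq hc
  have ht : affineSpan ℝ (Set.range ((↑) : K → E d)) = ⊤ := by
    rw [hi.affineSpan_eq_top_iff_card_eq_finrank_add_one]
    simp [hc]
  refine ⟨(AffineBasis.mk _ hi ht).reindex e, ?_⟩
  ext x
  simp only [vset, Finset.mem_map, Finset.mem_univ, true_and, Function.Embedding.coeFn_mk,
    AffineBasis.coe_reindex, Function.comp_apply]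
  constructor
  · rintro ⟨i, rfl⟩
    exact (e.symm i).2
  · intro hx
    exact ⟨e ⟨x, hx⟩, by simp; rfl⟩

theorem mem_faces_iff (b : AffineBasis (Fin (d + 1)) ℝ (E d)) (e : Finset (E d)) :
    e ∈ faces (vset b) ↔ ∃ j, e = vface b j := by
  classical
  have hcard : (vset b).card = d + 1 := by simp [vset]
  rw [faces, Finset.mem_powersetCard]
  constructor
  · rintro ⟨hs, hc⟩
    have : (vset b \ e).card = 1 := by
      rw [Finset.card_sdiff_of_subset hs]; omega
    obtain ⟨a, ha⟩ := Finset.card_eq_one.1 this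
    have ha' : a ∈ vset b \ e := by rw [ha]; simp
    obtain ⟨ha1, ha2⟩ := Finset.mem_sdiff.1 ha'
    obtain ⟨j, -, rfl⟩ := Finset.mem_map.1 ha1
    refine ⟨j, ?_⟩
    have : e = vset b \ (vset b \ e) := by
      rw [Finset.sdiff_sdiff_eq_self hs]
    rw [this, ha]
    ext x
    simp only [vset, vface, Finset.mem_sdiff, Finset.mem_map, Finset.mem_univ, true_and,
      Finset.mem_singleton, Finset.mem_erase, and_true, Function.Embedding.coeFn_mk]
    constructor
    · rintro ⟨⟨i, rfl⟩, h⟩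
      exact ⟨i, fun hij => h (by rw [hij]), rfl⟩
    · rintro ⟨i, hi, rfl⟩
      exact ⟨⟨i, rfl⟩, fun h => hi (b.ind.injective h)⟩
  · rintro ⟨j, rfl⟩
    refine ⟨Finset.map_subset_map.2 (Finset.subset_univ _), by simp [vface]⟩

theorem vface_injective (b : AffineBasis (Fin (d + 1)) ℝ (E d)) :
    Function.Injective (vface b) := by
  intro i j h
  by_contra hij
  have : b j ∈ vface b i := by
    simp only [vface, Finset.mem_map, Finset.mem_erase, Finset.mem_univ, and_true]
    exact ⟨j, fun h => hij h.symm, rfl⟩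
  rw [h] at this
  simp [vface] at this

theorem faces_vset (b : AffineBasis (Fin (d + 1)) ℝ (E d)) :
    faces (vset b) = Finset.univ.map ⟨vface b, vface_injective b⟩ := by
  ext e
  rw [mem_faces_iff]
  simp [eq_comm]

theorem sum_faces (b : AffineBasis (Fin (d + 1)) ℝ (E d)) {M : Type*} [AddCommMonoid M]
    (F : Finset (E d) → M) : ∑ e ∈ faces (vset b), F e = ∑ j, F (vface b j) := by
  rw [faces_vset, Finset.sum_map]; rfl

/-- One description serves for the simplex (all indices), for its faces (one index omitted) and,
through conformity, for the intersection of two elements. -/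
theorem convexHull_image_eq (b : AffineBasis (Fin (d + 1)) ℝ (E d)) (S : Set (Fin (d + 1))) :
    convexHull ℝ (b '' S) = {x | (∀ j, 0 ≤ b.coord j x) ∧ ∀ j, j ∉ S → b.coord j x = 0} := by
  apply Subset.antisymm
  · refine convexHull_min ?_ ?_
    · rintro _ ⟨i, hi, rfl⟩
      refine ⟨fun j => ?_, fun j hj => ?_⟩
      · rw [b.coord_apply]; split_ifs <;> norm_num
      · rw [b.coord_apply, if_neg]
        rintro rfl
        exact hj hi
    · rintro x ⟨hx, hx'⟩ y ⟨hy, hy'⟩ s t hs ht hst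
      have key : ∀ j, b.coord j (s • x + t • y) = s * b.coord j x + t * b.coord j y := by
        intro j
        have := Convex.combo_affine_apply (f := b.coord j) (x := x) (y := y) hst
        simpa using this
      refine ⟨fun j => ?_, fun j hj => ?_⟩
      · rw [key]
        have := hx j; have := hy j; positivity
      · rw [key, hx' j hj, hy' j hj]; simp
  · rintro x ⟨hx, hx'⟩
    rw [← b.linear_combination_coord_eq_self x]
    have hsub : ∑ i, b.coord i x • b i = ∑ i with b.coord i x ≠ 0, b.coord i x • b i := by
      rw [Finset.sum_filter_of_ne]
      intro i _ h h0
      exact h (by simp [h0])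
    rw [hsub]
    refine (convex_convexHull ℝ _).sum_mem (fun i _ => hx i) ?_ ?_
    · rw [Finset.sum_filter_ne_zero, b.sum_coord_apply_eq_one]
    · intro i hi
      refine subset_convexHull _ _ ⟨i, ?_, rfl⟩
      by_contra h
      exact (Finset.mem_filter.1 hi).2 (hx' i h)

theorem cell_vset (b : AffineBasis (Fin (d + 1)) ℝ (E d)) :
    cell (vset b) = {x | ∀ j, 0 ≤ b.coord j x} := by
  have := convexHull_image_eq b Set.univ
  simpa [cell, vset] using this

theorem cell_vface (b : AffineBasis (Fin (d + 1)) ℝ (E d)) (j : Fin (d + 1)) :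
    cell (vface b j) = {x | (∀ i, 0 ≤ b.coord i x) ∧ b.coord j x = 0} := by
  have := convexHull_image_eq b {i | i ≠ j}
  simp only [mem_ofPred_eq, not_not, forall_eq] at this
  rw [← this, cell, coe_vface]

theorem interior_cell_vset (b : AffineBasis (Fin (d + 1)) ℝ (E d)) :
    interior (cell (vset b)) = {x | ∀ j, 0 < b.coord j x} := by
  rw [← b.interior_convexHull]
  simp [cell, vset]

theorem isCompact_cell (s : Finset (E d)) : IsCompact (cell s) :=
  s.finite_toSet.isCompact_convexHull (𝕜 := ℝ)

theorem convex_cell (s : Finset (E d)) : Convex ℝ (cell s) := convex_convexHull ℝ _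

theorem measurableSet_cell (s : Finset (E d)) : MeasurableSet (cell s) :=
  (isCompact_cell s).isClosed.measurableSet

/-- The gradient of a barycentric coordinate. -/
def grad (b : AffineBasis (Fin (d + 1)) ℝ (E d)) (j : Fin (d + 1)) : E d :=
  (InnerProductSpace.toDual ℝ (E d)).symm (LinearMap.toContinuousLinearMap (b.coord j).linear)

theorem inner_grad (b : AffineBasis (Fin (d + 1)) ℝ (E d)) (j : Fin (d + 1)) (v : E d) :
    inner ℝ (grad b j) v = (b.coord j).linear v := by
  simp [grad]

theorem inner_grad_sub (b : AffineBasis (Fin (d + 1)) ℝ (E d)) (j : Fin (d + 1)) (x y : E d) :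
    inner ℝ (grad b j) (x - y) = b.coord j x - b.coord j y := by
  rw [inner_grad]
  exact (b.coord j).linearMap_vsub x y

theorem coord_add (b : AffineBasis (Fin (d + 1)) ℝ (E d)) (j : Fin (d + 1)) (x v : E d) :
    b.coord j (x + v) = b.coord j x + inner ℝ (grad b j) v := by
  have := inner_grad_sub b j (x + v) x
  rw [add_sub_cancel_left] at this
  rw [this]; ring

theorem sum_grad (b : AffineBasis (Fin (d + 1)) ℝ (E d)) : ∑ j, grad b j = 0 := by
  refine ext_inner_right ℝ fun v => ?_
  rw [sum_inner, inner_zero_left]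
  have h : ∀ j, inner ℝ (grad b j) v = b.coord j v - b.coord j 0 := fun j => by
    rw [← inner_grad_sub, sub_zero]
  simp_rw [h, Finset.sum_sub_distrib, b.sum_coord_apply_eq_one, sub_self]

/-- Linear part of the reproduction of points by barycentric coordinates. In the divergence theorem
it reassembles a direction from its face contributions. -/
theorem sum_inner_grad_smul (b : AffineBasis (Fin (d + 1)) ℝ (E d)) (v : E d) :
    ∑ j, inner ℝ (grad b j) v • b j = v := by
  have h : ∀ j, inner ℝ (grad b j) v = b.coord j v - b.coord j 0 := fun j => by
    rw [← inner_grad_sub, sub_zero]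
  simp_rw [h, sub_smul, Finset.sum_sub_distrib, b.linear_combination_coord_eq_self, sub_zero]

theorem inner_grad_vertex (b : AffineBasis (Fin (d + 1)) ℝ (E d)) (j i l : Fin (d + 1)) :
    inner ℝ (grad b j) (b i - b l) = (if j = i then 1 else 0) - if j = l then (1 : ℝ) else 0 := by
  rw [inner_grad_sub, b.coord_apply, b.coord_apply]

theorem grad_ne_zero (hd : 0 < d) (b : AffineBasis (Fin (d + 1)) ℝ (E d)) (j : Fin (d + 1)) :
    grad b j ≠ 0 := by
  intro h
  have : Nontrivial (Fin (d + 1)) := Fin.nontrivial_iff_two_le.2 (by omega)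
  obtain ⟨i, hi⟩ := exists_ne j
  have := inner_grad_vertex b j j i
  rw [h, inner_zero_left, if_pos rfl, if_neg hi.symm] at this
  norm_num at this

/-- The `j`-th coordinate vanishes at all vertices of the face, so its gradient is orthogonal to
their differences; a dimension count gives the rest. -/
theorem orthogonal_vectorSpan_vface (hd : 0 < d) (b : AffineBasis (Fin (d + 1)) ℝ (E d))
    (j : Fin (d + 1)) :
    (vectorSpan ℝ (vface b j : Set (E d)))ᗮ = ℝ ∙ grad b j := by
  have hle : vectorSpan ℝ (vface b j : Set (E d)) ≤ (ℝ ∙ grad b j)ᗮ := by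
    rw [vectorSpan_def, Submodule.span_le]
    rintro _ ⟨x, hx, y, hy, rfl⟩
    simp only [vface, Finset.coe_map, Finset.coe_erase, Finset.coe_univ] at hx hy
    obtain ⟨i, hi, rfl⟩ := hx
    obtain ⟨l, hl, rfl⟩ := hy
    rw [SetLike.mem_coe, Submodule.mem_orthogonal_singleton_iff_inner_right]
    have := inner_grad_vertex b j i l
    rw [if_neg (fun h => hi.2 h.symm), if_neg (fun h => hl.2 h.symm)] at this
    simpa using this
  have hind : AffineIndependent ℝ (fun i : {i // i ≠ j} => b i) :=
    b.ind.comp_embedding (Function.Embedding.subtype _)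
  have hfr : Module.finrank ℝ (vectorSpan ℝ (vface b j : Set (E d))) = d - 1 := by
    have h1 := hind.finrank_vectorSpan (n := d - 1) (by simp; omega)
    have h2 : Set.range (fun i : {i // i ≠ j} => b i) = (vface b j : Set (E d)) := by
      rw [coe_vface, Set.image_eq_range]; rfl
    rwa [h2] at h1
  have hg := finrank_span_singleton (K := ℝ) (grad_ne_zero hd b j)
  have ho := (ℝ ∙ grad b j).finrank_add_finrank_orthogonal
  rw [finrank_euclideanSpace, Fintype.card_fin, hg] at ho
  have heq : vectorSpan ℝ (vface b j : Set (E d)) = (ℝ ∙ grad b j)ᗮ :=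
    Submodule.eq_of_le_of_finrank_eq hle (by omega)
  rw [heq, Submodule.orthogonal_orthogonal]

theorem normal_vface (hd : 0 < d) (b : AffineBasis (Fin (d + 1)) ℝ (E d)) (j : Fin (d + 1)) :
    normal (vset b) (vface b j) = -(‖grad b j‖⁻¹ • grad b j) := by
  have hg := grad_ne_zero hd b j
  have hn : 0 < ‖grad b j‖ := norm_pos_iff.2 hg
  have hout : outwardVec (vset b) (vface b j) = -((d / ‖grad b j‖ ^ 2) • grad b j) := by
    rw [outwardVec]
    simp only [orthogonal_vectorSpan_vface hd b j]
    rw [Submodule.starProjection_singleton]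
    rw [← neg_smul]
    congr 1
    rw [← neg_div]
    congr 1
    -- For each of the `d` vertices of the face, only the difference with `b j` pairs nontrivially
    -- with the gradient, and it gives `-1`.
    simp only [vface, vset, Finset.sum_map, inner_sum, Function.Embedding.coeFn_mk,
      inner_grad_vertex]
    rw [Finset.sum_congr rfl (g := fun _ => (-1 : ℝ))]
    · simp
    · intro i hi
      simp [(Finset.ne_of_mem_erase hi).symm]
  have hdp : (0 : ℝ) < d := by exact_mod_cast hd
  rw [normal, hout, norm_neg, norm_smul, smul_neg, smul_smul]
  congr 2
  rw [Real.norm_of_nonneg (by positivity)]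
  field_simp

end RTM

end

/-! ### Surface measure on faces and the divergence theorem on a simplex -/

noncomputable section
namespace RTM
variable {d : ℕ}

open scoped ENNReal

theorem coord_homothety (b : AffineBasis (Fin (d + 1)) ℝ (E d)) (j i : Fin (d + 1)) (t : ℝ)
    (y : E d) : b.coord i (AffineMap.homothety (b j) t y) =
      t * b.coord i y + (1 - t) * if i = j then 1 else 0 := by
  rw [AffineMap.homothety_apply, vadd_eq_add, vsub_eq_sub, add_comm (t • _), coord_add,
    inner_smul_right, inner_grad_sub, b.coord_apply]
  ring

/-- The homothety with centre `b j` and ratio `t` multiplies the other coordinates by `t` and moves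
the `j`-th from `0` to `1 - t`. Slices parallel to a face are therefore shrunken copies of it. -/
theorem cell_inter_slice (b : AffineBasis (Fin (d + 1)) ℝ (E d)) (j : Fin (d + 1)) {t : ℝ}
    (ht : 0 < t) (ht1 : t < 1) :
    cell (vset b) ∩ {x | b.coord j x = 1 - t} =
      AffineMap.homothety (b j) t '' cell (vface b j) := by
  ext x
  rw [cell_vset, cell_vface]
  constructor
  · rintro ⟨hx, hxj⟩
    refine ⟨AffineMap.homothety (b j) t⁻¹ x, ⟨fun i => ?_, ?_⟩, ?_⟩
    · rw [coord_homothety]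
      split_ifs with h
      · subst h
        rw [hxj]
        apply le_of_eq; field_simp; ring
      · have := hx i
        simp only [mul_zero, add_zero]; positivity
    · rw [coord_homothety, if_pos rfl, hxj]
      field_simp; ring
    · rw [← AffineMap.homothety_mul_apply, mul_inv_cancel₀ ht.ne', AffineMap.homothety_one]; rfl
  · rintro ⟨y, ⟨hy, hyj⟩, rfl⟩
    refine ⟨fun i => ?_, ?_⟩
    · rw [coord_homothety]
      have := hy i
      have : 0 ≤ 1 - t := by linarith
      split_ifs <;> positivity
    · rw [mem_ofPred_eq, coord_homothety, if_pos rfl, hyj]; ring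

/-- Fubini along the direction orthogonal to the face: the slices are homothetic to the face, and
`(d-1)`-dimensional measure scales with `t ^ (d - 1)`. -/
theorem volume_cell_inter (hd : 0 < d) (b : AffineBasis (Fin (d + 1)) ℝ (E d)) (j : Fin (d + 1))
    {A : Set (E d)} (hA : MeasurableSet A) :
    volume (A ∩ cell (vset b)) = ENNReal.ofReal ‖grad b j‖⁻¹ *
      ∫⁻ t in Ioo (0 : ℝ) 1, ENNReal.ofReal (t ^ (d - 1)) *
        surf (vface b j) (AffineMap.homothety (b j) t ⁻¹' A) := by
  have hg := grad_ne_zero hd b j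
  have hn : 0 < ‖grad b j‖ := norm_pos_iff.2 hg
  -- Normalized so that the inner product with the gradient is `-1`: the point `b j + t • v` has
  -- `j`-th coordinate `1 - t`, and the norm of `v` is the height of the simplex over the face.
  set v : E d := (-(‖grad b j‖ ^ 2)⁻¹) • grad b j with hv
  have hv0 : v ≠ 0 := smul_ne_zero (neg_ne_zero.2 (inv_ne_zero (by positivity))) hg
  have hvn : ‖v‖ₑ = ENNReal.ofReal ‖grad b j‖⁻¹ := by
    rw [← ofReal_norm, hv, norm_smul, norm_neg, norm_inv, norm_pow, norm_norm]
    congr 1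
    field_simp
  have hplane : ∀ t : ℝ, ((AffineSubspace.mk' (t • v +ᵥ b j) (ℝ ∙ v)ᗮ : AffineSubspace ℝ (E d)) :
      Set (E d)) = {x | b.coord j x = 1 - t} := by
    intro t
    ext x
    rw [SetLike.mem_coe, AffineSubspace.mem_mk', Submodule.mem_orthogonal_singleton_iff_inner_right,
      hv, inner_smul_left, vsub_eq_sub, vadd_eq_add, ← hv, mem_ofPred_eq]
    have h1 : inner ℝ (grad b j) v = -1 := by
      rw [hv, inner_smul_right, real_inner_self_eq_norm_sq]
      field_simp
    have h2 : inner ℝ (grad b j) (x - (t • v + b j)) = b.coord j x - 1 + t := by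
      rw [inner_grad_sub, add_comm (t • v), coord_add, inner_smul_right, h1, b.coord_apply, if_pos rfl]
      ring
    rw [h2, mul_eq_zero]
    constructor
    · rintro (h | h)
      · simp at h; exact absurd h hg
      · linarith
    · intro h
      right; linarith
  have hfin : Module.finrank ℝ (E d) = d := by simp
  have := EuclideanGeometry.euclideanHausdorffMeasure_eq_lintegral (b j) hv0
    (hA.inter (measurableSet_cell (vset b)))
  rw [InnerProductSpace.euclideanHausdorffMeasure_eq_volume, hfin, hvn] at this
  rw [this]
  congr 1
  -- Nonnegative coordinates with sum one lie in `[0, 1]`, so the other slices are empty.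
  have hsupp : ∀ t : ℝ, t ∉ Icc (0 : ℝ) 1 →
      Measure.euclideanHausdorffMeasure (d - 1) (A ∩ cell (vset b) ∩
        (AffineSubspace.mk' (t • v +ᵥ b j) (ℝ ∙ v)ᗮ : Set (E d))) = 0 := by
    intro t ht
    refine (congrArg _ ?_).trans measure_empty
    rw [hplane, cell_vset]
    ext x
    simp only [mem_inter_iff, mem_ofPred_eq, mem_empty_iff_false, iff_false, not_and]
    rintro ⟨-, hx⟩ hxj
    apply ht
    have h1 := b.sum_coord_apply_eq_one x
    have h2 : b.coord j x ≤ ∑ i, b.coord i x :=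
      Finset.single_le_sum (fun i _ => hx i) (Finset.mem_univ j)
    have h3 := hx j
    constructor <;> linarith
  rw [← setLIntegral_eq_of_support_subset (s := Icc (0 : ℝ) 1)]
  · rw [← restrict_Ioo_eq_restrict_Icc]
    refine setLIntegral_congr_fun measurableSet_Ioo fun t ht => ?_
    simp only
    rw [hplane, inter_assoc, cell_inter_slice b j ht.1 ht.2, inter_comm, ← image_inter_preimage,
      euclideanHausdorffMeasure_homothety_image _ _ ht.1.ne', surf,
      Measure.restrict_apply', inter_comm]
    · rw [ENNReal.smul_def, smul_eq_mul]
      congr 1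
      rw [ENNReal.coe_pow, ENNReal.ofReal_pow ht.1.le, ← enorm_eq_nnnorm,
        Real.enorm_of_nonneg ht.1.le]
    · exact measurableSet_cell _
  · intro t ht
    by_contra h
    exact ht (hsupp t h)

/-- A face of infinite measure would give the cone over it, the bounded simplex, infinite volume. -/
theorem isFiniteMeasure_surf (hd : 0 < d) (b : AffineBasis (Fin (d + 1)) ℝ (E d))
    (j : Fin (d + 1)) : IsFiniteMeasure (surf (vface b j)) := by
  have hn : 0 < ‖grad b j‖ := norm_pos_iff.2 (grad_ne_zero hd b j)
  have h := volume_cell_inter hd b j MeasurableSet.univ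
  rw [univ_inter] at h
  simp only [preimage_univ] at h
  rw [lintegral_mul_const _ (by fun_prop)] at h
  refine ⟨lt_top_iff_ne_top.2 fun htop => ?_⟩
  have hpos : (∫⁻ t in Ioo (0 : ℝ) 1, ENNReal.ofReal (t ^ (d - 1))) ≠ 0 := by
    rw [Ne, setLIntegral_eq_zero_iff' measurableSet_Ioo (by fun_prop)]
    intro h0
    have : ∀ᵐ t : ℝ, t ∉ Ioo (0 : ℝ) 1 := by
      filter_upwards [h0] with t ht hmem
      have := ht hmem
      rw [ENNReal.ofReal_eq_zero] at this
      have h1 : 0 < t ^ (d - 1) := pow_pos hmem.1 _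
      linarith
    have h2 : volume (Ioo (0 : ℝ) 1) = 0 := measure_eq_zero_iff_ae_notMem.2 this
    simp at h2
  rw [htop, ENNReal.mul_top hpos, ENNReal.mul_top (by simpa using hn)] at h
  exact (isCompact_cell (vset b)).measure_lt_top.ne h

/-- The volume measure on a simplex in polar coordinates centred at a vertex. -/
theorem restrict_cell_eq_map (hd : 0 < d) (b : AffineBasis (Fin (d + 1)) ℝ (E d))
    (j : Fin (d + 1)) :
    volume.restrict (cell (vset b)) = ENNReal.ofReal ‖grad b j‖⁻¹ •
      Measure.map (fun p : ℝ × E d => AffineMap.homothety (b j) p.1 p.2)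
        (((volume.restrict (Ioo (0 : ℝ) 1)).withDensity
          (fun t => ENNReal.ofReal (t ^ (d - 1)))).prod (surf (vface b j))) := by
  have := isFiniteMeasure_surf hd b j
  have hc : Continuous (fun p : ℝ × E d => AffineMap.homothety (b j) p.1 p.2) := by
    simp only [AffineMap.homothety_apply, vadd_eq_add, vsub_eq_sub]
    fun_prop
  ext A hA
  rw [Measure.restrict_apply hA, volume_cell_inter hd b j hA, Measure.smul_apply,
    Measure.map_apply hc.measurable hA, Measure.prod_apply (hc.measurable hA), smul_eq_mul,
    lintegral_withDensity_eq_lintegral_mul _ (by fun_prop)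
      (measurable_measure_prodMk_left (hc.measurable hA))]
  rfl

/-- On the ray from `b j` to a point `y` of the face, the derivative of `t ^ d * φ` is `t ^ (d - 1)`
times the volume integrand. Integrating it over `[0, 1]` leaves `φ y`, and the polar coordinates of
`restrict_cell_eq_map` turn the double integral into one over the simplex. -/
theorem integral_surf_eq (hd : 0 < d) (b : AffineBasis (Fin (d + 1)) ℝ (E d)) (j : Fin (d + 1))
    {φ : E d → ℝ} (hφ : ContDiff ℝ 1 φ) :
    ∫ x, φ x ∂surf (vface b j) =
      ‖grad b j‖ * ∫ x in cell (vset b), (d * φ x + fderiv ℝ φ x (x - b j)) := by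
  have := isFiniteMeasure_surf hd b j
  have hn : 0 < ‖grad b j‖ := norm_pos_iff.2 (grad_ne_zero hd b j)
  have hc : Continuous (fun p : ℝ × E d => AffineMap.homothety (b j) p.1 p.2) := by
    simp only [AffineMap.homothety_apply, vadd_eq_add, vsub_eq_sub]
    fun_prop
  have hF : Continuous (fun x => d * φ x + fderiv ℝ φ x (x - b j)) := by
    have h1 := hφ.continuous
    have h2 := hφ.continuous_fderiv one_ne_zero
    fun_prop
  set F := fun x => d * φ x + fderiv ℝ φ x (x - b j) with hFdef
  have hint : Integrable F (volume.restrict (cell (vset b))) :=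
    hF.continuousOn.integrableOn_compact (isCompact_cell _)
  rw [restrict_cell_eq_map hd b j] at hint ⊢
  have hc0 : ENNReal.ofReal ‖grad b j‖⁻¹ ≠ 0 := by simpa using hn
  rw [integrable_smul_measure hc0 ENNReal.ofReal_ne_top,
    integrable_map_measure hF.aestronglyMeasurable hc.aemeasurable] at hint
  rw [integral_smul_measure, integral_map hc.aemeasurable hF.aestronglyMeasurable,
    ENNReal.toReal_ofReal (by positivity), smul_eq_mul, ← mul_assoc, mul_inv_cancel₀ hn.ne',
    one_mul]
  refine Eq.trans ?_ (integral_prod_symm _ hint).symm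
  refine integral_congr_ae (Filter.Eventually.of_forall fun y => ?_)
  simp only [Function.comp]
  rw [integral_withDensity_eq_integral_toReal_smul (by fun_prop) (by simp)]
  have hderiv : ∀ t : ℝ, HasDerivAt (fun t : ℝ => t ^ d * φ (AffineMap.homothety (b j) t y))
      (t ^ (d - 1) * F (AffineMap.homothety (b j) t y)) t := by
    intro t
    have h1 : HasDerivAt (fun t : ℝ => AffineMap.homothety (b j) t y) (y - b j) t := by
      simp only [AffineMap.homothety_apply, vadd_eq_add, vsub_eq_sub]
      simpa using ((hasDerivAt_id t).smul_const (y - b j)).add_const (b j)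
    have h2 := ((hφ.differentiable one_ne_zero).differentiableAt
      (x := AffineMap.homothety (b j) t y)).hasFDerivAt.comp_hasDerivAt t h1
    have h3 := (hasDerivAt_pow d t).mul h2
    convert! h3 using 1
    have h4 : AffineMap.homothety (b j) t y - b j = t • (y - b j) := by
      simp [AffineMap.homothety_apply]
    simp only [hFdef, h4, map_smul, smul_eq_mul, Function.comp]
    obtain ⟨m, rfl⟩ : ∃ m, d = m + 1 := ⟨d - 1, by omega⟩
    simp only [Nat.add_sub_cancel]
    ring
  have hcont : Continuous (fun t : ℝ => t ^ (d - 1) * F (AffineMap.homothety (b j) t y)) := by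
    have : Continuous (fun t : ℝ => AffineMap.homothety (b j) t y) := by
      simp only [AffineMap.homothety_apply, vadd_eq_add, vsub_eq_sub]
      fun_prop
    fun_prop
  have hftc := intervalIntegral.integral_eq_sub_of_hasDerivAt (a := 0) (b := 1)
    (fun t _ => hderiv t) (hcont.intervalIntegrable _ _)
  rw [intervalIntegral.integral_of_le zero_le_one, integral_Ioc_eq_integral_Ioo] at hftc
  rw [one_pow, zero_pow hd.ne', one_mul, zero_mul, sub_zero, AffineMap.homothety_one] at hftc
  simp only [AffineMap.id_apply] at hftc
  rw [← hftc]
  refine setIntegral_congr_fun measurableSet_Ioo fun t ht => ?_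
  simp only [smul_eq_mul]
  rw [ENNReal.toReal_ofReal (pow_nonneg ht.1.le _)]

/-- The divergence theorem on a simplex. -/
theorem integral_fderiv_cell (hd : 0 < d) (b : AffineBasis (Fin (d + 1)) ℝ (E d))
    {φ : E d → ℝ} (hφ : ContDiff ℝ 1 φ) (v : E d) :
    ∫ x in cell (vset b), fderiv ℝ φ x v =
      ∑ e ∈ faces (vset b), ∫ x, φ x * inner ℝ v (normal (vset b) e) ∂surf e := by
  have h1 := hφ.continuous
  have h2 := hφ.continuous_fderiv one_ne_zero
  have hint : ∀ F : E d → ℝ, Continuous F → IntegrableOn F (cell (vset b)) := fun F hF =>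
    hF.continuousOn.integrableOn_compact (isCompact_cell _)
  rw [sum_faces]
  simp_rw [integral_mul_const, integral_surf_eq hd b _ hφ, normal_vface hd]
  -- Splitting `x - b j` separates a part that `sum_grad` cancels after summation over `j` from a
  -- part in which `sum_inner_grad_smul` recovers `v`.
  have h3 : ∀ j, ‖grad b j‖ * (∫ x in cell (vset b), (d * φ x + fderiv ℝ φ x (x - b j))) *
      inner ℝ v (-(‖grad b j‖⁻¹ • grad b j)) = ∫ x in cell (vset b),
        -(inner ℝ (grad b j) v * (d * φ x + fderiv ℝ φ x x)) +
          inner ℝ (grad b j) v * fderiv ℝ φ x (b j) := by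
    intro j
    have hn : 0 < ‖grad b j‖ := norm_pos_iff.2 (grad_ne_zero hd b j)
    rw [inner_neg_right, inner_smul_right, real_inner_comm]
    have : ‖grad b j‖ * (∫ x in cell (vset b), (d * φ x + fderiv ℝ φ x (x - b j))) *
      -(‖grad b j‖⁻¹ * inner ℝ (grad b j) v) = -inner ℝ (grad b j) v *
        ∫ x in cell (vset b), (d * φ x + fderiv ℝ φ x (x - b j)) := by
      field_simp
    rw [this, ← integral_const_mul]
    congr 1
    ext x
    rw [map_sub]; ring
  simp_rw [h3]
  rw [← integral_finsetSum]
  · congr 1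
    ext x
    rw [Finset.sum_add_distrib, Finset.sum_neg_distrib, ← Finset.sum_mul, ← sum_inner, sum_grad,
      inner_zero_left, zero_mul, neg_zero, zero_add]
    conv_lhs => rw [← sum_inner_grad_smul b v, map_sum]
    simp
  · intro j _
    exact hint _ (by fun_prop)

end RTM

end

/-! ### Mollification and dilation in `L²` -/

noncomputable section
namespace RTM
variable {d : ℕ}

open scoped ENNReal Topology
open Filter

/-- Mollification by a normalized bump function. -/
abbrev mollify (ρ : ContDiffBump (0 : E d)) (f : E d → ℝ) : E d → ℝ :=
  convolution (ρ.normed volume) f (ContinuousLinearMap.lsmul ℝ ℝ) volume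

/-- The mollified value is a mean with respect to a probability measure, so its square is at most
the mean of the square; then Fubini and translation invariance. -/
theorem eLpNorm_mollify_le (ρ : ContDiffBump (0 : E d)) {f : E d → ℝ} (hf : MemLp f 2 volume) :
    eLpNorm (mollify ρ f) 2 volume ≤ eLpNorm f 2 volume := by
  set ν : Measure (E d) := volume.withDensity (fun y => ENNReal.ofReal (ρ.normed volume y)) with hν
  have hρm : Measurable (fun y => ENNReal.ofReal (ρ.normed volume y)) :=
    ρ.continuous_normed.measurable.ennreal_ofReal
  have hprob : IsProbabilityMeasure ν := by
    refine ⟨?_⟩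
    rw [hν, withDensity_apply _ MeasurableSet.univ, setLIntegral_univ,
      ← ofReal_integral_eq_lintegral_ofReal ρ.integrable_normed
        (Eventually.of_forall fun x => ρ.nonneg_normed x), ρ.integral_normed, ENNReal.ofReal_one]
  have hac : ν ≪ volume := withDensity_absolutelyContinuous _ _
  have hsm : ∀ x, AEStronglyMeasurable (fun y => f (x - y)) volume := fun x =>
    hf.aestronglyMeasurable.comp_quasiMeasurePreserving
      (quasiMeasurePreserving_sub_left_of_right_invariant volume x)
  have h1 : ∀ x, ‖mollify ρ f x‖ₑ ^ (2 : ℝ) ≤ ∫⁻ y, ENNReal.ofReal (ρ.normed volume y) *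
      ‖f (x - y)‖ₑ ^ (2 : ℝ) := by
    intro x
    have ha : ‖mollify ρ f x‖ₑ ≤ eLpNorm (fun y => f (x - y)) 1 ν := by
      rw [eLpNorm_one_eq_lintegral_enorm, hν,
        lintegral_withDensity_eq_lintegral_mul₀ hρm.aemeasurable (hsm x).enorm]
      refine (enorm_integral_le_lintegral_enorm _).trans (le_of_eq ?_)
      refine lintegral_congr fun y => ?_
      simp only [ContinuousLinearMap.lsmul_apply, smul_eq_mul, Pi.mul_apply]
      rw [enorm_mul, Real.enorm_of_nonneg (ρ.nonneg_normed y)]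
    have hb := ha.trans (eLpNorm_le_eLpNorm_of_exponent_le (q := 2) (by norm_num)
      ((hsm x).mono_ac hac))
    rw [eLpNorm_eq_lintegral_rpow_enorm_toReal (by norm_num) (by norm_num)] at hb
    have hc := ENNReal.rpow_le_rpow hb (show (0 : ℝ) ≤ 2 by norm_num)
    rw [← ENNReal.rpow_mul] at hc
    simp only [ENNReal.toReal_ofNat, one_div, ne_eq, OfNat.ofNat_ne_zero, not_false_eq_true,
      inv_mul_cancel₀, ENNReal.rpow_one] at hc
    refine hc.trans (le_of_eq ?_)
    rw [hν, lintegral_withDensity_eq_lintegral_mul₀ hρm.aemeasurable ((hsm x).enorm.pow_const 2)]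
    rfl
  rw [eLpNorm_eq_lintegral_rpow_enorm_toReal (by norm_num) (by norm_num),
    eLpNorm_eq_lintegral_rpow_enorm_toReal (by norm_num) (by norm_num)]
  refine ENNReal.rpow_le_rpow ?_ (by positivity)
  simp only [ENNReal.toReal_ofNat]
  calc ∫⁻ x, ‖mollify ρ f x‖ₑ ^ (2 : ℝ)
      ≤ ∫⁻ x, ∫⁻ y, ENNReal.ofReal (ρ.normed volume y) * ‖f (x - y)‖ₑ ^ (2 : ℝ) :=
        lintegral_mono h1
    _ = ∫⁻ y, ∫⁻ x, ENNReal.ofReal (ρ.normed volume y) * ‖f (x - y)‖ₑ ^ (2 : ℝ) := by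
        refine lintegral_lintegral_swap ?_
        refine (hρm.comp measurable_snd).aemeasurable.mul ?_
        have := hf.aestronglyMeasurable.comp_quasiMeasurePreserving
          (quasiMeasurePreserving_sub_of_right_invariant (volume : Measure (E d)) volume)
        exact this.enorm.pow_const 2
    _ = ∫⁻ y, ENNReal.ofReal (ρ.normed volume y) * ∫⁻ x, ‖f x‖ₑ ^ (2 : ℝ) := by
        refine lintegral_congr fun y => ?_
        rw [lintegral_const_mul' _ _ ENNReal.ofReal_ne_top]
        congr 1
        exact lintegral_sub_right_eq_self (fun x => ‖f x‖ₑ ^ (2 : ℝ)) y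
    _ = ∫⁻ x, ‖f x‖ₑ ^ (2 : ℝ) := by
        rw [lintegral_mul_const _ hρm]
        have := hprob.measure_univ
        rw [hν, withDensity_apply _ MeasurableSet.univ, setLIntegral_univ] at this
        rw [this, one_mul]

/-- Only a bound uniform in `t` is needed, so the true factor `t ^ (-d/2)` is replaced by the cruder
`2 ^ d`. -/
theorem eLpNorm_comp_homothety_le (x₀ : E d) {t : ℝ} (ht : 1 / 2 ≤ t) {f : E d → ℝ}
    (hf : AEStronglyMeasurable f volume) :
    eLpNorm (fun x => f (AffineMap.homothety x₀ t x)) 2 volume ≤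
      ENNReal.ofReal (2 ^ d) * eLpNorm f 2 volume := by
  have ht0 : 0 < t := by linarith
  have h1 : ∀ x, AffineMap.homothety x₀ t x = t • x + (x₀ - t • x₀) := fun x => by
    simp only [AffineMap.homothety_apply, vadd_eq_add, vsub_eq_sub, smul_sub]; abel
  have hmap : Measure.map (fun x => AffineMap.homothety x₀ t x) (volume : Measure (E d)) =
      ENNReal.ofReal ((t ^ d)⁻¹) • volume := by
    have h2 : (fun x => AffineMap.homothety x₀ t x) = (fun x => x + (x₀ - t • x₀)) ∘
        (fun x : E d => t • x) := by
      ext1 x; exact h1 x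
    rw [h2, ← Measure.map_map (by fun_prop) (by fun_prop), Measure.map_addHaar_smul _ ht0.ne',
      Measure.map_smul, (measurePreserving_add_right volume (x₀ - t • x₀)).map_eq]
    simp [abs_of_pos ht0]
  have hc : Continuous (fun x => AffineMap.homothety x₀ t x) := by
    simp only [h1]; fun_prop
  have h3 : eLpNorm (fun x => f (AffineMap.homothety x₀ t x)) 2 volume =
      eLpNorm f 2 (Measure.map (fun x => AffineMap.homothety x₀ t x) volume) := by
    rw [eLpNorm_map_measure _ hc.aemeasurable]
    · rfl
    · rw [hmap]; exact hf.smul_measure _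
  rw [h3, hmap, eLpNorm_smul_measure_of_ne_top (by norm_num), smul_eq_mul]
  refine mul_le_mul_left ?_ _
  have h5 : ENNReal.ofReal ((t ^ d)⁻¹) ≤ ENNReal.ofReal (2 ^ d) := by
    refine ENNReal.ofReal_le_ofReal ?_
    rw [← inv_pow]
    refine pow_le_pow_left₀ (by positivity) ?_ _
    rw [inv_le_comm₀ ht0 (by norm_num)]
    linarith
  have h6 : (1 : ℝ≥0∞) ≤ ENNReal.ofReal (2 ^ d) := by
    rw [← ENNReal.ofReal_one]
    exact ENNReal.ofReal_le_ofReal (one_le_pow₀ (by norm_num))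
  calc ENNReal.ofReal ((t ^ d)⁻¹) ^ (1 / (2 : ℝ≥0∞)).toReal
      ≤ ENNReal.ofReal (2 ^ d) ^ (1 / (2 : ℝ≥0∞)).toReal :=
        ENNReal.rpow_le_rpow h5 (by positivity)
    _ ≤ ENNReal.ofReal (2 ^ d) ^ (1 : ℝ) :=
        ENNReal.rpow_le_rpow_of_exponent_le h6 (by simp; norm_num)
    _ = _ := ENNReal.rpow_one _

theorem mollify_sub (ρ : ContDiffBump (0 : E d)) {f g : E d → ℝ} (hf : LocallyIntegrable f volume)
    (hg : LocallyIntegrable g volume) (z : E d) :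
    mollify ρ (f - g) z = mollify ρ f z - mollify ρ g z := by
  have h1 := (ρ.hasCompactSupport_normed (μ := volume)).convolutionExists_left (μ := volume)
    (ContinuousLinearMap.lsmul ℝ ℝ) ρ.continuous_normed hf z
  have h2 := (ρ.hasCompactSupport_normed (μ := volume)).convolutionExists_left (μ := volume)
    (ContinuousLinearMap.lsmul ℝ ℝ) ρ.continuous_normed hg z
  unfold mollify convolution
  rw [← integral_sub h1 h2]
  simp [mul_sub]

/-- Dilation followed by mollification is bounded on `L²` uniformly in `n`, so it suffices to treat
a continuous compactly supported `g` close to `f`; for `g` the convergence is uniform on the bounded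
set `S`. -/
theorem tendsto_eLpNorm_mollify_homothety {S : Set (E d)} (hS : IsCompact S) (x₀ : E d)
    {ρ : ℕ → ContDiffBump (0 : E d)} (hρ : Tendsto (fun n => (ρ n).rOut) atTop (𝓝 0))
    {t : ℕ → ℝ} (ht : Tendsto t atTop (𝓝 1)) {f : E d → ℝ} (hf : MemLp f 2 volume) :
    Tendsto (fun n => eLpNorm (fun x => mollify (ρ n) f (AffineMap.homothety x₀ (t n) x) - f x) 2
      (volume.restrict S)) atTop (𝓝 0) := by
  rw [ENNReal.tendsto_atTop_zero]
  intro ε hε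
  -- The error `f - g` enters twice: transformed, at the cost of `2 ^ d`, and as it stands.
  set C : ℝ≥0∞ := ENNReal.ofReal (2 ^ d) + 1 with hC
  have hC0 : C ≠ 0 := by simp [hC]
  have hCt : C ≠ ⊤ := ENNReal.add_ne_top.2 ⟨ENNReal.ofReal_ne_top, ENNReal.one_ne_top⟩
  obtain ⟨g, hgs, hge, hgc, hgL⟩ := hf.exists_hasCompactSupport_eLpNorm_sub_le (by norm_num)
    (ε := ε / 2 / C) (by simp [ENNReal.div_eq_zero_iff, hε.ne', hCt])
  have hvol : volume S ≠ ⊤ := hS.measure_lt_top.ne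
  -- uniform smallness for the continuous function
  obtain ⟨η, hη, hηε⟩ : ∃ η : ℝ, 0 < η ∧
      (volume.restrict S) univ ^ (2 : ℝ≥0∞).toReal⁻¹ * ENNReal.ofReal η ≤ ε / 2 := by
    rw [Measure.restrict_apply_univ]
    have hV : volume S ^ (2 : ℝ≥0∞).toReal⁻¹ ≠ ⊤ := ENNReal.rpow_ne_top_of_nonneg (by positivity) hvol
    have hcont : Tendsto (fun η : ℝ => volume S ^ (2 : ℝ≥0∞).toReal⁻¹ * ENNReal.ofReal η)
        (𝓝[>] 0) (𝓝 0) := by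
      have := ENNReal.Tendsto.const_mul (a := volume S ^ (2 : ℝ≥0∞).toReal⁻¹)
        (ENNReal.tendsto_ofReal (tendsto_nhdsWithin_of_tendsto_nhds (s := Ioi 0) (a := (0 : ℝ))
          tendsto_id)) (Or.inr hV)
      simpa using this
    have he := (hcont.eventually (ge_mem_nhds (ENNReal.half_pos hε.ne'))).and
      self_mem_nhdsWithin
    obtain ⟨η, h1, h2⟩ := he.exists
    exact ⟨η, h2, h1⟩
  have huc := hgs.uniformContinuous_of_continuous hgc
  rw [Metric.uniformContinuous_iff] at huc
  obtain ⟨δ, hδ, hδg⟩ := huc (η / 2) (by positivity)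
  obtain ⟨R, hR⟩ := hS.isBounded.subset_closedBall x₀
  have e1 : ∀ᶠ n in atTop, (ρ n).rOut < δ := hρ.eventually (gt_mem_nhds hδ)
  have e2 : ∀ᶠ n in atTop, |t n - 1| * |R| < δ := by
    have : Tendsto (fun n => |t n - 1| * |R|) atTop (𝓝 0) := by
      simpa using (((ht.sub_const 1).abs).mul_const |R|)
    exact this.eventually (gt_mem_nhds hδ)
  have e3 : ∀ᶠ n in atTop, 1 / 2 ≤ t n := ht.eventually (le_mem_nhds (by norm_num))
  obtain ⟨N, hN⟩ := ((e1.and e2).and e3).exists_forall_of_atTop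
  refine ⟨N, fun n hn => ?_⟩
  obtain ⟨⟨h1, h2⟩, h3⟩ := hN n hn
  set D := fun x => AffineMap.homothety x₀ (t n) x with hD
  have hDc : Continuous D := by
    simp only [hD, AffineMap.homothety_apply, vadd_eq_add, vsub_eq_sub]; fun_prop
  have hfl := hf.locallyIntegrable (by norm_num)
  have hgl := hgL.locallyIntegrable (by norm_num)
  have hcm : ∀ {h : E d → ℝ}, LocallyIntegrable h volume → Continuous (mollify (ρ n) h) :=
    fun hh => (ρ n).hasCompactSupport_normed.continuous_convolution_left _
      (ρ n).continuous_normed hh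
  have hfg := (hf.sub hgL).locallyIntegrable (by norm_num)
  have hsplit : (fun x => mollify (ρ n) f (D x) - f x) =
      (fun x => mollify (ρ n) (f - g) (D x)) + ((fun x => mollify (ρ n) g (D x) - g x) +
        (g - f)) := by
    ext x
    simp only [Pi.add_apply, Pi.sub_apply, mollify_sub (ρ n) hfl hgl]
    ring
  have b1 : eLpNorm (fun x => mollify (ρ n) (f - g) (D x)) 2 (volume.restrict S) ≤
      ENNReal.ofReal (2 ^ d) * (ε / 2 / C) := by
    refine (eLpNorm_mono_measure _ Measure.restrict_le_self).trans ?_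
    refine (eLpNorm_comp_homothety_le x₀ h3 (hcm hfg).aestronglyMeasurable).trans ?_
    exact mul_le_mul_right ((eLpNorm_mollify_le _ (hf.sub hgL)).trans hge) _
  have b2 : eLpNorm (fun x => mollify (ρ n) g (D x) - g x) 2 (volume.restrict S) ≤ ε / 2 := by
    refine (eLpNorm_le_of_ae_bound (C := η) ?_).trans hηε
    rw [ae_restrict_iff' hS.measurableSet]
    refine Eventually.of_forall fun x hx => ?_
    rw [← dist_eq_norm]
    have c1 : dist (mollify (ρ n) g (D x)) (g (D x)) ≤ η / 2 := by
      refine ContDiffBump.dist_normed_convolution_le hgc.aestronglyMeasurable fun y hy => ?_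
      exact (hδg ((Metric.mem_ball.1 hy).trans h1)).le
    have c2 : dist (g (D x)) (g x) ≤ η / 2 := by
      refine (hδg ?_).le
      have : D x - x = (t n - 1) • (x - x₀) := by
        simp only [hD, AffineMap.homothety_apply, vadd_eq_add, vsub_eq_sub, sub_smul, one_smul]
        abel
      rw [dist_eq_norm, this, norm_smul, Real.norm_eq_abs, ← dist_eq_norm]
      refine lt_of_le_of_lt ?_ h2
      exact mul_le_mul_of_nonneg_left ((Metric.mem_closedBall.1 (hR hx)).trans (le_abs_self R))
        (abs_nonneg _)
    linarith [dist_triangle (mollify (ρ n) g (D x)) (g (D x)) (g x)]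
  have b3 : eLpNorm (g - f) 2 (volume.restrict S) ≤ ε / 2 / C := by
    rw [eLpNorm_sub_comm]
    exact (eLpNorm_mono_measure _ Measure.restrict_le_self).trans hge
  rw [hsplit]
  have m1 : AEStronglyMeasurable (fun x => mollify (ρ n) (f - g) (D x)) (volume.restrict S) :=
    ((hcm hfg).comp hDc).aestronglyMeasurable
  have m2 : AEStronglyMeasurable (fun x => mollify (ρ n) g (D x) - g x) (volume.restrict S) :=
    (((hcm hgl).comp hDc).sub hgc).aestronglyMeasurable
  have m3 : AEStronglyMeasurable (g - f) (volume.restrict S) :=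
    (hgL.sub hf).aestronglyMeasurable.restrict
  refine (eLpNorm_add_le m1 (m2.add m3) (by norm_num)).trans ?_
  refine (add_le_add le_rfl (eLpNorm_add_le m2 m3 (by norm_num))).trans ?_
  refine (add_le_add b1 (add_le_add b2 b3)).trans ?_
  have : ENNReal.ofReal (2 ^ d) * (ε / 2 / C) + (ε / 2 + ε / 2 / C) =
      C * (ε / 2 / C) + ε / 2 := by
    rw [hC]; ring
  rw [this, ENNReal.mul_div_cancel hC0 hCt, ENNReal.add_halves]

end RTM

end

/-! ### Density of smooth functions in `H¹` of a convex body -/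

noncomputable section
namespace RTM
variable {d : ℕ}

open scoped ENNReal Topology
open Filter

theorem interior_ae_eq_of_convex {S : Set (E d)} (hS : Convex ℝ S) :
    interior S =ᵐ[volume] S :=
  interior_ae_eq_of_null_frontier (hS.addHaar_frontier volume)

/-- The derivative falls on the kernel. Since its support around `z` stays inside the interior of
`S`, the translated kernel is a test function there, and the weak derivative may be used although
the extension by zero has no weak derivative in general. -/
theorem pd_mollify_eq {S : Set (E d)} (hconv : Convex ℝ S) (hS : IsCompact S) {i : Fin d}
    {w G : E d → ℝ} (hw : MemLp w 2 (volume.restrict S))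
    (h : IsWeakPartial (interior S) i w G) (ρ : ContDiffBump (0 : E d)) {z : E d}
    (hz : Metric.closedBall z ρ.rOut ⊆ interior S) :
    pd i (mollify ρ (S.indicator w)) z = mollify ρ (S.indicator G) z := by
  have hwL : MemLp (S.indicator w) 2 volume := (memLp_indicator_iff_restrict hS.measurableSet).2 hw
  have hwl := hwL.locallyIntegrable (by norm_num)
  have hcs := ρ.hasCompactSupport_normed (μ := (volume : Measure (E d)))
  have hcd : ContDiff ℝ ∞ (ρ.normed (volume : Measure (E d))) := ρ.contDiff_normed
  have hcd1 : ContDiff ℝ 1 (ρ.normed (volume : Measure (E d))) := ρ.contDiff_normed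
  have hfd : Continuous (fderiv ℝ (ρ.normed (volume : Measure (E d)))) :=
    hcd1.continuous_fderiv one_ne_zero
  have h1 := (hcs.hasFDerivAt_convolution_left (ContinuousLinearMap.lsmul ℝ ℝ) hcd1 hwl z).fderiv
  have hex := (hcs.fderiv ℝ).convolutionExists_left (μ := volume)
    (ContinuousLinearMap.precompL (E d) (ContinuousLinearMap.lsmul ℝ ℝ)) hfd hwl z
  set φ : E d → ℝ := fun y => ρ.normed volume (z - y) with hφ
  have hφt : IsTest (interior S) φ := by
    refine ⟨hcd.comp (by fun_prop), ?_, ?_⟩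
    · exact hcs.comp_homeomorph (Homeomorph.subLeft z)
    · refine (closure_minimal ?_ Metric.isClosed_closedBall).trans hz
      intro y hy
      have : z - y ∈ Function.support (ρ.normed (volume : Measure (E d))) := hy
      rw [ρ.support_normed_eq, mem_ball_zero_iff, ← dist_eq_norm, dist_comm] at this
      exact Metric.mem_closedBall.2 this.le
  have hφd : ∀ y, pd i φ y = -fderiv ℝ (ρ.normed volume) (z - y) (EuclideanSpace.single i 1) := by
    intro y
    have e1 : HasFDerivAt φ ((fderiv ℝ (ρ.normed volume) (z - y)).comp
        (-ContinuousLinearMap.id ℝ (E d))) y := by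
      have e0 : HasFDerivAt (fun y : E d => z - y) (-ContinuousLinearMap.id ℝ (E d)) y :=
        (hasFDerivAt_id y).const_sub z
      exact ((hcd1.differentiable one_ne_zero) (z - y)).hasFDerivAt.comp y e0
    rw [pd, e1.fderiv]
    simp
  rw [pd, h1, convolution, ContinuousLinearMap.integral_apply hex]
  have h2 : ∀ t, (((ContinuousLinearMap.precompL (E d) (ContinuousLinearMap.lsmul ℝ ℝ))
      (fderiv ℝ (ρ.normed volume) t)) (S.indicator w (z - t))) (EuclideanSpace.single i 1) =
      fderiv ℝ (ρ.normed volume) t (EuclideanSpace.single i 1) * S.indicator w (z - t) := by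
    intro t
    simp [ContinuousLinearMap.precompL_apply]
  simp_rw [h2]
  rw [← integral_sub_left_eq_self _ volume z]
  simp only [sub_sub_cancel]
  have h3 : mollify ρ (S.indicator G) z = ∫ y in S, G y * φ y := by
    rw [mollify, convolution_eq_swap, ← integral_indicator hS.measurableSet]
    refine integral_congr_ae (Eventually.of_forall fun y => ?_)
    by_cases hy : y ∈ S <;> simp [hy, hφ, mul_comm]
  have h4 : ∫ y, fderiv ℝ (ρ.normed volume) (z - y) (EuclideanSpace.single i 1) *
      S.indicator w y = -∫ y in S, w y * pd i φ y := by
    rw [← integral_neg, ← integral_indicator hS.measurableSet]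
    refine integral_congr_ae (Eventually.of_forall fun y => ?_)
    by_cases hy : y ∈ S <;> simp [hy, hφd, mul_comm]
  have h5 := h φ hφt
  rw [h3, h4]
  rw [setIntegral_congr_set (interior_ae_eq_of_convex hconv),
    setIntegral_congr_set (interior_ae_eq_of_convex hconv)] at h5
  rw [h5, neg_neg]

/-- Functions that are smooth up to the boundary are dense in `H¹` of a convex body. -/
theorem exists_smooth_seq {S : Set (E d)} (hconv : Convex ℝ S) (hS : IsCompact S)
    (hint : (interior S).Nonempty) {w : E d → ℝ} {G : Fin d → E d → ℝ}
    (hw : MemLp w 2 (volume.restrict S)) (hG : ∀ i, MemLp (G i) 2 (volume.restrict S))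
    (h : ∀ i, IsWeakPartial (interior S) i w (G i)) :
    ∃ φ : ℕ → E d → ℝ, (∀ n, ContDiff ℝ ∞ (φ n)) ∧
      Tendsto (fun n => eLpNorm (φ n - w) 2 (volume.restrict S)) atTop (𝓝 0) ∧
      ∀ i, Tendsto (fun n => eLpNorm (pd i (φ n) - G i) 2 (volume.restrict S)) atTop (𝓝 0) := by
  obtain ⟨x₀, hx₀⟩ := hint
  obtain ⟨R, hR, hball⟩ := Metric.isOpen_iff.1 isOpen_interior x₀ hx₀
  set δ : ℕ → ℝ := fun n => 1 / ((n : ℝ) + 1) / 2 with hδ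
  have hδ0 : ∀ n, 0 < δ n := fun n => by simp only [hδ]; positivity
  have hδ1 : ∀ n, δ n ≤ 1 / 2 := fun n => by
    have : 1 / ((n : ℝ) + 1) ≤ 1 := by
      rw [div_le_one (by positivity)]; linarith [(Nat.cast_nonneg n : (0 : ℝ) ≤ n)]
    simp only [hδ]; linarith
  have hδt : Tendsto δ atTop (𝓝 0) := by
    simpa [hδ] using (tendsto_one_div_add_atTop_nhds_zero_nat (𝕜 := ℝ)).div_const 2
  have hpos : ∀ n, 0 < δ n * R / 4 := fun n => by have := hδ0 n; positivity
  -- `S` contains a ball of radius `R` around `x₀`, so shrinking by `1 - δ n` keeps a distance `δ n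
  -- * R` from the boundary. An outer radius of half that distance keeps the kernel inside.
  set ρ : ℕ → ContDiffBump (0 : E d) := fun n =>
    ⟨δ n * R / 4, δ n * R / 2, hpos n, by linarith [hpos n]⟩ with hρ
  have hρt : Tendsto (fun n => (ρ n).rOut) atTop (𝓝 0) := by
    simpa using (hδt.mul_const R).div_const 2
  have ht : Tendsto (fun n => 1 - δ n) atTop (𝓝 1) := by
    simpa using hδt.const_sub 1
  have hin : ∀ n, ∀ x ∈ S, Metric.closedBall (AffineMap.homothety x₀ (1 - δ n) x) (ρ n).rOut ⊆
      interior S := by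
    intro n x hx y hy
    -- Blowing up the offset of `y` by `1 / δ n` gives a point `y'` of the ball around `x₀`, and `y`
    -- is the convex combination of `x` and `y'` with weights `1 - δ n` and `δ n`.
    have hd0 := hδ0 n
    set y' : E d := x₀ + (δ n)⁻¹ • (y - AffineMap.homothety x₀ (1 - δ n) x) with hy'
    have hy'b : y' ∈ interior S := by
      apply hball
      rw [hy', Metric.mem_ball, dist_eq_norm, add_sub_cancel_left, norm_smul, norm_inv,
        Real.norm_of_nonneg hd0.le, ← dist_eq_norm, inv_mul_lt_iff₀ hd0]
      refine lt_of_le_of_lt (Metric.mem_closedBall.1 hy) ?_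
      change δ n * R / 2 < δ n * R
      have := hpos n
      linarith
    have hyeq : y = (1 - δ n) • x + δ n • y' := by
      rw [hy', smul_add, smul_smul, mul_inv_cancel₀ hd0.ne', one_smul]
      simp only [AffineMap.homothety_apply, vadd_eq_add, vsub_eq_sub, sub_smul, smul_sub, one_smul]
      abel
    rw [hyeq]
    exact hconv.combo_self_interior_mem_interior hx hy'b (by linarith [hδ1 n]) hd0 (by ring)
  have hind : ∀ {v : E d → ℝ}, MemLp v 2 (volume.restrict S) → MemLp (S.indicator v) 2 volume :=
    fun hv => (memLp_indicator_iff_restrict hS.measurableSet).2 hv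
  have hae : ∀ v : E d → ℝ, ∀ᵐ x ∂volume.restrict S, S.indicator v x = v x := fun v =>
    indicator_ae_eq_restrict hS.measurableSet
  set D : ℕ → E d → E d := fun n x => AffineMap.homothety x₀ (1 - δ n) x with hD
  have hDd : ∀ n x, HasFDerivAt (D n) ((1 - δ n) • ContinuousLinearMap.id ℝ (E d)) x := by
    intro n x
    simp only [hD, AffineMap.homothety_apply, vadd_eq_add, vsub_eq_sub]
    exact (((hasFDerivAt_id x).sub_const x₀).const_smul (1 - δ n)).add_const x₀
  have hDc : ∀ n, ContDiff ℝ ∞ (D n) := by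
    intro n
    simp only [hD, AffineMap.homothety_apply, vadd_eq_add, vsub_eq_sub]
    fun_prop
  have hmc : ∀ n, ContDiff ℝ ∞ (mollify (ρ n) (S.indicator w)) := fun n =>
    ((ρ n).hasCompactSupport_normed (μ := volume)).contDiff_convolution_left _
      (ρ n).contDiff_normed ((hind hw).locallyIntegrable (by norm_num))
  refine ⟨fun n x => mollify (ρ n) (S.indicator w) (D n x), fun n => (hmc n).comp (hDc n), ?_,
    fun i => ?_⟩
  · refine (tendsto_eLpNorm_mollify_homothety hS x₀ hρt ht (hind hw)).congr fun n => ?_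
    refine eLpNorm_congr_ae ?_
    filter_upwards [hae w] with x hx
    simp [hx, hD]
  -- The dilation contributes the factor `1 - δ n`; its deviation from one costs only `δ n` times
  -- the norm of `G i`.
  · have hpd : ∀ n, ∀ x ∈ S, pd i (fun x => mollify (ρ n) (S.indicator w) (D n x)) x =
        (1 - δ n) * mollify (ρ n) (S.indicator (G i)) (D n x) := by
      intro n x hx
      have e1 := (((hmc n).differentiable (by norm_num)) (D n x)).hasFDerivAt.comp x (hDd n x)
      have e2 := pd_mollify_eq hconv hS hw (h i) (ρ n) (hin n x hx)
      rw [pd] at e2 ⊢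
      change fderiv ℝ (mollify (ρ n) (S.indicator w) ∘ D n) x _ = _
      rw [e1.fderiv]
      simp [e2, hD]
    have hGt := tendsto_eLpNorm_mollify_homothety hS x₀ hρt ht (hind (hG i))
    have hδe : Tendsto (fun n => ENNReal.ofReal (δ n) * eLpNorm (G i) 2 (volume.restrict S)) atTop
        (𝓝 0) := by
      have := ENNReal.Tendsto.mul_const (b := eLpNorm (G i) 2 (volume.restrict S))
        (ENNReal.tendsto_ofReal hδt) (Or.inr (hG i).eLpNorm_ne_top)
      simpa using this
    have hsum := hGt.add hδe
    rw [add_zero] at hsum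
    refine tendsto_of_tendsto_of_tendsto_of_le_of_le tendsto_const_nhds hsum (fun _ => zero_le)
      fun n => ?_
    have hmG : Continuous (mollify (ρ n) (S.indicator (G i))) :=
      ((ρ n).hasCompactSupport_normed (μ := volume)).continuous_convolution_left _
        (ρ n).continuous_normed ((hind (hG i)).locallyIntegrable (by norm_num))
    set A : E d → ℝ := fun x => mollify (ρ n) (S.indicator (G i)) (D n x) - S.indicator (G i) x
    have hA : AEStronglyMeasurable A (volume.restrict S) :=
      (hmG.comp (hDc n).continuous).aestronglyMeasurable.sub
        (hind (hG i)).aestronglyMeasurable.restrict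
    have e3 : eLpNorm (pd i (fun x => mollify (ρ n) (S.indicator w) (D n x)) - G i) 2
        (volume.restrict S) = eLpNorm ((1 - δ n) • A + (-δ n) • G i) 2 (volume.restrict S) := by
      refine eLpNorm_congr_ae ?_
      filter_upwards [hae (G i), ae_restrict_mem hS.measurableSet] with x hx hxS
      simp only [Pi.sub_apply, Pi.add_apply, Pi.smul_apply, hpd n x hxS, A, hx, smul_eq_mul]
      ring
    rw [e3]
    refine (eLpNorm_add_le (hA.const_smul _) ((hG i).aestronglyMeasurable.const_smul _)
      (by norm_num)).trans ?_
    rw [eLpNorm_const_smul, eLpNorm_const_smul, enorm_neg, Real.enorm_of_nonneg (hδ0 n).le]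
    refine add_le_add ?_ le_rfl
    rw [Real.enorm_of_nonneg (by linarith [hδ1 n])]
    refine (mul_le_mul_left (ENNReal.ofReal_le_ofReal (q := 1) (by linarith [hδ0 n])) _).trans ?_
    rw [ENNReal.ofReal_one, one_mul]

end RTM

end

/-! ### `L²` limits, Green's formula and the trace inequality for smooth functions -/

noncomputable section
namespace RTM
variable {d : ℕ}

open scoped ENNReal Topology
open Filter

section L2

variable {α : Type*} [MeasurableSpace α] {μ : Measure α}

theorem integral_sq_eq {f : α → ℝ} (hf : MemLp f 2 μ) :
    ∫ x, f x ^ 2 ∂μ = (eLpNorm f 2 μ).toReal ^ 2 := by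
  have h0 : 0 ≤ ∫ x, f x ^ 2 ∂μ := integral_nonneg fun x => sq_nonneg _
  rw [hf.eLpNorm_eq_integral_rpow_norm (by norm_num) (by norm_num)]
  simp only [ENNReal.toReal_ofNat, Real.rpow_two, Real.norm_eq_abs, sq_abs]
  rw [ENNReal.toReal_ofReal (by positivity), ← Real.rpow_natCast, ← Real.rpow_mul h0]
  norm_num

theorem integrable_mul {f g : α → ℝ} (hf : MemLp f 2 μ) (hg : MemLp g 2 μ) :
    Integrable (fun x => f x * g x) μ :=
  hf.integrable_mul hg

theorem integrable_sq {f : α → ℝ} (hf : MemLp f 2 μ) : Integrable (fun x => f x ^ 2) μ :=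
  hf.integrable_sq

/-- The Cauchy-Schwarz inequality. -/
theorem sq_integral_mul_le {f g : α → ℝ} (hf : MemLp f 2 μ) (hg : MemLp g 2 μ) :
    (∫ x, f x * g x ∂μ) ^ 2 ≤ (∫ x, f x ^ 2 ∂μ) * ∫ x, g x ^ 2 ∂μ := by
  have h : ∀ t : ℝ, 0 ≤ (∫ x, g x ^ 2 ∂μ) * (t * t) + (2 * ∫ x, f x * g x ∂μ) * t +
      ∫ x, f x ^ 2 ∂μ := by
    intro t
    have e : ∫ x, (f x + t * g x) ^ 2 ∂μ = (∫ x, g x ^ 2 ∂μ) * (t * t) +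
        (2 * ∫ x, f x * g x ∂μ) * t + ∫ x, f x ^ 2 ∂μ := by
      have e1 : ∀ x, (f x + t * g x) ^ 2 =
          (t * t) * g x ^ 2 + (2 * t) * (f x * g x) + f x ^ 2 := fun x => by ring
      simp_rw [e1]
      have i1 : Integrable (fun x => (t * t) * g x ^ 2 + (2 * t) * (f x * g x)) μ :=
        ((integrable_sq hg).const_mul _).add ((integrable_mul hf hg).const_mul _)
      rw [integral_add i1 (integrable_sq hf), integral_add ((integrable_sq hg).const_mul _)
        ((integrable_mul hf hg).const_mul _), integral_const_mul, integral_const_mul]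
      ring
    rw [← e]
    exact integral_nonneg fun x => sq_nonneg _
  have := discrim_le_zero h
  rw [discrim] at this
  linarith

theorem abs_integral_mul_le {f g : α → ℝ} (hf : MemLp f 2 μ) (hg : MemLp g 2 μ) :
    |∫ x, f x * g x ∂μ| ≤ √(∫ x, f x ^ 2 ∂μ) * √(∫ x, g x ^ 2 ∂μ) := by
  rw [← Real.sqrt_mul (integral_nonneg fun x => sq_nonneg _)]
  exact Real.abs_le_sqrt (sq_integral_mul_le hf hg)

theorem tendsto_integral_sq {f : ℕ → α → ℝ} {g : α → ℝ} (hf : ∀ n, MemLp (f n) 2 μ)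
    (hg : MemLp g 2 μ) (h : Tendsto (fun n => eLpNorm (f n - g) 2 μ) atTop (𝓝 0)) :
    Tendsto (fun n => ∫ x, (f n x - g x) ^ 2 ∂μ) atTop (𝓝 0) := by
  have h1 : ∀ n, ∫ x, (f n x - g x) ^ 2 ∂μ = (eLpNorm (f n - g) 2 μ).toReal ^ 2 := fun n =>
    integral_sq_eq ((hf n).sub hg)
  simp_rw [h1]
  have := ((ENNReal.tendsto_toReal ENNReal.zero_ne_top).comp h).pow 2
  simpa using this

theorem tendsto_integral_mul {f : ℕ → α → ℝ} {g ψ : α → ℝ} (hf : ∀ n, MemLp (f n) 2 μ)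
    (hg : MemLp g 2 μ) (hψ : MemLp ψ 2 μ)
    (h : Tendsto (fun n => ∫ x, (f n x - g x) ^ 2 ∂μ) atTop (𝓝 0)) :
    Tendsto (fun n => ∫ x, f n x * ψ x ∂μ) atTop (𝓝 (∫ x, g x * ψ x ∂μ)) := by
  rw [tendsto_iff_dist_tendsto_zero]
  have hb : Tendsto (fun n => √(∫ x, (f n x - g x) ^ 2 ∂μ) * √(∫ x, ψ x ^ 2 ∂μ)) atTop (𝓝 0) := by
    have := ((Real.continuous_sqrt.tendsto _).comp h).mul_const (√(∫ x, ψ x ^ 2 ∂μ))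
    simpa using this
  refine squeeze_zero (fun _ => dist_nonneg) (fun n => ?_) hb
  rw [Real.dist_eq, ← integral_sub (integrable_mul (hf n) hψ) (integrable_mul hg hψ)]
  have : ∀ x, f n x * ψ x - g x * ψ x = (f n x - g x) * ψ x := fun x => by ring
  simp_rw [this]
  exact abs_integral_mul_le ((hf n).sub hg) hψ

theorem tendsto_integral_sq_right {f : ℕ → α → ℝ} {g : α → ℝ} (hf : ∀ n, MemLp (f n) 2 μ)
    (hg : MemLp g 2 μ) (h : Tendsto (fun n => ∫ x, (f n x - g x) ^ 2 ∂μ) atTop (𝓝 0)) :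
    Tendsto (fun n => ∫ x, f n x ^ 2 ∂μ) atTop (𝓝 (∫ x, g x ^ 2 ∂μ)) := by
  have h1 := (h.add ((tendsto_integral_mul hf hg hg h).const_mul 2)).sub_const
    (∫ x, g x ^ 2 ∂μ)
  simp only [← pow_two] at h1
  have h3 : 0 + 2 * ∫ x, g x ^ 2 ∂μ - ∫ x, g x ^ 2 ∂μ = ∫ x, g x ^ 2 ∂μ := by ring
  rw [h3] at h1
  refine h1.congr fun n => ?_
  have e : ∀ x, (f n x - g x) ^ 2 = f n x ^ 2 - 2 * (f n x * g x) + g x ^ 2 := fun x => by ring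
  simp_rw [e]
  have i1 : Integrable (fun x => f n x ^ 2 - 2 * (f n x * g x)) μ :=
    (integrable_sq (hf n)).sub ((integrable_mul (hf n) hg).const_mul 2)
  rw [integral_add i1 (integrable_sq hg), integral_sub (integrable_sq (hf n))
    ((integrable_mul (hf n) hg).const_mul 2), integral_const_mul]
  ring

/-- Completeness of `L²`. A bound of the form `B m + B n` is what comparison of both terms with a
common limit provides. -/
theorem exists_L2_limit {f : ℕ → α → ℝ} (hf : ∀ n, MemLp (f n) 2 μ) {B : ℕ → ℝ}
    (hB : Tendsto B atTop (𝓝 0))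
    (h : ∀ m n, ∫ x, (f m x - f n x) ^ 2 ∂μ ≤ B m + B n) :
    ∃ g, MemLp g 2 μ ∧ Tendsto (fun n => ∫ x, (f n x - g x) ^ 2 ∂μ) atTop (𝓝 0) := by
  set u : ℕ → Lp ℝ 2 μ := fun n => (hf n).toLp (f n) with hu
  have hdist : ∀ m n, dist (u m) (u n) ^ 2 = ∫ x, (f m x - f n x) ^ 2 ∂μ := by
    intro m n
    rw [dist_edist, Lp.edist_toLp_toLp]
    exact (integral_sq_eq ((hf m).sub (hf n))).symm
  have hc : CauchySeq u := by
    rw [Metric.cauchySeq_iff]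
    intro ε hε
    have := hB.eventually (gt_mem_nhds (show (0 : ℝ) < ε ^ 2 / 2 by positivity))
    obtain ⟨N, hN⟩ := this.exists_forall_of_atTop
    refine ⟨N, fun m hm n hn => ?_⟩
    refine lt_of_pow_lt_pow_left₀ 2 hε.le ?_
    rw [hdist]
    linarith [h m n, hN m hm, hN n hn]
  obtain ⟨v, hv⟩ := cauchySeq_tendsto_of_complete hc
  refine ⟨v, Lp.memLp v, ?_⟩
  refine tendsto_integral_sq hf (Lp.memLp v) ?_
  have h1 := tendsto_iff_edist_tendsto_0.1 hv
  refine h1.congr fun n => ?_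
  rw [Lp.edist_def]
  refine eLpNorm_congr_ae ?_
  filter_upwards [(hf n).coeFn_toLp] with x hx
  simp [hu, hx]

end L2

theorem memLp_cell_of_continuous (s : Finset (E d)) {f : E d → ℝ} (hf : Continuous f)
    (p : ℝ≥0∞) : MemLp f p (volume.restrict (cell s)) := by
  have : IsFiniteMeasure (volume.restrict (cell s)) :=
    ⟨by rw [Measure.restrict_apply_univ]; exact (isCompact_cell s).measure_lt_top⟩
  obtain ⟨C, hC⟩ := (isCompact_cell s).exists_bound_of_continuousOn hf.continuousOn
  exact MemLp.of_bound hf.aestronglyMeasurable C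
    ((ae_restrict_mem (measurableSet_cell s)).mono hC)

theorem memLp_surf_of_continuous (hd : 0 < d) (b : AffineBasis (Fin (d + 1)) ℝ (E d))
    (j : Fin (d + 1)) {f : E d → ℝ} (hf : Continuous f) (p : ℝ≥0∞) :
    MemLp f p (surf (vface b j)) := by
  have := isFiniteMeasure_surf hd b j
  obtain ⟨C, hC⟩ := (isCompact_cell (vface b j)).exists_bound_of_continuousOn hf.continuousOn
  exact MemLp.of_bound hf.aestronglyMeasurable C
    ((ae_restrict_mem (measurableSet_cell _)).mono hC)

theorem fderiv_eq_sum_pd (φ : E d → ℝ) (x v : E d) :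
    fderiv ℝ φ x v = ∑ i, v i * pd i φ x := by
  have : v = ∑ i, v i • EuclideanSpace.single i (1 : ℝ) := by
    ext j; simp [Pi.single_apply]
  conv_lhs => rw [this, map_sum]
  simp [pd]

theorem pd_mul {i : Fin d} {φ ψ : E d → ℝ} {x : E d} (hφ : DifferentiableAt ℝ φ x)
    (hψ : DifferentiableAt ℝ ψ x) :
    pd i (fun y => φ y * ψ y) x = φ x * pd i ψ x + ψ x * pd i φ x := by
  rw [pd, fderiv_fun_mul hφ hψ]
  simp [pd]

theorem pd_sub {i : Fin d} {φ ψ : E d → ℝ} {x : E d} (hφ : DifferentiableAt ℝ φ x)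
    (hψ : DifferentiableAt ℝ ψ x) :
    pd i (fun y => φ y - ψ y) x = pd i φ x - pd i ψ x := by
  rw [pd, fderiv_fun_sub hφ hψ]
  simp [pd]

theorem continuous_pd {i : Fin d} {φ : E d → ℝ} {n : ℕ∞} (hφ : ContDiff ℝ n φ) (hn : n ≠ 0) :
    Continuous (pd i φ) := by
  have := hφ.continuous_fderiv (by exact_mod_cast hn)
  unfold pd
  fun_prop

theorem green_smooth (hd : 0 < d) (b : AffineBasis (Fin (d + 1)) ℝ (E d)) {φ ψ : E d → ℝ}
    (hφ : ContDiff ℝ 1 φ) (hψ : ContDiff ℝ 1 ψ) (i : Fin d) :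
    (∫ x in cell (vset b), φ x * pd i ψ x) + (∫ x in cell (vset b), pd i φ x * ψ x) =
      ∑ e ∈ faces (vset b), ∫ x, φ x * ψ x * normal (vset b) e i ∂surf e := by
  have h := integral_fderiv_cell hd b (hφ.mul hψ) (EuclideanSpace.single i 1)
  have c1 : Continuous (pd i φ) := continuous_pd (n := 1) hφ one_ne_zero
  have c2 : Continuous (pd i ψ) := continuous_pd (n := 1) hψ one_ne_zero
  have c3 := hφ.continuous
  have c4 := hψ.continuous
  have hint : ∀ F : E d → ℝ, Continuous F → IntegrableOn F (cell (vset b)) := fun F hF =>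
    hF.continuousOn.integrableOn_compact (isCompact_cell _)
  rw [← integral_add (hint _ (by fun_prop)) (hint _ (by fun_prop))]
  have h1 : ∀ e, inner ℝ (EuclideanSpace.single i (1 : ℝ)) (normal (vset b) e) =
      normal (vset b) e i := fun e => by rw [EuclideanSpace.inner_single_left]; simp
  simp_rw [h1] at h
  rw [← h]
  refine integral_congr_ae (Eventually.of_forall fun x => ?_)
  have := pd_mul (i := i) (hφ.differentiable one_ne_zero x) (hψ.differentiable one_ne_zero x)
  simp only
  rw [mul_comm (pd i φ x), ← this]
  rfl

/-- Apply `integral_surf_eq` to `ψ ^ 2`. The directional derivative is `2 ψ` times the derivative of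
`ψ` along `x - b j`, split by Young's inequality; `2 * |R|` bounds the length of `x - b j`, and the
summand `d + 1` collects `d * ψ ^ 2` and Young's `ψ ^ 2`. -/
theorem exists_trace_bound (hd : 0 < d) (b : AffineBasis (Fin (d + 1)) ℝ (E d)) :
    ∃ C, 0 ≤ C ∧ ∀ e ∈ faces (vset b), ∀ ψ : E d → ℝ, ContDiff ℝ 1 ψ →
      ∫ x, ψ x ^ 2 ∂surf e ≤ C * ((∫ x in cell (vset b), ψ x ^ 2) +
        ∑ i, ∫ x in cell (vset b), pd i ψ x ^ 2) := by
  obtain ⟨R, hR⟩ := (isCompact_cell (vset b)).isBounded.exists_norm_le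
  have hK : ∀ j x, x ∈ cell (vset b) → ‖x - b j‖ ≤ 2 * |R| := by
    intro j x hx
    have h1 := (hR x hx).trans (le_abs_self R)
    have h2 := (hR (b j) (subset_convexHull ℝ _ (by simp [vset]))).trans (le_abs_self R)
    linarith [norm_sub_le x (b j)]
  set M := (∑ j, ‖grad b j‖) with hM
  have hM0 : 0 ≤ M := Finset.sum_nonneg fun _ _ => norm_nonneg _
  refine ⟨M * ((d + 1) + (2 * |R|) ^ 2), by positivity, fun e he ψ hψ => ?_⟩
  obtain ⟨j, rfl⟩ := (mem_faces_iff b e).1 he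
  have c1 : ∀ i, Continuous (pd i ψ) := fun i => continuous_pd (n := 1) hψ one_ne_zero
  have c3 := hψ.continuous
  have hint : ∀ F : E d → ℝ, Continuous F → IntegrableOn F (cell (vset b)) := fun F hF =>
    hF.continuousOn.integrableOn_compact (isCompact_cell _)
  rw [integral_surf_eq hd b j (hψ.pow 2), mul_assoc]
  have hfd : ∀ x v, fderiv ℝ (fun x => ψ x ^ 2) x v = 2 * ψ x * fderiv ℝ ψ x v := by
    intro x v
    rw [fderiv_fun_pow 2 (hψ.differentiable one_ne_zero x)]
    simp
  have c5 : Continuous (fun x => fderiv ℝ (fun x => ψ x ^ 2) x (x - b j)) := by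
    have := (hψ.pow 2).continuous_fderiv one_ne_zero
    fun_prop
  have hle : (∫ x in cell (vset b), (d * ψ x ^ 2 + fderiv ℝ (fun x => ψ x ^ 2) x (x - b j))) ≤
      ((d + 1) + (2 * |R|) ^ 2) * ((∫ x in cell (vset b), ψ x ^ 2) +
        ∑ i, ∫ x in cell (vset b), pd i ψ x ^ 2) := by
    rw [← integral_finsetSum _ (fun i _ => hint _ (by have := c1 i; fun_prop)),
      ← integral_add (hint _ (by fun_prop)) (hint _ (by fun_prop)), ← integral_const_mul]
    refine setIntegral_mono_on (hint _ (by fun_prop)) (hint _ (by fun_prop))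
      (measurableSet_cell _) fun x hx => ?_
    rw [hfd, fderiv_eq_sum_pd]
    set s := ∑ i, pd i ψ x ^ 2
    set t := ∑ i, (x - b j) i * pd i ψ x with ht
    have hs : 0 ≤ s := Finset.sum_nonneg fun _ _ => sq_nonneg _
    have h1 : t ^ 2 ≤ (2 * |R|) ^ 2 * s := by
      refine (Finset.sum_mul_sq_le_sq_mul_sq _ _ _).trans ?_
      refine mul_le_mul_of_nonneg_right ?_ hs
      rw [← EuclideanSpace.real_norm_sq_eq]
      exact pow_le_pow_left₀ (norm_nonneg _) (hK j x hx) 2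
    have h2 : 0 ≤ (2 * |R|) ^ 2 * ψ x ^ 2 := by positivity
    have h3 : (0 : ℝ) ≤ (d + 1) * s := by positivity
    nlinarith [sq_nonneg (ψ x - t)]
  refine (mul_le_mul_of_nonneg_left hle (norm_nonneg _)).trans ?_
  refine mul_le_mul_of_nonneg_right
    (Finset.single_le_sum (f := fun j => ‖grad b j‖) (fun _ _ => norm_nonneg _)
      (Finset.mem_univ j)) ?_
  refine mul_nonneg (by positivity) (add_nonneg (integral_nonneg fun x => sq_nonneg _)
    (Finset.sum_nonneg fun i _ => integral_nonneg fun x => sq_nonneg _))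

end RTM

end

/-! ### The trace theorem on a simplex: existence, uniqueness, weak gradients -/

noncomputable section
namespace RTM
variable {d : ℕ}

open scoped ENNReal Topology
open Filter

/-- `g` is the trace on the boundary of `K` of `w`, and `G` is the weak gradient of `w` on `K`. -/
structure HasTrace (K : Finset (E d)) (w : E d → ℝ) (G : Fin d → E d → ℝ) (g : E d → ℝ) :
    Prop where
  memLp : MemLp w 2 (volume.restrict (cell K))
  memLp_grad : ∀ i, MemLp (G i) 2 (volume.restrict (cell K))
  memLp_trace : ∀ e ∈ faces K, MemLp g 2 (surf e)
  green : ∀ (i : Fin d) (φ : E d → ℝ), ContDiff ℝ ∞ φ →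
      (∫ x in cell K, w x * pd i φ x) + (∫ x in cell K, G i x * φ x) =
        ∑ e ∈ faces K, ∫ x, g x * φ x * normal K e i ∂surf e

theorem isTrace_iff {K : Finset (E d)} {w g : E d → ℝ} :
    IsTrace K w g ↔ ∃ G, HasTrace K w G g :=
  ⟨fun ⟨h1, h2, G, h3, h4⟩ => ⟨G, h1, h3, h2, h4⟩,
    fun ⟨G, h1, h3, h2, h4⟩ => ⟨h1, h2, G, h3, h4⟩⟩

theorem HasTrace.congr {K : Finset (E d)} {w w' g : E d → ℝ} {G G' : Fin d → E d → ℝ}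
    (h : HasTrace K w G g) (hw : w =ᵐ[volume.restrict (cell K)] w')
    (hG : ∀ i, G i =ᵐ[volume.restrict (cell K)] G' i) : HasTrace K w' G' g := by
  refine ⟨h.memLp.ae_eq hw, fun i => (h.memLp_grad i).ae_eq (hG i), h.memLp_trace,
    fun i φ hφ => ?_⟩
  rw [← h.green i φ hφ]
  congr 1
  · refine integral_congr_ae ?_
    filter_upwards [hw] with x hx
    rw [hx]
  · refine integral_congr_ae ?_
    filter_upwards [hG i] with x hx
    rw [hx]

theorem hasTrace_smooth (hd : 0 < d) (b : AffineBasis (Fin (d + 1)) ℝ (E d)) {φ : E d → ℝ}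
    (hφ : ContDiff ℝ ∞ φ) : HasTrace (vset b) φ (fun i => pd i φ) φ := by
  refine ⟨memLp_cell_of_continuous _ hφ.continuous 2,
    fun i => memLp_cell_of_continuous _ (continuous_pd hφ (by simp)) 2, fun e he => ?_,
    fun i ψ hψ => green_smooth hd b (hφ.of_le (by simp)) (hψ.of_le (by simp)) i⟩
  obtain ⟨j, rfl⟩ := (mem_faces_iff b e).1 he
  exact memLp_surf_of_continuous hd b j hφ.continuous 2

theorem HasTrace.sub (hd : 0 < d) {b : AffineBasis (Fin (d + 1)) ℝ (E d)} {w w' g g' : E d → ℝ}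
    {G G' : Fin d → E d → ℝ} (h : HasTrace (vset b) w G g) (h' : HasTrace (vset b) w' G' g') :
    HasTrace (vset b) (fun x => w x - w' x) (fun i x => G i x - G' i x)
      (fun x => g x - g' x) := by
  refine ⟨h.memLp.sub h'.memLp, fun i => (h.memLp_grad i).sub (h'.memLp_grad i),
    fun e he => (h.memLp_trace e he).sub (h'.memLp_trace e he), fun i φ hφ => ?_⟩
  have m1 := memLp_cell_of_continuous (vset b) hφ.continuous 2
  have m2 := memLp_cell_of_continuous (vset b) (continuous_pd (i := i) hφ (by simp)) 2
  simp only [sub_mul]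
  rw [integral_sub (integrable_mul h.memLp m2) (integrable_mul h'.memLp m2),
    integral_sub (integrable_mul (h.memLp_grad i) m1) (integrable_mul (h'.memLp_grad i) m1)]
  have : ∀ e ∈ faces (vset b), ∫ x, (g x * φ x * normal (vset b) e i -
      g' x * φ x * normal (vset b) e i) ∂surf e =
      (∫ x, g x * φ x * normal (vset b) e i ∂surf e) -
        ∫ x, g' x * φ x * normal (vset b) e i ∂surf e := by
    intro e he
    obtain ⟨j, rfl⟩ := (mem_faces_iff b e).1 he
    have m3 := memLp_surf_of_continuous hd b j hφ.continuous 2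
    exact integral_sub ((integrable_mul (h.memLp_trace _ he) m3).mul_const _)
      ((integrable_mul (h'.memLp_trace _ he) m3).mul_const _)
  rw [Finset.sum_congr rfl this, Finset.sum_sub_distrib, ← h.green i φ hφ, ← h'.green i φ hφ]
  ring

theorem coord_interior_pos {b : AffineBasis (Fin (d + 1)) ℝ (E d)} {x : E d}
    (hx : x ∈ interior (cell (vset b))) (j : Fin (d + 1)) : 0 < b.coord j x := by
  rw [interior_cell_vset] at hx
  exact hx j

theorem setIntegral_eq_of_tsupport {U S : Set (E d)} (hUS : U ⊆ S) (hS : MeasurableSet S)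
    {f φ : E d → ℝ} (hφ : tsupport φ ⊆ U) :
    ∫ x in U, f x * φ x = ∫ x in S, f x * φ x := by
  refine (setIntegral_eq_of_subset_of_forall_sdiff_eq_zero hS hUS fun x hx => ?_).symm
  rw [image_eq_zero_of_notMem_tsupport (fun h => hx.2 (hφ h)), mul_zero]

theorem tsupport_pd_subset (i : Fin d) (φ : E d → ℝ) : tsupport (pd i φ) ⊆ tsupport φ := by
  refine closure_minimal ?_ (isClosed_tsupport φ)
  intro x hx
  by_contra h
  apply hx
  have : x ∉ tsupport (fderiv ℝ φ) := fun h' => h (tsupport_fderiv_subset ℝ h')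
  rw [pd, image_eq_zero_of_notMem_tsupport this]
  rfl

theorem IsWeakPartial.mono {Ω U : Set (E d)} (hΩ : IsOpen Ω) (h : U ⊆ Ω)
    {i : Fin d} {w g : E d → ℝ} (hw : IsWeakPartial Ω i w g) : IsWeakPartial U i w g := by
  intro φ hφ
  have := hw φ ⟨hφ.1, hφ.2.1, hφ.2.2.trans h⟩
  rw [setIntegral_eq_of_tsupport h hΩ.measurableSet hφ.2.2,
    setIntegral_eq_of_tsupport h hΩ.measurableSet
      ((tsupport_pd_subset i φ).trans hφ.2.2), this]

theorem IsWeakPartial.congr {Ω : Set (E d)} {i : Fin d} {w w' g g' : E d → ℝ}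
    (h : IsWeakPartial Ω i w g) (hw : w =ᵐ[volume.restrict Ω] w')
    (hg : g =ᵐ[volume.restrict Ω] g') : IsWeakPartial Ω i w' g' := by
  intro φ hφ
  have e1 : ∫ x in Ω, w' x * pd i φ x = ∫ x in Ω, w x * pd i φ x :=
    integral_congr_ae (by filter_upwards [hw] with x hx; rw [hx])
  have e2 : ∫ x in Ω, g' x * φ x = ∫ x in Ω, g x * φ x :=
    integral_congr_ae (by filter_upwards [hg] with x hx; rw [hx])
  rw [e1, e2, h φ hφ]

theorem ae_eq_of_forall_test {Ω : Set (E d)} (hΩ : IsOpen Ω) {g g' : E d → ℝ}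
    (hg : MemLp g 2 (volume.restrict Ω)) (hg' : MemLp g' 2 (volume.restrict Ω))
    (h : ∀ φ, IsTest Ω φ → ∫ x in Ω, g x * φ x = ∫ x in Ω, g' x * φ x) :
    g =ᵐ[volume.restrict Ω] g' := by
  have hsub := hg.sub hg'
  have hloc : LocallyIntegrable (g - g') (volume.restrict Ω) := hsub.locallyIntegrable (by norm_num)
  have := IsOpen.ae_eq_zero_of_integral_contDiff_smul_eq_zero (μ := volume.restrict Ω) hΩ
    (hloc.locallyIntegrableOn Ω) ?_
  · filter_upwards [this, ae_restrict_mem hΩ.measurableSet] with x hx hxΩ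
    have := hx hxΩ
    simpa [sub_eq_zero] using this
  · intro φ h1 h2 h3
    have hb : MemLp φ 2 (volume.restrict Ω) :=
      (h1.continuous.memLp_of_hasCompactSupport h2).restrict _
    have e : ∀ x, φ x • (g - g') x = g x * φ x - g' x * φ x := fun x => by
      simp only [Pi.sub_apply, smul_eq_mul]; ring
    simp_rw [e]
    rw [integral_sub (integrable_mul hg hb) (integrable_mul hg' hb), h φ ⟨h1, h2, h3⟩, sub_self]

/-- A test function supported in the interior vanishes on every face, where some barycentric
coordinate is zero, so the boundary terms of Green's formula disappear. -/
theorem HasTrace.isWeakPartial {b : AffineBasis (Fin (d + 1)) ℝ (E d)} {w g : E d → ℝ}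
    {G : Fin d → E d → ℝ} (h : HasTrace (vset b) w G g) (i : Fin d) :
    IsWeakPartial (interior (cell (vset b))) i w (G i) := by
  intro φ hφ
  have hz : ∑ e ∈ faces (vset b), ∫ x, g x * φ x * normal (vset b) e i ∂surf e = 0 := by
    refine Finset.sum_eq_zero fun e he => ?_
    obtain ⟨j, rfl⟩ := (mem_faces_iff b e).1 he
    refine integral_eq_zero_of_ae ?_
    rw [surf]
    filter_upwards [ae_restrict_mem (measurableSet_cell _)] with x hx
    rw [cell_vface] at hx
    have : φ x = 0 := image_eq_zero_of_notMem_tsupport fun hm =>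
      (coord_interior_pos (hφ.2.2 hm) j).ne' hx.2
    simp [this]
  have := h.green i φ hφ.1
  rw [hz] at this
  rw [setIntegral_congr_set (interior_ae_eq_of_convex (convex_cell _)),
    setIntegral_congr_set (interior_ae_eq_of_convex (convex_cell _))]
  linarith

theorem restrict_interior_cell (s : Finset (E d)) :
    (volume : Measure (E d)).restrict (interior (cell s)) = volume.restrict (cell s) :=
  Measure.restrict_congr_set (interior_ae_eq_of_convex (convex_cell s))

/-- The gradient in `IsTrace` is only asserted to exist; uniqueness of weak derivatives identifies
it with a gradient known from elsewhere. -/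
theorem HasTrace.grad_ae_eq {b : AffineBasis (Fin (d + 1)) ℝ (E d)} {w g D : E d → ℝ}
    {G : Fin d → E d → ℝ} (h : HasTrace (vset b) w G g) {i : Fin d}
    (hD : MemLp D 2 (volume.restrict (cell (vset b))))
    (hwD : IsWeakPartial (interior (cell (vset b))) i w D) :
    G i =ᵐ[volume.restrict (cell (vset b))] D := by
  rw [← restrict_interior_cell] at hD ⊢
  have hG := h.memLp_grad i
  rw [← restrict_interior_cell] at hG
  refine ae_eq_of_forall_test isOpen_interior hG hD fun φ hφ => ?_
  have h1 := h.isWeakPartial i φ hφ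
  have h2 := hwD φ hφ
  linarith

theorem interior_cell_nonempty (b : AffineBasis (Fin (d + 1)) ℝ (E d)) :
    (interior (cell (vset b))).Nonempty := by
  have := b.centroid_mem_interior_convexHull
  rw [show Set.range b = (vset b : Set (E d)) by simp [vset]] at this
  exact ⟨_, this⟩

/-- The trace theorem on a simplex. -/
theorem exists_hasTrace (hd : 0 < d) (b : AffineBasis (Fin (d + 1)) ℝ (E d)) {w : E d → ℝ}
    {G : Fin d → E d → ℝ} (hw : MemLp w 2 (volume.restrict (cell (vset b))))
    (hG : ∀ i, MemLp (G i) 2 (volume.restrict (cell (vset b))))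
    (h : ∀ i, IsWeakPartial (interior (cell (vset b))) i w (G i)) :
    ∃ g, HasTrace (vset b) w G g := by
  obtain ⟨φ, hφ, hφw, hφG⟩ := exists_smooth_seq (convex_cell _) (isCompact_cell _)
    (interior_cell_nonempty b) hw hG h
  have mφ : ∀ n, MemLp (φ n) 2 (volume.restrict (cell (vset b))) := fun n =>
    memLp_cell_of_continuous _ (hφ n).continuous 2
  have mpd : ∀ i n, MemLp (pd i (φ n)) 2 (volume.restrict (cell (vset b))) := fun i n =>
    memLp_cell_of_continuous _ (continuous_pd (hφ n) (by simp)) 2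
  have t1 := tendsto_integral_sq mφ hw hφw
  have t2 := fun i => tendsto_integral_sq (mpd i) (hG i) (hφG i)
  obtain ⟨C, hC, hCb⟩ := exists_trace_bound hd b
  set A : ℕ → ℝ := fun n => (∫ x in cell (vset b), (φ n x - w x) ^ 2) +
    ∑ i, ∫ x in cell (vset b), (pd i (φ n) x - G i x) ^ 2 with hA
  have tA : Tendsto A atTop (𝓝 0) := by
    have := t1.add (tendsto_finsetSum Finset.univ (fun i _ => t2 i))
    simpa using this
  -- The sum of the surface measures, so that a single limit function serves on all faces at once.
  set μ : Measure (E d) := ∑ e ∈ faces (vset b), surf e with hμ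
  have hle : ∀ e ∈ faces (vset b), surf e ≤ μ := fun e he => by
    rw [hμ, ← Finset.add_sum_erase _ _ he]
    exact Measure.le_add_right le_rfl
  have hsm : ∀ n, MemLp (φ n) 2 μ := by
    intro n
    rw [hμ]
    refine (memLp_two_iff_integrable_sq (hφ n).continuous.aestronglyMeasurable).2
      (integrable_finsetSum_measure.2 fun e he => ?_)
    obtain ⟨j, rfl⟩ := (mem_faces_iff b e).1 he
    exact integrable_sq (memLp_surf_of_continuous hd b j (hφ n).continuous 2)
  -- The trace inequality for `φ m - φ n`, with both functions and their gradients compared with `w`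
  -- and `G`, shows that the boundary values are Cauchy.
  have hcauchy : ∀ m n, ∫ x, (φ m x - φ n x) ^ 2 ∂μ ≤
      ((faces (vset b)).card * C * 2 * A m) + ((faces (vset b)).card * C * 2 * A n) := by
    intro m n
    have hint : ∀ e ∈ faces (vset b), Integrable (fun x => (φ m x - φ n x) ^ 2) (surf e) :=
      fun e he => (integrable_sq ((hsm m).sub (hsm n))).mono_measure (hle e he)
    rw [hμ, integral_finsetSum_measure hint]
    have hpt : ∀ {p q r : E d → ℝ}, MemLp p 2 (volume.restrict (cell (vset b))) →
        MemLp q 2 (volume.restrict (cell (vset b))) → MemLp r 2 (volume.restrict (cell (vset b))) →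
        ∫ x in cell (vset b), (p x - q x) ^ 2 ≤ 2 * (∫ x in cell (vset b), (p x - r x) ^ 2) +
          2 * ∫ x in cell (vset b), (q x - r x) ^ 2 := by
      intro p q r hp hq hr
      have i1 : Integrable (fun x => 2 * (p x - r x) ^ 2) (volume.restrict (cell (vset b))) :=
        (integrable_sq (hp.sub hr)).const_mul 2
      have i2 : Integrable (fun x => 2 * (q x - r x) ^ 2) (volume.restrict (cell (vset b))) :=
        (integrable_sq (hq.sub hr)).const_mul 2
      rw [← integral_const_mul, ← integral_const_mul, ← integral_add i1 i2]
      refine integral_mono (integrable_sq (hp.sub hq)) (i1.add i2) fun x => ?_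
      change _ ≤ 2 * (p x - r x) ^ 2 + 2 * (q x - r x) ^ 2
      nlinarith [sq_nonneg (p x - r x + (q x - r x))]
    have hb : ∀ e ∈ faces (vset b), ∫ x, (φ m x - φ n x) ^ 2 ∂surf e ≤ C * (2 * A m + 2 * A n) := by
      intro e he
      refine (hCb e he (fun x => φ m x - φ n x)
        (((hφ m).sub (hφ n)).of_le (by simp))).trans ?_
      refine mul_le_mul_of_nonneg_left ?_ hC
      have e1 : ∀ i x, pd i (fun x => φ m x - φ n x) x = pd i (φ m) x - pd i (φ n) x :=
        fun i x => pd_sub ((hφ m).differentiable (by simp) x) ((hφ n).differentiable (by simp) x)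
      simp_rw [e1]
      have s1 := hpt (mφ m) (mφ n) hw
      have s2 := Finset.sum_le_sum fun i (_ : i ∈ Finset.univ) => hpt (mpd i m) (mpd i n) (hG i)
      rw [Finset.sum_add_distrib, ← Finset.mul_sum, ← Finset.mul_sum] at s2
      simp only [hA]
      linarith
    refine (Finset.sum_le_card_nsmul _ _ _ hb).trans (le_of_eq ?_)
    rw [nsmul_eq_mul]; ring
  have tB : Tendsto (fun n => (faces (vset b)).card * C * 2 * A n) atTop (𝓝 0) := by
    simpa using tA.const_mul ((faces (vset b)).card * C * 2)
  obtain ⟨g, hg, hgt⟩ := exists_L2_limit hsm tB hcauchy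
  have hge : ∀ e ∈ faces (vset b), MemLp g 2 (surf e) := fun e he => hg.mono_measure (hle e he)
  refine ⟨g, hw, hG, hge, fun i ψ hψ => ?_⟩
  have m1 := memLp_cell_of_continuous (vset b) hψ.continuous 2
  have m2 := memLp_cell_of_continuous (vset b) (continuous_pd (i := i) hψ (by simp)) 2
  -- Both sides of Green's formula for the smooth approximations converge; uniqueness of limits
  -- gives the formula for `w`.
  have l1 := (tendsto_integral_mul mφ hw m2 t1).add
    (tendsto_integral_mul (mpd i) (hG i) m1 (t2 i))
  refine tendsto_nhds_unique l1 ?_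
  have hgr := fun n => green_smooth hd b ((hφ n).of_le (by simp)) (hψ.of_le (m := 1) (by simp)) i
  simp_rw [hgr]
  refine tendsto_finsetSum _ fun e he => ?_
  have he' := he
  obtain ⟨j, rfl⟩ := (mem_faces_iff b e).1 he'
  have m3 : MemLp (fun x => ψ x * normal (vset b) (vface b j) i) 2 (surf (vface b j)) :=
    memLp_surf_of_continuous hd b j (hψ.continuous.mul continuous_const) 2
  simp_rw [mul_assoc]
  refine tendsto_integral_mul (fun n => (hsm n).mono_measure (hle _ he)) (hge _ he) m3 ?_
  refine squeeze_zero (fun n => integral_nonneg fun x => sq_nonneg _) (fun n => ?_) hgt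
  exact integral_mono_measure (hle _ he) (Eventually.of_forall fun x => sq_nonneg _)
    (integrable_sq ((hsm n).sub hg))

/-- Green's formula is tested with `φ` times the components of `x - b j`. The field `x - b j` is
tangential to the faces through `b j`, and on the opposite face its normal component is the height
of the simplex. The moments of a trace thus depend only on `w` and `G`, which makes traces unique.
-/
theorem integral_trace_mul (hd : 0 < d) {b : AffineBasis (Fin (d + 1)) ℝ (E d)} {w g : E d → ℝ}
    {G : Fin d → E d → ℝ} (h : HasTrace (vset b) w G g) (j : Fin (d + 1)) {φ : E d → ℝ}
    (hφ : ContDiff ℝ ∞ φ) :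
    ∫ x, g x * φ x ∂surf (vface b j) = ‖grad b j‖ * ∑ i,
      ((∫ x in cell (vset b), w x * pd i (fun y => φ y * (y - b j) i) x) +
        ∫ x in cell (vset b), G i x * (φ x * (x - b j) i)) := by
  have hn : 0 < ‖grad b j‖ := norm_pos_iff.2 (grad_ne_zero hd b j)
  have hξ : ∀ i, ContDiff ℝ ∞ (fun y : E d => (y - b j) i) := by
    intro i
    have : ContDiff ℝ ∞ (fun y : E d => (EuclideanSpace.proj i : E d →L[ℝ] ℝ) (y - b j)) := by
      fun_prop
    exact this
  rw [Finset.sum_congr rfl fun i _ => h.green i _ (hφ.mul (hξ i)), Finset.sum_comm, sum_faces]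
  have hl : ∀ l, ∑ i, ∫ x, g x * (φ x * (x - b j) i) * normal (vset b) (vface b l) i
      ∂surf (vface b l) = if l = j then ‖grad b j‖⁻¹ * ∫ x, g x * φ x ∂surf (vface b j) else 0 := by
    intro l
    have hmem : MemLp g 2 (surf (vface b l)) := h.memLp_trace _ ((mem_faces_iff b _).2 ⟨l, rfl⟩)
    rw [← integral_finsetSum]
    · have e1 : ∀ᵐ x ∂surf (vface b l), ∑ i, g x * (φ x * (x - b j) i) *
          normal (vset b) (vface b l) i = (if l = j then ‖grad b j‖⁻¹ else 0) * (g x * φ x) := by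
        rw [surf]
        filter_upwards [ae_restrict_mem (measurableSet_cell _)] with x hx
        rw [cell_vface] at hx
        have e2 : inner ℝ (x - b j) (normal (vset b) (vface b l)) =
            if l = j then ‖grad b j‖⁻¹ else 0 := by
          rw [normal_vface hd, inner_neg_right, inner_smul_right, real_inner_comm, inner_grad_sub,
            hx.2, b.coord_apply]
          split_ifs with hlj
          · rw [hlj]; ring
          · simp
        rw [← e2]
        simp only [PiLp.inner_apply, RCLike.inner_apply, conj_trivial, Finset.sum_mul]
        refine Finset.sum_congr rfl fun i _ => by ring
      rw [integral_congr_ae e1, integral_const_mul]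
      split_ifs with hlj
      · rw [hlj]
      · simp
    · intro i _
      have m3 : MemLp (fun x => φ x * (x - b j) i) 2 (surf (vface b l)) :=
        memLp_surf_of_continuous hd b l (hφ.continuous.mul (hξ i).continuous) 2
      exact (integrable_mul hmem m3).mul_const _
  simp_rw [hl, Finset.sum_ite_eq', Finset.mem_univ, if_true]
  rw [← mul_assoc, mul_inv_cancel₀ hn.ne', one_mul]

theorem HasTrace.trace_ae_eq (hd : 0 < d) {b : AffineBasis (Fin (d + 1)) ℝ (E d)}
    {w g g' : E d → ℝ} {G : Fin d → E d → ℝ} (h : HasTrace (vset b) w G g)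
    (h' : HasTrace (vset b) w G g') {e : Finset (E d)} (he : e ∈ faces (vset b)) :
    g =ᵐ[surf e] g' := by
  obtain ⟨j, rfl⟩ := (mem_faces_iff b e).1 he
  have := isFiniteMeasure_surf hd b j
  refine ae_eq_of_integral_contDiff_smul_eq
    ((h.memLp_trace _ he).locallyIntegrable (by norm_num))
    ((h'.memLp_trace _ he).locallyIntegrable (by norm_num)) fun φ hφ _ => ?_
  simp only [smul_eq_mul, mul_comm (φ _)]
  rw [integral_trace_mul hd h j hφ, integral_trace_mul hd h' j hφ]

end RTM

end

/-! ### Geometry of conforming meshes and jumps across interior faces -/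

noncomputable section
namespace RTM
variable {d : ℕ}

open scoped ENNReal Topology
open Filter

/-- For `i ≠ j` the zero set of the `i`-th coordinate is invariant under homotheties centred at `b
j`. If it had positive measure on the face, its cone, part of the boundary of the simplex, would
have positive volume. -/
theorem surf_coord_zero (hd : 0 < d) (b : AffineBasis (Fin (d + 1)) ℝ (E d)) {i j : Fin (d + 1)}
    (hij : i ≠ j) : surf (vface b j) {x | b.coord i x = 0} = 0 := by
  have hcont : Continuous (b.coord i) := (b.coord i).continuous_of_finiteDimensional
  have hA : MeasurableSet {x | b.coord i x = 0} :=
    (isClosed_singleton.preimage hcont).measurableSet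
  have h := volume_cell_inter hd b j hA
  have h0 : volume ({x | b.coord i x = 0} ∩ cell (vset b)) = 0 := by
    refine measure_mono_null ?_ ((convex_cell (vset b)).addHaar_frontier volume)
    rintro x ⟨hx, hxK⟩
    refine ⟨subset_closure hxK, fun hint => ?_⟩
    exact (coord_interior_pos hint i).ne' hx
  have hpre : ∀ t ∈ Ioo (0 : ℝ) 1, ENNReal.ofReal (t ^ (d - 1)) *
      surf (vface b j) (AffineMap.homothety (b j) t ⁻¹' {x | b.coord i x = 0}) =
      ENNReal.ofReal (t ^ (d - 1)) * surf (vface b j) {x | b.coord i x = 0} := by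
    intro t ht
    congr 2
    ext x
    simp only [mem_preimage, mem_ofPred_eq, coord_homothety, if_neg hij, mul_zero, add_zero,
      mul_eq_zero, ht.1.ne', false_or]
  rw [h0, setLIntegral_congr_fun measurableSet_Ioo hpre, lintegral_mul_const _ (by fun_prop)] at h
  have hn : 0 < ‖grad b j‖ := norm_pos_iff.2 (grad_ne_zero hd b j)
  rcases mul_eq_zero.1 h.symm with h1 | h1
  · simp only [ENNReal.ofReal_eq_zero] at h1
    exact absurd h1 (not_le.2 (inv_pos.2 hn))
  rcases mul_eq_zero.1 h1 with h2 | h2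
  · exfalso
    rw [setLIntegral_eq_zero_iff' measurableSet_Ioo (by fun_prop)] at h2
    have : ∀ᵐ t : ℝ, t ∉ Ioo (0 : ℝ) 1 := by
      filter_upwards [h2] with t ht hmem
      have := ht hmem
      rw [ENNReal.ofReal_eq_zero] at this
      have h1 : 0 < t ^ (d - 1) := pow_pos hmem.1 _
      linarith
    have h2 : volume (Ioo (0 : ℝ) 1) = 0 := measure_eq_zero_iff_ae_notMem.2 this
    simp at h2
  · exact h2

theorem ae_surf_pos (hd : 0 < d) (b : AffineBasis (Fin (d + 1)) ℝ (E d)) (j : Fin (d + 1)) :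
    ∀ᵐ x ∂surf (vface b j), b.coord j x = 0 ∧ ∀ i, i ≠ j → 0 < b.coord i x := by
  have h1 : ∀ᵐ x ∂surf (vface b j), ∀ i, i ≠ j → b.coord i x ≠ 0 := by
    rw [ae_all_iff]
    intro i
    by_cases hij : i = j
    · exact Eventually.of_forall fun x h => absurd hij h
    · have := measure_eq_zero_iff_ae_notMem.1 (surf_coord_zero hd b hij)
      filter_upwards [this] with x hx _ using hx
  have h2 : ∀ᵐ x ∂surf (vface b j), x ∈ cell (vface b j) :=
    ae_restrict_mem (measurableSet_cell _)
  filter_upwards [h1, h2] with x hx hxm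
  rw [cell_vface] at hxm
  exact ⟨hxm.2, fun i hi => lt_of_le_of_ne (hxm.1 i) (hx i hi).symm⟩

theorem continuous_coord (b : AffineBasis (Fin (d + 1)) ℝ (E d)) (i : Fin (d + 1)) :
    Continuous (b.coord i) := (b.coord i).continuous_of_finiteDimensional

namespace Mesh

variable (T : Mesh d)

theorem exists_basis {K : Finset (E d)} (hK : K ∈ T.elements) :
    ∃ b : AffineBasis (Fin (d + 1)) ℝ (E d), vset b = K :=
  exists_affineBasis (T.card_eq K hK) (T.indep K hK)

variable {T}

/-- The form in which conformity is used: `x` lies in the hull of the common vertices, so a vertex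
that carries weight at `x` is common. -/
theorem vertex_mem {b : AffineBasis (Fin (d + 1)) ℝ (E d)} {L : Finset (E d)}
    (hK : vset b ∈ T.elements) (hL : L ∈ T.elements) {x : E d} (hxK : x ∈ cell (vset b))
    (hxL : x ∈ cell L) {i : Fin (d + 1)} (hi : b.coord i x ≠ 0) : b i ∈ L := by
  have h : x ∈ convexHull ℝ (((vset b : Finset (E d)) : Set (E d)) ∩ L) := by
    rw [← T.conforming _ hK _ hL]; exact ⟨hxK, hxL⟩
  have e : ((vset b : Finset (E d)) : Set (E d)) ∩ L = b '' {i | b i ∈ L} := by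
    ext y
    simp only [vset, Finset.coe_map, Finset.coe_univ, mem_inter_iff, mem_image, mem_ofPred_eq,
      mem_univ, true_and, Function.Embedding.coeFn_mk, SetLike.mem_coe]
    constructor
    · rintro ⟨⟨i, rfl⟩, hy⟩; exact ⟨i, hy, rfl⟩
    · rintro ⟨i, hy, rfl⟩; exact ⟨⟨i, rfl⟩, hy⟩
  rw [e, convexHull_image_eq] at h
  by_contra hc
  exact hi (h.2 i hc)

theorem eq_of_mem_interior {K L : Finset (E d)} (hK : K ∈ T.elements) (hL : L ∈ T.elements)
    {x : E d} (hxK : x ∈ interior (cell K)) (hxL : x ∈ cell L) : K = L := by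
  obtain ⟨b, rfl⟩ := T.exists_basis hK
  refine Finset.eq_of_subset_of_card_le ?_ (by rw [T.card_eq _ hK, T.card_eq _ hL])
  intro v hv
  obtain ⟨i, -, rfl⟩ := Finset.mem_map.1 hv
  exact vertex_mem hK hL (interior_subset hxK) hxL (coord_interior_pos hxK i).ne'

theorem interior_subset_domain {Ω : Set (E d)} (hΩ : T.IsMeshOf Ω) {K : Finset (E d)}
    (hK : K ∈ T.elements) : interior (cell K) ⊆ Ω := by
  rw [hΩ]
  exact interior_mono (subset_biUnion_of_mem (u := fun K => cell K) hK)

theorem isOpen_domain {Ω : Set (E d)} (hΩ : T.IsMeshOf Ω) : IsOpen Ω := by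
  rw [hΩ]; exact isOpen_interior

theorem restrict_cell_le {Ω : Set (E d)} (hΩ : T.IsMeshOf Ω) {K : Finset (E d)}
    (hK : K ∈ T.elements) :
    (volume : Measure (E d)).restrict (cell K) ≤ volume.restrict Ω := by
  rw [← restrict_interior_cell]
  exact Measure.restrict_mono (interior_subset_domain hΩ hK) le_rfl

/-- Frontiers of convex sets are null and the interiors of distinct elements are disjoint, so up to
null sets the elements partition the domain. -/
theorem restrict_domain_eq {Ω : Set (E d)} (hΩ : T.IsMeshOf Ω) :
    (volume : Measure (E d)).restrict Ω = ∑ K ∈ T.elements, volume.restrict (cell K) := by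
  have h1 : Ω =ᵐ[volume] ⋃ K ∈ T.elements, interior (cell K) := by
    have hsub : (⋃ K ∈ T.elements, interior (cell K)) ⊆ Ω :=
      iUnion₂_subset fun K hK => interior_subset_domain hΩ hK
    refine Filter.EventuallyLE.antisymm ?_ hsub.eventuallyLE
    have h0 : volume (⋃ K ∈ T.elements, frontier (cell K)) = 0 := by
      refine (measure_biUnion_null_iff T.elements.countable_toSet).2 ?_
      exact fun K _ => (convex_cell K).addHaar_frontier volume
    filter_upwards [measure_eq_zero_iff_ae_notMem.1 h0] with x hx hxΩ
    have hxu : x ∈ ⋃ K ∈ T.elements, cell K := by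
      rw [show Ω = _ from hΩ] at hxΩ; exact interior_subset hxΩ
    obtain ⟨K, hK, hxK⟩ := mem_iUnion₂.1 hxu
    refine mem_iUnion₂.2 ⟨K, hK, ?_⟩
    by_contra hni
    exact hx (mem_iUnion₂.2 ⟨K, hK, subset_closure hxK, hni⟩)
  rw [Measure.restrict_congr_set h1]
  have hd : (T.elements : Set (Finset (E d))).PairwiseDisjoint fun K => interior (cell K) := by
    intro K hK L hL hKL
    refine disjoint_left.2 fun x hx hx' => hKL ?_
    exact eq_of_mem_interior hK hL hx (interior_subset hx')
  ext A hA
  rw [Measure.restrict_apply hA, Measure.finsetSum_apply, inter_iUnion₂,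
    measure_biUnion_finset (fun K hK L hL hKL => (hd hK hL hKL).mono inter_subset_right
      inter_subset_right) (fun K _ => hA.inter isOpen_interior.measurableSet)]
  refine Finset.sum_congr rfl fun K _ => ?_
  rw [← restrict_interior_cell, Measure.restrict_apply hA]

theorem sum_integral_cell {Ω : Set (E d)} (hΩ : T.IsMeshOf Ω) {F : E d → ℝ}
    (hF : Integrable F (volume.restrict Ω)) :
    ∑ K ∈ T.elements, ∫ x in cell K, F x = ∫ x in Ω, F x := by
  rw [restrict_domain_eq hΩ, integral_finsetSum_measure]
  exact fun K hK => hF.mono_measure (restrict_cell_le hΩ hK)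

/-- Both coordinates vanish on the common face, so they are proportional. Were the factor `c`
positive, a small step from the relative interior of the face into one element would stay in the
other, contradicting disjoint interiors. -/
theorem exists_opposite {b b' : AffineBasis (Fin (d + 1)) ℝ (E d)} {j j' : Fin (d + 1)}
    (hd : 2 ≤ d) (hK : vset b ∈ T.elements) (hL : vset b' ∈ T.elements) (hKL : vset b ≠ vset b')
    (he : vface b j = vface b' j') :
    ∃ c < 0, grad b' j' = c • grad b j ∧ ∀ x, b'.coord j' x = c * b.coord j x := by
  have h1 := orthogonal_vectorSpan_vface (by omega) b j
  have h2 := orthogonal_vectorSpan_vface (by omega) b' j'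
  rw [← he, h1] at h2
  have h3 : grad b' j' ∈ ℝ ∙ grad b j := by rw [h2]; exact Submodule.mem_span_singleton_self _
  obtain ⟨c, hc⟩ := Submodule.mem_span_singleton.1 h3
  have : Nontrivial (Fin (d + 1)) := Fin.nontrivial_iff_two_le.2 (by omega)
  have hg := grad_ne_zero (by omega) b j
  have hg' := grad_ne_zero (by omega) b' j'
  obtain ⟨i₀, hi₀⟩ := exists_ne j
  have hv : b i₀ ∈ vface b j := by
    simp only [vface, Finset.mem_map, Finset.mem_erase, Finset.mem_univ, and_true]
    exact ⟨i₀, hi₀, rfl⟩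
  obtain ⟨i₁, hi₁, hi₁'⟩ : ∃ i₁, i₁ ≠ j' ∧ b' i₁ = b i₀ := by
    rw [he] at hv
    simpa only [vface, Finset.mem_map, Finset.mem_erase, Finset.mem_univ, and_true,
      Function.Embedding.coeFn_mk] using hv
  have hcoord : ∀ x, b'.coord j' x = c * b.coord j x := by
    intro x
    have e1 := inner_grad_sub b' j' x (b' i₁)
    have e2 := inner_grad_sub b j x (b i₀)
    rw [b'.coord_apply, if_neg hi₁.symm, sub_zero] at e1
    rw [b.coord_apply, if_neg hi₀.symm, sub_zero] at e2
    rw [← e1, ← e2, ← hc, hi₁', inner_smul_left]; rfl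
  refine ⟨c, ?_, hc.symm, hcoord⟩
  have hc0 : c ≠ 0 := by
    rintro rfl
    rw [zero_smul] at hc
    exact hg' hc.symm
  by_contra hcn
  have hcp : 0 < c := lt_of_le_of_ne (not_lt.1 hcn) hc0.symm
  -- a point of the relative interior of the common face
  have hx : ∃ a : E d, (b.coord j a = 0 ∧ ∀ i, i ≠ j → 0 < b.coord i a) ∧
      ∀ i, i ≠ j' → 0 < b'.coord i a := by
    have hf := isFiniteMeasure_surf (by omega) b j
    -- The face has positive measure, since otherwise polar coordinates would give the simplex
    -- volume zero. Almost every point is then relatively interior with respect to both elements,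
    -- and one such point exists.
    have h0 : surf (vface b j) ≠ 0 := by
      intro h0
      have := restrict_cell_eq_map (by omega) b j
      rw [h0, Measure.prod_zero, Measure.map_zero, smul_zero, Measure.restrict_eq_zero] at this
      have hpos := isOpen_interior.measure_pos volume (interior_cell_nonempty b)
      exact hpos.ne' (measure_mono_null interior_subset this)
    have e1 := ae_surf_pos (by omega) b j
    have e2 := ae_surf_pos (by omega) b' j'
    rw [← he] at e2
    have : (ae (surf (vface b j))).NeBot := ae_neBot.2 h0
    obtain ⟨a, ha, ha'⟩ := (e1.and e2).exists
    exact ⟨a, ha, ha'.2⟩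
  obtain ⟨a, ⟨ha0, ha⟩, ha'⟩ := hx
  have hline : Continuous (fun t : ℝ => a + t • grad b j) := by fun_prop
  have t1 : ∀ i, i ≠ j → ∀ᶠ t in 𝓝 (0 : ℝ), 0 < b.coord i (a + t • grad b j) := fun i hi =>
    ((continuous_coord b i).comp hline).continuousAt.eventually_const_lt (by simpa using ha i hi)
  have t2 : ∀ i, i ≠ j' → ∀ᶠ t in 𝓝 (0 : ℝ), 0 < b'.coord i (a + t • grad b j) := fun i hi =>
    ((continuous_coord b' i).comp hline).continuousAt.eventually_const_lt (by simpa using ha' i hi)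
  have t1' : ∀ᶠ t in 𝓝 (0 : ℝ), ∀ i, i ≠ j → 0 < b.coord i (a + t • grad b j) := by
    rw [eventually_all]; intro i
    by_cases hi : i = j
    · exact Eventually.of_forall fun _ h => absurd hi h
    · exact (t1 i hi).mono fun _ h _ => h
  have t2' : ∀ᶠ t in 𝓝 (0 : ℝ), ∀ i, i ≠ j' → 0 < b'.coord i (a + t • grad b j) := by
    rw [eventually_all]; intro i
    by_cases hi : i = j'
    · exact Eventually.of_forall fun _ h => absurd hi h
    · exact (t2 i hi).mono fun _ h _ => h
  have hev := ((t1'.and t2').filter_mono (nhdsWithin_le_nhds (s := Ioi 0))).and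
    self_mem_nhdsWithin
  obtain ⟨t, ⟨ht1, ht2⟩, ht⟩ := hev.exists
  have htp : (0 : ℝ) < t := ht
  have hj : 0 < b.coord j (a + t • grad b j) := by
    rw [coord_add, ha0, inner_smul_right, real_inner_self_eq_norm_sq]
    have := norm_pos_iff.2 hg
    positivity
  have m1 : a + t • grad b j ∈ interior (cell (vset b)) := by
    rw [interior_cell_vset]
    intro i
    by_cases hi : i = j
    · rw [hi]; exact hj
    · exact ht1 i hi
  have m2 : a + t • grad b j ∈ cell (vset b') := by
    rw [cell_vset]
    intro i
    by_cases hi : i = j'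
    · rw [hi, hcoord]; exact (mul_pos hcp hj).le
    · exact (ht2 i hi).le
  exact hKL (eq_of_mem_interior hK hL m1 m2)

theorem normal_eq_neg (hd : 2 ≤ d) {K L e : Finset (E d)} (hK : K ∈ T.elements)
    (hL : L ∈ T.elements) (hKL : K ≠ L) (heK : e ∈ faces K) (heL : e ∈ faces L) :
    normal L e = -normal K e := by
  obtain ⟨b, rfl⟩ := T.exists_basis hK
  obtain ⟨b', rfl⟩ := T.exists_basis hL
  obtain ⟨j, rfl⟩ := (mem_faces_iff b e).1 heK
  obtain ⟨j', he⟩ := (mem_faces_iff b' _).1 heL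
  obtain ⟨c, hc, hg, -⟩ := exists_opposite hd hK hL hKL he
  rw [normal_vface (by omega), he, normal_vface (by omega), hg, norm_smul, Real.norm_eq_abs,
    abs_of_neg hc, smul_smul, ← neg_smul, neg_neg]
  congr 1
  have := norm_pos_iff.2 (grad_ne_zero (by omega) b j)
  have := hc.ne
  field_simp

theorem normal_ne_zero (hd : 0 < d) {K e : Finset (E d)} (hK : K ∈ T.elements)
    (he : e ∈ faces K) : normal K e ≠ 0 := by
  obtain ⟨b, rfl⟩ := T.exists_basis hK
  obtain ⟨j, rfl⟩ := (mem_faces_iff b e).1 he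
  rw [normal_vface hd]
  have := grad_ne_zero hd b j
  simp [this]

theorem eventually_coord_pos {b : AffineBasis (Fin (d + 1)) ℝ (E d)} {j : Fin (d + 1)} {x : E d}
    (hx : ∀ i, i ≠ j → 0 < b.coord i x) : ∀ᶠ y in 𝓝 x, ∀ i, i ≠ j → 0 < b.coord i y := by
  rw [eventually_all]; intro i
  by_cases hi : i = j
  · exact Eventually.of_forall fun _ h => absurd hi h
  · exact ((continuous_coord b i).continuousAt.eventually_const_lt (hx i hi)).mono fun _ h _ => h

/-- Near a relatively interior point of the common face, the sign of the `j`-th coordinate decides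
which of the two elements contains a point, so their union is a neighbourhood. -/
theorem ae_mem_domain (hd : 2 ≤ d) {Ω : Set (E d)} (hΩ : T.IsMeshOf Ω) {K L e : Finset (E d)}
    (hK : K ∈ T.elements) (hL : L ∈ T.elements) (hKL : K ≠ L) (heK : e ∈ faces K)
    (heL : e ∈ faces L) : ∀ᵐ x ∂surf e, x ∈ Ω := by
  obtain ⟨b, rfl⟩ := T.exists_basis hK
  obtain ⟨b', rfl⟩ := T.exists_basis hL
  obtain ⟨j, rfl⟩ := (mem_faces_iff b e).1 heK
  obtain ⟨j', he⟩ := (mem_faces_iff b' _).1 heL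
  obtain ⟨c, hc, -, hco⟩ := exists_opposite hd hK hL hKL he
  have e1 := ae_surf_pos (by omega) b j
  have e2 := ae_surf_pos (by omega) b' j'
  rw [← he] at e2
  filter_upwards [e1, e2] with x h1 h2
  rw [show Ω = _ from hΩ, mem_interior_iff_mem_nhds]
  filter_upwards [eventually_coord_pos h1.2, eventually_coord_pos h2.2] with y hy hy'
  rcases le_total 0 (b.coord j y) with h | h
  · refine mem_iUnion₂.2 ⟨_, hK, ?_⟩
    rw [cell_vset]
    intro i
    by_cases hi : i = j
    · rwa [hi]
    · exact (hy i hi).le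
  · refine mem_iUnion₂.2 ⟨_, hL, ?_⟩
    rw [cell_vset]
    intro i
    by_cases hi : i = j'
    · rw [hi, hco]; exact mul_nonneg_of_nonpos_of_nonpos hc.le h
    · exact (hy' i hi).le

/-- Without a second element at the face, all other elements stay away from its relatively interior
points by `vertex_mem`. Just outside `K` there is then nothing of the mesh, so these points lie in
the frontier of the domain, and by closedness the whole face does. -/
theorem exists_neighbour (hd : 2 ≤ d) {Ω : Set (E d)} (hΩ : T.IsMeshOf Ω) {K e : Finset (E d)}
    (hK : K ∈ T.elements) (he : e ∈ faces K) (hb : ¬ OnBoundary Ω e) :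
    ∃ L ∈ T.elements, K ≠ L ∧ e ∈ faces L := by
  obtain ⟨b, rfl⟩ := T.exists_basis hK
  obtain ⟨j, rfl⟩ := (mem_faces_iff b e).1 he
  by_contra hno
  push Not at hno
  apply hb
  have hrel : ∀ x, b.coord j x = 0 → (∀ i, i ≠ j → 0 < b.coord i x) → x ∈ frontier Ω := by
    intro x hx0 hx
    have hxK : x ∈ cell (vset b) := by
      rw [cell_vset]
      intro i
      by_cases hi : i = j
      · rw [hi, hx0]
      · exact (hx i hi).le
    refine ⟨?_, fun hxi => ?_⟩
    · have : closure (interior (cell (vset b))) = closure (cell (vset b)) :=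
        (convex_cell _).closure_interior_eq_closure_of_nonempty_interior (interior_cell_nonempty b)
      exact closure_mono (interior_subset_domain hΩ hK) (this ▸ subset_closure hxK)
    · have hxu : (⋃ K ∈ T.elements, cell K) ∈ 𝓝 x := by
        have := interior_subset hxi
        rw [show Ω = _ from hΩ] at this
        exact mem_interior_iff_mem_nhds.1 this
      have hfar : ∀ L ∈ T.elements, L ≠ vset b → ∀ᶠ y in 𝓝 x, y ∉ cell L := by
        intro L hL hne
        refine (isCompact_cell L).isClosed.isOpen_compl.mem_nhds fun hxL => ?_
        refine hno L hL hne.symm ?_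
        rw [faces, Finset.mem_powersetCard]
        refine ⟨fun v hv => ?_, by simp [vface]⟩
        simp only [vface, Finset.mem_map, Finset.mem_erase, Finset.mem_univ, and_true] at hv
        obtain ⟨i, hi, rfl⟩ := hv
        exact vertex_mem hK hL hxK hxL (hx i hi).ne'
      have hfar' : ∀ᶠ y in 𝓝 x, ∀ L ∈ T.elements, L ≠ vset b → y ∉ cell L := by
        rw [eventually_all_finset]
        intro L hL
        by_cases hne : L = vset b
        · exact Eventually.of_forall fun _ h => absurd hne h
        · exact (hfar L hL hne).mono fun _ h _ => h
      have hev : ∀ᶠ y in 𝓝 x, 0 ≤ b.coord j y := by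
        filter_upwards [hxu, hfar'] with y hy hy'
        obtain ⟨L, hL, hyL⟩ := mem_iUnion₂.1 hy
        by_cases hne : L = vset b
        · rw [hne, cell_vset] at hyL; exact hyL j
        · exact absurd hyL (hy' L hL hne)
      have hline : Tendsto (fun t : ℝ => x + t • grad b j) (𝓝 0) (𝓝 x) := by
        have : Continuous (fun t : ℝ => x + t • grad b j) := by fun_prop
        simpa using this.tendsto 0
      have hev2 := ((hline.eventually hev).filter_mono (nhdsWithin_le_nhds (s := Iio 0))).and
        self_mem_nhdsWithin
      obtain ⟨t, ht, htn⟩ := hev2.exists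
      have htn' : t < 0 := htn
      rw [coord_add, hx0, inner_smul_right, real_inner_self_eq_norm_sq] at ht
      have := norm_pos_iff.2 (grad_ne_zero (by omega) b j)
      have : 0 < ‖grad b j‖ ^ 2 := by positivity
      nlinarith
  -- every point of the face is a limit of points of its relative interior
  have : Nontrivial (Fin (d + 1)) := Fin.nontrivial_iff_two_le.2 (by omega)
  set a : E d := Finset.centroid ℝ (Finset.univ.erase j) b with ha
  have hne : (Finset.univ.erase j).Nonempty := by
    obtain ⟨i, hi⟩ := exists_ne j
    exact ⟨i, by simp [hi]⟩
  have haj : b.coord j a = 0 := by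
    rw [ha, Finset.centroid_def, b.coord_apply_combination_of_notMem (by simp)
      (Finset.sum_centroidWeights_eq_one_of_nonempty ℝ _ hne)]
  have hai : ∀ i, i ≠ j → 0 < b.coord i a := by
    intro i hi
    rw [ha, b.coord_apply_centroid (by simp [hi])]
    have : (0 : ℝ) < ((Finset.univ.erase j).card : ℝ) := by exact_mod_cast hne.card_pos
    positivity
  intro x hx
  rw [cell_vface] at hx
  refine isClosed_frontier.mem_of_tendsto (b := 𝓝[>] (0 : ℝ))
    (f := fun t : ℝ => x + t • (a - x)) ?_ ?_
  · have : Continuous (fun t : ℝ => x + t • (a - x)) := by fun_prop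
    have h0 := this.tendsto 0
    simp only [zero_smul, add_zero] at h0
    exact h0.mono_left nhdsWithin_le_nhds
  · have h01 : Ioo (0 : ℝ) 1 ∈ 𝓝[>] (0 : ℝ) := Ioo_mem_nhdsGT zero_lt_one
    filter_upwards [h01] with t ht
    refine hrel _ ?_ fun i hi => ?_
    · rw [coord_add, inner_smul_right, inner_grad_sub, hx.2, haj]; simp
    · rw [coord_add, inner_smul_right, inner_grad_sub]
      have h1 := hai i hi
      have h2 := hx.1 i
      have h3 : 0 < t * b.coord i a := mul_pos ht.1 h1
      have h4 : 0 ≤ (1 - t) * b.coord i x := mul_nonneg (by linarith [ht.2]) h2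
      linarith

theorem mem_allFaces {e : Finset (E d)} : e ∈ T.allFaces ↔ ∃ K ∈ T.elements, e ∈ faces K := by
  simp [Mesh.allFaces]

/-- Two faces of one element meet where a further coordinate vanishes, which is a null set. If `e`
is not a face of the element of `e'`, no relatively interior point of `e` lies in that element: all
vertices of `e` would belong to it. -/
theorem ae_notMem_cell (hd : 0 < d) {e e' : Finset (E d)} (he : e ∈ T.allFaces)
    (he' : e' ∈ T.allFaces) (hne : e ≠ e') : ∀ᵐ x ∂surf e, x ∉ cell e' := by
  obtain ⟨K, hK, heK⟩ := mem_allFaces.1 he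
  obtain ⟨L, hL, heL⟩ := mem_allFaces.1 he'
  obtain ⟨b, rfl⟩ := T.exists_basis hK
  obtain ⟨b', rfl⟩ := T.exists_basis hL
  obtain ⟨j', rfl⟩ := (mem_faces_iff b' _).1 heL
  by_cases h : e ∈ faces (vset b')
  · obtain ⟨l, rfl⟩ := (mem_faces_iff b' _).1 h
    have hlj : j' ≠ l := fun h => hne (by rw [h])
    filter_upwards [ae_surf_pos hd b' l] with x hx hxm
    rw [cell_vface] at hxm
    exact (hx.2 j' hlj).ne' hxm.2
  · obtain ⟨j, rfl⟩ := (mem_faces_iff b _).1 heK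
    filter_upwards [ae_surf_pos hd b j, ae_restrict_mem (measurableSet_cell (vface b j))]
      with x hx hxe hxm
    apply h
    rw [faces, Finset.mem_powersetCard]
    refine ⟨fun v hv => ?_, by simp [vface]⟩
    simp only [vface, Finset.mem_map, Finset.mem_erase, Finset.mem_univ, and_true] at hv
    obtain ⟨i, hi, rfl⟩ := hv
    rw [cell_vface] at hxe hxm
    exact vertex_mem hK hL (by rw [cell_vset]; exact hxe.1) (by rw [cell_vset]; exact hxm.1)
      (hx.2 i hi).ne'

open Classical in
/-- An interior face has exactly two neighbouring elements, with opposite normals. -/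
theorem exists_pair (hd : 2 ≤ d) {Ω : Set (E d)} (hΩ : T.IsMeshOf Ω) {e : Finset (E d)}
    (he : e ∈ T.allFaces) (hb : ¬ OnBoundary Ω e) :
    ∃ K L, K ≠ L ∧ T.elements.filter (fun K => e ∈ faces K) = {K, L} ∧
      normal L e = -normal K e ∧ ∀ᵐ x ∂surf e, x ∈ Ω := by
  obtain ⟨K, hK, heK⟩ := mem_allFaces.1 he
  obtain ⟨L, hL, hKL, heL⟩ := exists_neighbour hd hΩ hK heK hb
  refine ⟨K, L, hKL, ?_, normal_eq_neg hd hK hL hKL heK heL,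
    ae_mem_domain hd hΩ hK hL hKL heK heL⟩
  ext M
  simp only [Finset.mem_filter, Finset.mem_insert, Finset.mem_singleton]
  constructor
  · rintro ⟨hM, heM⟩
    -- A third element would make three normals pairwise opposite, hence zero.
    by_contra hno
    push Not at hno
    have n1 := normal_eq_neg hd hM hK hno.1 heM heK
    have n2 := normal_eq_neg hd hM hL hno.2 heM heL
    have n3 := normal_eq_neg hd hK hL hKL heK heL
    rw [n2, n1, neg_neg] at n3
    have n4 : (2 : ℝ) • normal M e = 0 := by
      rw [two_smul]
      nth_rewrite 1 [← n3]
      exact neg_add_cancel _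
    replace n4 := (smul_eq_zero.1 n4).resolve_left two_ne_zero
    exact normal_ne_zero (by omega) hM heM n4
  · rintro (rfl | rfl)
    · exact ⟨hK, heK⟩
    · exact ⟨hL, heL⟩

-- Test functions supported in the domain away from all other faces isolate `e`, and almost every
-- point of `e` lies in that open set. The family `g` stands for normal traces of a flux as well as
-- for a trace multiplied by one component of the normal.
open Classical in
theorem jump_ae_eq_zero (hd : 2 ≤ d) {Ω : Set (E d)} (hΩ : T.IsMeshOf Ω)
    {g : Finset (E d) → Finset (E d) → E d → ℝ}
    (hg : ∀ K ∈ T.elements, ∀ e ∈ faces K, MemLp (g K e) 2 (surf e))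
    (h : ∀ φ, IsTest Ω φ → ∑ K ∈ T.elements, ∑ e ∈ faces K, ∫ x, g K e x * φ x ∂surf e = 0)
    {e : Finset (E d)} (he : e ∈ T.allFaces) (hb : ¬ OnBoundary Ω e) :
    ∀ᵐ x ∂surf e, ∑ K ∈ T.elements with e ∈ faces K, g K e x = 0 := by
  set F : E d → ℝ := fun x => ∑ K ∈ T.elements with e ∈ faces K, g K e x with hF
  have hFm : MemLp F 2 (surf e) :=
    memLp_finsetSum _ fun K hK => hg K (Finset.mem_filter.1 hK).1 e (Finset.mem_filter.1 hK).2
  obtain ⟨K₀, hK₀, heK₀⟩ := mem_allFaces.1 he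
  have hfin : IsFiniteMeasure (surf e) := by
    obtain ⟨b, rfl⟩ := T.exists_basis hK₀
    obtain ⟨j, rfl⟩ := (mem_faces_iff b _).1 heK₀
    exact isFiniteMeasure_surf (by omega) b j
  set Z : Set (E d) := ⋃ e' ∈ T.allFaces.erase e, cell e' with hZ
  have hZc : IsClosed Z := by
    refine Set.Finite.isClosed_biUnion (Finset.finite_toSet _) fun e' _ => ?_
    exact (isCompact_cell e').isClosed
  have hU : IsOpen (Ω \ Z) := (isOpen_domain hΩ).sdiff hZc
  have hzero := hU.ae_eq_zero_of_integral_contDiff_smul_eq_zero (f := F) (μ := surf e)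
    ((hFm.locallyIntegrable (by norm_num)).locallyIntegrableOn _) ?_
  · obtain ⟨K, L, -, -, -, hΩe⟩ := exists_pair hd hΩ he hb
    have hZe : ∀ᵐ x ∂surf e, x ∉ Z := by
      have : ∀ᵐ x ∂surf e, ∀ e' ∈ T.allFaces.erase e, x ∉ cell e' := by
        rw [Filter.eventually_all_finset]
        intro e' he'
        exact ae_notMem_cell (by omega) he (Finset.mem_of_mem_erase he')
          (Finset.ne_of_mem_erase he').symm
      filter_upwards [this] with x hx hxZ
      obtain ⟨e', he', hxe'⟩ := mem_iUnion₂.1 hxZ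
      exact hx e' he' hxe'
    filter_upwards [hzero, hΩe, hZe] with x h1 h2 h3 using h1 ⟨h2, h3⟩
  · intro φ h1 h2 h3
    have h4 := h φ ⟨h1, h2, h3.trans sdiff_subset⟩
    have h5 : ∀ K ∈ T.elements, ∑ e' ∈ faces K, ∫ x, g K e' x * φ x ∂surf e' =
        if e ∈ faces K then ∫ x, g K e x * φ x ∂surf e else 0 := by
      intro K hK
      have h6 : ∀ e' ∈ faces K, e' ≠ e → ∫ x, g K e' x * φ x ∂surf e' = 0 := by
        intro e' he' hne
        refine integral_eq_zero_of_ae ?_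
        rw [surf]
        filter_upwards [ae_restrict_mem (measurableSet_cell e')] with x hx
        have : φ x = 0 := image_eq_zero_of_notMem_tsupport fun hm =>
          (h3 hm).2 (mem_iUnion₂.2 ⟨e', Finset.mem_erase.2
            ⟨hne, mem_allFaces.2 ⟨K, hK, he'⟩⟩, hx⟩)
        simp [this]
      split_ifs with heK
      · exact Finset.sum_eq_single_of_mem e heK fun e' he' hne => h6 e' he' hne
      · exact Finset.sum_eq_zero fun e' he' => h6 e' he' fun h => heK (h ▸ he')
    rw [Finset.sum_congr rfl h5, ← Finset.sum_filter, ← integral_finsetSum] at h4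
    · rw [← h4]
      refine integral_congr_ae (Eventually.of_forall fun x => ?_)
      simp only [hF, smul_eq_mul, Finset.mul_sum]
      exact Finset.sum_congr rfl fun K _ => mul_comm _ _
    · intro K hK
      have m := hg K (Finset.mem_filter.1 hK).1 e (Finset.mem_filter.1 hK).2
      exact integrable_mul m (h1.continuous.memLp_of_hasCompactSupport h2)

end Mesh

end RTM

end

/-! ### Polynomials and the Raviart–Thomas space -/

noncomputable section
namespace RTM
variable {d : ℕ}

open MvPolynomial

@[simp] theorem ev_add (p q : MvPolynomial (Fin d) ℝ) (x : E d) : ev (p + q) x = ev p x + ev q x :=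
  map_add _ _ _
@[simp] theorem ev_sub (p q : MvPolynomial (Fin d) ℝ) (x : E d) : ev (p - q) x = ev p x - ev q x :=
  map_sub _ _ _
@[simp] theorem ev_mul (p q : MvPolynomial (Fin d) ℝ) (x : E d) : ev (p * q) x = ev p x * ev q x :=
  map_mul _ _ _
@[simp] theorem ev_zero (x : E d) : ev (0 : MvPolynomial (Fin d) ℝ) x = 0 := map_zero _
@[simp] theorem ev_C (c : ℝ) (x : E d) : ev (C c : MvPolynomial (Fin d) ℝ) x = c := eval_C _
@[simp] theorem ev_X (i : Fin d) (x : E d) : ev (X i : MvPolynomial (Fin d) ℝ) x = x i := eval_X _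
@[simp] theorem ev_smul (c : ℝ) (p : MvPolynomial (Fin d) ℝ) (x : E d) :
    ev (c • p) x = c * ev p x := smul_eval _ _ _
@[simp] theorem ev_sum {ι : Type*} (s : Finset ι) (p : ι → MvPolynomial (Fin d) ℝ) (x : E d) :
    ev (∑ i ∈ s, p i) x = ∑ i ∈ s, ev (p i) x := map_sum (MvPolynomial.eval _) _ _

theorem contDiff_coord (i : Fin d) : ContDiff ℝ ∞ (fun x : E d => x i) :=
  (EuclideanSpace.proj i : E d →L[ℝ] ℝ).contDiff

theorem contDiff_ev (p : MvPolynomial (Fin d) ℝ) : ContDiff ℝ ∞ (ev p) := by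
  induction p using MvPolynomial.induction_on with
  | C a =>
    rw [show ev (C a : MvPolynomial (Fin d) ℝ) = fun _ => a from funext (ev_C a)]
    exact contDiff_const
  | add p q hp hq =>
    rw [show ev (p + q) = fun x => ev p x + ev q x from funext (ev_add p q)]
    exact hp.add hq
  | mul_X p i hp =>
    rw [show ev (p * X i) = fun x => ev p x * x i from
      funext fun x => by rw [ev_mul, ev_X]]
    exact hp.mul (contDiff_coord i)

theorem continuous_ev (p : MvPolynomial (Fin d) ℝ) : Continuous (ev p) := (contDiff_ev p).continuous

theorem pd_ev (i : Fin d) (p : MvPolynomial (Fin d) ℝ) : pd i (ev p) = ev (pderiv i p) := by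
  have hdf : ∀ (p : MvPolynomial (Fin d) ℝ) x, DifferentiableAt ℝ (ev p) x := fun p x =>
    (contDiff_ev p).differentiable (by simp) x
  funext x
  induction p using MvPolynomial.induction_on with
  | C a =>
    have : ev (C a : MvPolynomial (Fin d) ℝ) = fun _ => a := funext (ev_C a)
    rw [pd, this, pderiv_C]; simp
  | add p q hp hq =>
    have : ev (p + q) = fun x => ev p x + ev q x := funext (ev_add p q)
    rw [pd] at hp hq ⊢
    rw [this, fderiv_fun_add (hdf p x) (hdf q x), map_add, ev_add, ← hp, ← hq]; rfl
  | mul_X p j hp =>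
    have : ev (p * X j) = fun x => ev p x * ev (X j) x := funext (ev_mul p (X j))
    rw [this, pd_mul (hdf p x) (hdf (X j) x), hp, pderiv_mul, ev_add, ev_mul, ev_mul]
    have h2 : pd i (ev (X j : MvPolynomial (Fin d) ℝ)) x = ev (pderiv i (X j)) x := by
      have e1 : ev (X j : MvPolynomial (Fin d) ℝ) = (EuclideanSpace.proj j : E d →L[ℝ] ℝ) :=
        funext (ev_X j)
      rw [pd, e1, ContinuousLinearMap.fderiv, pderiv_X]
      rcases eq_or_ne i j with rfl | h
      · simp [ev]
      · simp [ev, h.symm]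
    rw [h2]; ring

theorem mem_polyLT {n : ℕ} {p : MvPolynomial (Fin d) ℝ} :
    p ∈ polyLT d n ↔ ∀ s ∈ p.support, s.degree < n := by
  rw [polyLT, mem_restrictSupport_iff]; rfl

theorem mem_polyLT_succ {n : ℕ} {p : MvPolynomial (Fin d) ℝ} :
    p ∈ polyLT d (n + 1) ↔ p.totalDegree ≤ n := by
  rw [mem_polyLT, totalDegree, Finset.sup_le_iff]
  simp only [Nat.lt_succ_iff]; rfl

theorem polyLT_mono {m n : ℕ} (h : m ≤ n) : polyLT d m ≤ polyLT d n := fun _ hp =>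
  mem_polyLT.2 fun s hs => (mem_polyLT.1 hp s hs).trans_le h

theorem C_mem_polyLT (c : ℝ) (n : ℕ) : (C c : MvPolynomial (Fin d) ℝ) ∈ polyLT d (n + 1) := by
  rw [mem_polyLT_succ]; simp

theorem mul_mem_polyLT {m n : ℕ} {p q : MvPolynomial (Fin d) ℝ} (hp : p ∈ polyLT d (m + 1))
    (hq : q ∈ polyLT d (n + 1)) : p * q ∈ polyLT d (m + n + 1) := by
  rw [mem_polyLT_succ] at *
  exact (totalDegree_mul p q).trans (add_le_add hp hq)

theorem C_mul_mem_polyLT {n : ℕ} {p : MvPolynomial (Fin d) ℝ} (c : ℝ) (hp : p ∈ polyLT d n) :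
    C c * p ∈ polyLT d n := by
  rw [← smul_eq_C_mul]; exact Submodule.smul_mem _ _ hp

theorem X_mem_polyLT (i : Fin d) : (X i : MvPolynomial (Fin d) ℝ) ∈ polyLT d 2 := by
  rw [mem_polyLT_succ]; simp

theorem X_mul_mem_polyLT {n : ℕ} {p : MvPolynomial (Fin d) ℝ} (i : Fin d)
    (hp : p ∈ polyLT d n) : X i * p ∈ polyLT d (n + 1) := by
  rcases n with _ | n
  · have : p = 0 := by
      rw [mem_polyLT] at hp
      ext s
      by_contra h
      exact absurd (hp s (mem_support_iff.2 h)) (Nat.not_lt_zero _)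
    simp [this]
  · have := mul_mem_polyLT (X_mem_polyLT i) hp
    rwa [show 1 + n + 1 = n + 1 + 1 by ring] at this

theorem pderiv_mem_polyLT {n : ℕ} {p : MvPolynomial (Fin d) ℝ} (i : Fin d)
    (hp : p ∈ polyLT d (n + 1)) : pderiv i p ∈ polyLT d n := by
  rw [p.as_sum, map_sum]
  refine Submodule.sum_mem _ fun s hs => ?_
  rw [pderiv_monomial, mem_polyLT]
  intro t ht
  have h1 := mem_polyLT.1 hp s hs
  have h2 : t = s - Finsupp.single i 1 := by
    by_contra hne
    rw [mem_support_iff, coeff_monomial, if_neg (fun h => hne h.symm)] at ht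
    exact ht rfl
  have h3 : s i ≠ 0 := by
    intro h0
    rw [h0] at ht
    simp at ht
  have h4 : t + Finsupp.single i 1 = s := by
    rw [h2]
    exact tsub_add_cancel_of_le (by simpa using Nat.one_le_iff_ne_zero.2 h3)
  rw [← h4, map_add, Finsupp.degree_single] at h1
  omega

theorem mem_polyLT_of_isHomogeneous {k : ℕ} {p : MvPolynomial (Fin d) ℝ} (hp : p.IsHomogeneous k) :
    p ∈ polyLT d (k + 1) := mem_polyLT_succ.2 hp.totalDegree_le

theorem exists_of_mem_RTSpace {k : ℕ} {z : PolyField d} (hz : z ∈ RTSpace d k) :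
    ∃ (a : PolyField d) (p : MvPolynomial (Fin d) ℝ), (∀ i, a i ∈ polyLT d (k + 1)) ∧
      p.IsHomogeneous k ∧ ∀ i, z i = a i + X i * p := by
  obtain ⟨a, ha, y, hy, rfl⟩ := Submodule.mem_sup.1 hz
  obtain ⟨p, hp, rfl⟩ := Submodule.mem_map.1 hy
  exact ⟨a, p, fun i => (Submodule.mem_pi.1 ha) i trivial, hp, fun i => rfl⟩

/-- The polynomial `p` need not be homogeneous: multiplied by `x`, its part of degree below `k` has
degree at most `k` and is absorbed into `a`. This flexibility is needed after affine substitutions.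
-/
theorem mem_RTSpace {k : ℕ} {z : PolyField d} {a : PolyField d} {p : MvPolynomial (Fin d) ℝ}
    (ha : ∀ i, a i ∈ polyLT d (k + 1)) (hp : p ∈ polyLT d (k + 1))
    (hz : ∀ i, z i = a i + X i * p) : z ∈ RTSpace d k := by
  have hr : p - homogeneousComponent k p ∈ polyLT d k := by
    rw [mem_polyLT]
    intro s hs
    have h1 : s ∈ p.support := by
      rw [mem_support_iff] at hs ⊢
      intro h0
      rw [coeff_sub, coeff_homogeneousComponent, h0] at hs
      simp at hs
    have h2 := mem_polyLT.1 hp s h1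
    have h3 : s.degree ≠ k := by
      intro h
      rw [mem_support_iff, coeff_sub, coeff_homogeneousComponent, if_pos h, sub_self] at hs
      exact hs rfl
    omega
  refine Submodule.mem_sup.2 ⟨fun i => a i + X i * (p - homogeneousComponent k p), ?_,
    fun i => X i * homogeneousComponent k p, ?_, ?_⟩
  · exact Submodule.mem_pi.2 fun i _ => Submodule.add_mem _ (ha i) (X_mul_mem_polyLT i hr)
  · exact Submodule.mem_map.2 ⟨homogeneousComponent k p,
      homogeneousComponent_isHomogeneous k p, rfl⟩
  · funext i
    rw [hz i, Pi.add_apply]; ring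

theorem mem_polyLT_of_mem_RTSpace {k : ℕ} {z : PolyField d} (hz : z ∈ RTSpace d k) (i : Fin d) :
    z i ∈ polyLT d (k + 2) := by
  obtain ⟨a, p, ha, hp, h⟩ := exists_of_mem_RTSpace hz
  rw [h i]
  exact Submodule.add_mem _ (polyLT_mono (by omega) (ha i))
    (X_mul_mem_polyLT i (mem_polyLT_of_isHomogeneous hp))

theorem pdiv_mem_polyLT {k : ℕ} {z : PolyField d} (hz : z ∈ RTSpace d k) :
    pdiv z ∈ polyLT d (k + 1) :=
  Submodule.sum_mem _ fun i _ => pderiv_mem_polyLT i (mem_polyLT_of_mem_RTSpace hz i)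

theorem inner_evF (p : PolyField d) (x v : E d) : inner ℝ (evF p x) v = ∑ i, ev (p i) x * v i := by
  simp only [evF, PiLp.inner_apply, RCLike.inner_apply, conj_trivial]
  exact Finset.sum_congr rfl fun i _ => mul_comm _ _

theorem evF_apply (p : PolyField d) (x : E d) (i : Fin d) : evF p x i = ev (p i) x := rfl

theorem evF_sub (p q : PolyField d) (x : E d) : evF (p - q) x = evF p x - evF q x := by
  ext i; simp [evF]

theorem continuous_evF (p : PolyField d) : Continuous (evF p) := by
  have h : Continuous (fun x : E d => fun i => ev (p i) x) :=
    continuous_pi fun i => continuous_ev (p i)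
  exact (PiLp.continuous_toLp 2 _).comp h

/-- The normal component of a Raviart-Thomas field on a plane is a polynomial of degree `k`. -/
theorem exists_normal_component {k : ℕ} {z : PolyField d} (hz : z ∈ RTSpace d k) (n : E d)
    (c : ℝ) : ∃ m ∈ polyLT d (k + 1), ∀ x : E d, inner ℝ n x = c →
      ev m x = inner ℝ (evF z x) n := by
  obtain ⟨a, p, ha, hp, h⟩ := exists_of_mem_RTSpace hz
  -- On the plane, the normal component of `x ↦ p(x) x` is `c * p`, so the degree does not rise.
  refine ⟨∑ i, C (n i) * a i + C c * p, Submodule.add_mem _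
    (Submodule.sum_mem _ fun i _ => C_mul_mem_polyLT _ (ha i))
    (C_mul_mem_polyLT _ (mem_polyLT_of_isHomogeneous hp)), fun x hx => ?_⟩
  rw [inner_evF, ← hx]
  simp only [h, ev_add, ev_sum, ev_mul, ev_C, ev_X, PiLp.inner_apply, RCLike.inner_apply,
    conj_trivial, Finset.sum_mul, add_mul, Finset.sum_add_distrib]
  congr 1
  · exact Finset.sum_congr rfl fun i _ => mul_comm _ _
  · exact Finset.sum_congr rfl fun i _ => by ring

theorem pow_mem_polyLT {A : MvPolynomial (Fin d) ℝ} (hA : A ∈ polyLT d 2) (n : ℕ) :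
    A ^ n ∈ polyLT d (n + 1) := by
  rw [mem_polyLT_succ] at *
  exact (totalDegree_pow A n).trans (by nlinarith)

theorem aeval_mem_polyLT {n : ℕ} {p : MvPolynomial (Fin d) ℝ} (hp : p ∈ polyLT d n)
    {A : Fin d → MvPolynomial (Fin d) ℝ} (hA : ∀ i, A i ∈ polyLT d 2) :
    aeval A p ∈ polyLT d n := by
  rw [p.as_sum, map_sum]
  refine Submodule.sum_mem _ fun s hs => ?_
  rw [aeval_monomial]
  refine C_mul_mem_polyLT _ ?_
  have h1 : s.prod (fun i e => A i ^ e) ∈ polyLT d (s.degree + 1) := by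
    rw [mem_polyLT_succ, Finsupp.prod]
    refine (totalDegree_finsetProd _ _).trans ?_
    rw [Finsupp.degree_apply]
    exact Finset.sum_le_sum fun i _ => mem_polyLT_succ.1 (pow_mem_polyLT (hA i) _)
  exact polyLT_mono (mem_polyLT.1 hp s hs) h1

theorem ev_aeval (p : MvPolynomial (Fin d) ℝ) (A : Fin d → MvPolynomial (Fin d) ℝ) (x : E d) :
    ev (aeval A p) x = ev p (WithLp.toLp 2 fun i => ev (A i) x) := by
  simp only [ev]
  induction p using MvPolynomial.induction_on with
  | C a => simp
  | add p q hp hq => simp only [map_add, hp, hq]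
  | mul_X p i hp => simp only [map_mul, hp, aeval_X, eval_X]

theorem eq_zero_of_ev_eq_zero {U : Set (E d)} (hU : IsOpen U) (hne : U.Nonempty)
    {p : MvPolynomial (Fin d) ℝ} (h : ∀ x ∈ U, ev p x = 0) : p = 0 := by
  obtain ⟨x, hx⟩ := hne
  have hV : IsOpen ((fun y : Fin d → ℝ => (WithLp.toLp 2 y : E d)) ⁻¹' U) :=
    hU.preimage (PiLp.continuous_toLp 2 _)
  obtain ⟨ε, hε, hb⟩ := Metric.isOpen_iff.1 hV (fun i => x i) hx
  refine funext_set (fun i => Metric.ball (x i) ε) (fun i => ?_) fun y hy => ?_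
  · rw [Real.ball_eq_Ioo]
    exact Ioo_infinite (by linarith)
  · rw [← ball_pi _ hε] at hy
    rw [map_zero]
    exact h _ (hb hy)

end RTM

end

/-! ### Green's formula with polynomial fields and the commuting property -/

noncomputable section
namespace RTM
variable {d : ℕ}

open MvPolynomial

theorem inner_eq_sum (v w : E d) : inner ℝ v w = ∑ i, v i * w i := by
  simp only [PiLp.inner_apply, RCLike.inner_apply, conj_trivial]
  exact Finset.sum_congr rfl fun i _ => mul_comm _ _

theorem integrable_inner {μ : Measure (E d)} {v w : E d → E d}
    (hv : ∀ i, MemLp (fun x => v x i) 2 μ) (hw : ∀ i, MemLp (fun x => w x i) 2 μ) :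
    Integrable (fun x => inner ℝ (v x) (w x)) μ := by
  simp only [inner_eq_sum]
  exact integrable_finsetSum _ fun i _ => integrable_mul (hv i) (hw i)

theorem memLp_evF_cell (s : Finset (E d)) (z : PolyField d) (i : Fin d) :
    MemLp (fun x => evF z x i) 2 (volume.restrict (cell s)) :=
  memLp_cell_of_continuous s (continuous_ev (z i)) 2

/-- Green's formula for a vector field with a trace. -/
theorem green_div (hd : 0 < d) (b : AffineBasis (Fin (d + 1)) ℝ (E d)) {q γ : Fin d → E d → ℝ}
    {G : Fin d → Fin d → E d → ℝ} (h : ∀ i, HasTrace (vset b) (q i) (G i) (γ i)) {φ : E d → ℝ}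
    (hφ : ContDiff ℝ ∞ φ) :
    (∫ x in cell (vset b), ∑ i, q i x * pd i φ x) +
      (∫ x in cell (vset b), (∑ i, G i i x) * φ x) =
    ∑ e ∈ faces (vset b), ∫ x, (∑ i, γ i x * normal (vset b) e i) * φ x ∂surf e := by
  have h1 : ∀ i, MemLp (pd i φ) 2 (volume.restrict (cell (vset b))) := fun i =>
    memLp_cell_of_continuous _ (continuous_pd hφ (by simp)) 2
  have h2 : MemLp φ 2 (volume.restrict (cell (vset b))) :=
    memLp_cell_of_continuous _ hφ.continuous 2
  have h3 : ∀ e ∈ faces (vset b), MemLp φ 2 (surf e) := by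
    intro e he
    obtain ⟨j, rfl⟩ := (mem_faces_iff b e).1 he
    exact memLp_surf_of_continuous hd b j hφ.continuous 2
  rw [integral_finsetSum _ fun i _ => integrable_mul (h i).memLp (h1 i)]
  simp only [Finset.sum_mul]
  rw [integral_finsetSum _ fun i _ => integrable_mul ((h i).memLp_grad i) h2,
    ← Finset.sum_add_distrib, Finset.sum_congr rfl fun i _ => (h i).green i φ hφ,
    Finset.sum_comm]
  refine Finset.sum_congr rfl fun e he => ?_
  have h4 : ∀ i, Integrable (fun x => γ i x * normal (vset b) e i * φ x) (surf e) := fun i =>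
    integrable_mul (((h i).memLp_trace e he).mul_const _) (h3 e he)
  rw [integral_finsetSum _ fun i _ => h4 i]
  exact Finset.sum_congr rfl fun i _ => integral_congr_ae (.of_forall fun x => by ring)

theorem green_evF (hd : 0 < d) (b : AffineBasis (Fin (d + 1)) ℝ (E d)) (z : PolyField d)
    {φ : E d → ℝ} (hφ : ContDiff ℝ ∞ φ) :
    (∫ x in cell (vset b), ∑ i, ev (z i) x * pd i φ x) +
      (∫ x in cell (vset b), ev (pdiv z) x * φ x) =
    ∑ e ∈ faces (vset b), ∫ x, inner ℝ (evF z x) (normal (vset b) e) * φ x ∂surf e := by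
  have h := green_div hd b (fun i => hasTrace_smooth hd b (contDiff_ev (z i))) hφ
  simp only [pd_ev, ← inner_evF] at h
  simpa only [pdiv, ev_sum] using h

/-- Green's formula for a function with a trace against a polynomial field. -/
theorem HasTrace.green_evF (hd : 0 < d) {b : AffineBasis (Fin (d + 1)) ℝ (E d)} {u g : E d → ℝ}
    {G : Fin d → E d → ℝ} (h : HasTrace (vset b) u G g) (z : PolyField d) :
    (∫ x in cell (vset b), u x * ev (pdiv z) x) +
      (∫ x in cell (vset b), ∑ i, G i x * ev (z i) x) =
    ∑ e ∈ faces (vset b), ∫ x, g x * inner ℝ (evF z x) (normal (vset b) e) ∂surf e := by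
  have h1 : ∀ p : MvPolynomial (Fin d) ℝ, MemLp (ev p) 2 (volume.restrict (cell (vset b))) :=
    fun p => memLp_cell_of_continuous _ (continuous_ev p) 2
  simp only [pdiv, ev_sum, Finset.mul_sum]
  rw [integral_finsetSum _ fun i _ => integrable_mul h.memLp (h1 _),
    integral_finsetSum _ fun i _ => integrable_mul (h.memLp_grad i) (h1 _),
    ← Finset.sum_add_distrib]
  have h2 : ∀ i ∈ Finset.univ, _ := fun i _ => h.green i (ev (z i)) (contDiff_ev _)
  simp only [pd_ev] at h2
  rw [Finset.sum_congr rfl h2, Finset.sum_comm]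
  refine Finset.sum_congr rfl fun e he => ?_
  obtain ⟨j, rfl⟩ := (mem_faces_iff b e).1 he
  have h4 : ∀ i, Integrable (fun x => g x * ev (z i) x * normal (vset b) (vface b j) i)
      (surf (vface b j)) := fun i =>
    (integrable_mul (h.memLp_trace _ he)
      (memLp_surf_of_continuous hd b j (continuous_ev (z i)) 2)).mul_const _
  rw [← integral_finsetSum _ fun i _ => h4 i]
  refine integral_congr_ae (.of_forall fun x => ?_)
  simp only [inner_evF, Finset.mul_sum, mul_assoc]

theorem inner_normal_eq_const (hd : 0 < d) (b : AffineBasis (Fin (d + 1)) ℝ (E d))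
    {e : Finset (E d)} (he : e ∈ faces (vset b)) :
    ∃ c, ∀ x ∈ cell e, inner ℝ (normal (vset b) e) x = c := by
  obtain ⟨j, rfl⟩ := (mem_faces_iff b e).1 he
  refine ⟨-(‖grad b j‖⁻¹ * (-b.coord j 0)), fun x hx => ?_⟩
  rw [cell_vface] at hx
  have := inner_grad_sub b j x 0
  rw [sub_zero, hx.2, zero_sub] at this
  rw [normal_vface hd, inner_neg_left, real_inner_smul_left, this]

theorem ae_mem_cell_surf (e : Finset (E d)) : ∀ᵐ x ∂surf e, x ∈ cell e :=
  ae_restrict_mem (measurableSet_cell e)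

theorem sq_integral_eq_zero {α : Type*} [MeasurableSpace α] {μ : Measure α} {f : α → ℝ}
    (hf : MemLp f 2 μ) (h : ∫ x, f x ^ 2 ∂μ = 0) : f =ᵐ[μ] 0 := by
  have := (integral_eq_zero_iff_of_nonneg (fun x => sq_nonneg (f x)) (integrable_sq hf)).1 h
  filter_upwards [this] with x hx
  simpa using hx

theorem eq_zero_of_integral_sq_eq_zero (b : AffineBasis (Fin (d + 1)) ℝ (E d))
    {p : MvPolynomial (Fin d) ℝ} (h : ∫ x in cell (vset b), ev p x ^ 2 = 0) : p = 0 := by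
  have h1 := sq_integral_eq_zero (memLp_cell_of_continuous (vset b) (continuous_ev p) 2) h
  rw [← restrict_interior_cell] at h1
  refine eq_zero_of_ev_eq_zero isOpen_interior (interior_cell_nonempty b) fun x hx => ?_
  exact Measure.eqOn_open_of_ae_eq h1 isOpen_interior (continuous_ev p).continuousOn
    continuousOn_const hx

/-- The data of the field `q` on one element: the traces of its components that define the
Raviart-Thomas projection `p`, and its divergence `f`. -/
structure FluxData (k : ℕ) (K : Finset (E d)) (q : E d → E d) (f : E d → ℝ) (p : PolyField d)
    (γ : Fin d → E d → ℝ) (G : Fin d → Fin d → E d → ℝ) : Prop where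
  trace : ∀ i, HasTrace K (fun x => q x i) (G i) (γ i)
  div_eq : (fun x => ∑ i, G i i x) =ᵐ[volume.restrict (cell K)] f
  normal_eq : ∀ e ∈ faces K, ∀ m ∈ polyLT d (k + 1),
    ∫ x, inner ℝ (evF p x) (normal K e) * ev m x ∂surf e =
      ∫ x, (∑ i, γ i x * normal K e i) * ev m x ∂surf e

theorem IsWeakDiv.mono {Ω U : Set (E d)} (hΩ : IsOpen Ω) (h : U ⊆ Ω) {q : E d → E d}
    {f : E d → ℝ} (hq : IsWeakDiv Ω q f) : IsWeakDiv U q f := by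
  intro φ hφ
  have h1 := hq φ ⟨hφ.1, hφ.2.1, hφ.2.2.trans h⟩
  -- Multiplication by the indicator of the support gives the product form that
  -- `setIntegral_eq_of_tsupport` requires.
  have h2 : (fun x => ∑ i, q x i * pd i φ x) =
      fun x => (∑ i, q x i * pd i φ x) * (tsupport φ).indicator 1 x := by
    funext x
    by_cases hx : x ∈ tsupport φ
    · simp [hx]
    · simp only [indicator_of_notMem hx, mul_zero]
      exact Finset.sum_eq_zero fun i _ => by
        rw [image_eq_zero_of_notMem_tsupport (fun h => hx (tsupport_pd_subset i φ h)), mul_zero]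
  have h3 : tsupport ((tsupport φ).indicator (1 : E d → ℝ)) ⊆ U :=
    (closure_minimal (fun x hx => by
      by_contra h; exact hx (indicator_of_notMem h _)) (isClosed_tsupport φ)).trans hφ.2.2
  rw [← setIntegral_eq_of_tsupport h hΩ.measurableSet hφ.2.2] at h1
  rw [← h1]
  rw [h2]
  exact setIntegral_eq_of_tsupport h hΩ.measurableSet h3

namespace Mesh

variable (T : Mesh d)

/-- The sum of the diagonal weak derivatives is a weak divergence of `q` on the element, hence equal
to `f`. Test functions that vanish on all faces but one separate the normal moments, which the
projection prescribes only in their sum. -/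
theorem exists_fluxData {Ω : Set (E d)} (hΩ : T.IsMeshOf Ω) {K : Finset (E d)}
    (hK : K ∈ T.elements) {q : E d → E d} {f : E d → ℝ} (hf : MemLp f 2 (volume.restrict Ω))
    (hdiv : IsWeakDiv Ω q f) {k : ℕ} {p : PolyField d} (hp : IsRTProjection k K q p) :
    ∃ γ G, FluxData k K q f p γ G := by
  classical
  obtain ⟨γ, hγ, hn⟩ := hp.normal_eq
  simp only [isTrace_iff] at hγ
  choose G hG using hγ
  obtain ⟨b, rfl⟩ := T.exists_basis hK
  refine ⟨γ, G, hG, ?_, fun e he m hm => ?_⟩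
  · rw [← restrict_interior_cell]
    have hle : (volume : Measure (E d)).restrict (interior (cell (vset b))) ≤ volume.restrict Ω :=
      Measure.restrict_mono (T.interior_subset_domain hΩ hK) le_rfl
    have hGm : ∀ i, MemLp (G i i) 2 (volume.restrict (interior (cell (vset b)))) := fun i => by
      rw [restrict_interior_cell]; exact (hG i).memLp_grad i
    refine ae_eq_of_forall_test isOpen_interior (memLp_finsetSum _ fun i _ => hGm i)
      (hf.mono_measure hle) fun φ hφ => ?_
    have h1 := (hdiv.mono (T.isOpen_domain hΩ) (T.interior_subset_domain hΩ hK)) φ hφ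
    have h2 : ∀ i, MemLp (pd i φ) 2 (volume.restrict (interior (cell (vset b)))) := fun i => by
      rw [restrict_interior_cell]
      exact memLp_cell_of_continuous _ (continuous_pd hφ.1 (by simp)) 2
    have h3 : MemLp φ 2 (volume.restrict (interior (cell (vset b)))) := by
      rw [restrict_interior_cell]
      exact memLp_cell_of_continuous _ hφ.1.continuous 2
    have h4 : ∀ i, MemLp (fun x => q x i) 2 (volume.restrict (interior (cell (vset b)))) :=
      fun i => by rw [restrict_interior_cell]; exact (hG i).memLp
    rw [integral_finsetSum _ fun i _ => integrable_mul (h4 i) (h2 i),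
      Finset.sum_congr rfl fun i _ => (hG i).isWeakPartial i φ hφ, Finset.sum_neg_distrib,
      neg_inj] at h1
    rw [← h1]
    simp only [Finset.sum_mul]
    exact integral_finsetSum _ fun i _ => integrable_mul (hGm i) h3
  · have h := hn (fun e' => if e' = e then m else 0) (fun e' _ => by
      split_ifs
      exacts [hm, Submodule.zero_mem _])
    rw [Finset.sum_eq_single_of_mem e he (fun e' _ hne => by simp [hne]),
      Finset.sum_eq_single_of_mem e he (fun e' _ hne => by simp [hne])] at h
    simpa using h

end Mesh

/-- The commuting property. After integration by parts, the volume term tests with the gradient of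
`w`, of degree below `k`, and the face terms test with `w`, of degree at most `k`; for both, the
projection has the moments of `q`. -/
theorem integral_pdiv_projection (hd : 0 < d) {k : ℕ} {b : AffineBasis (Fin (d + 1)) ℝ (E d)}
    {q : E d → E d} {f : E d → ℝ} {p : PolyField d} {γ : Fin d → E d → ℝ}
    {G : Fin d → Fin d → E d → ℝ} (hp : IsRTProjection k (vset b) q p)
    (h : FluxData k (vset b) q f p γ G) {w : MvPolynomial (Fin d) ℝ} (hw : w ∈ polyLT d (k + 1)) :
    ∫ x in cell (vset b), ev (pdiv p) x * ev w x = ∫ x in cell (vset b), f x * ev w x := by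
  have h1 := green_div hd b h.trace (contDiff_ev w)
  have h2 := green_evF hd b p (contDiff_ev w)
  have h3 := hp.inner_eq (fun i => pderiv i w) fun i => pderiv_mem_polyLT i hw
  have h4 := Finset.sum_congr rfl fun e he => h.normal_eq e he w hw
  simp only [inner_eq_sum, evF_apply, ← pd_ev] at h3
  have h5 : ∫ x in cell (vset b), (∑ i, G i i x) * ev w x =
      ∫ x in cell (vset b), f x * ev w x := by
    refine integral_congr_ae ?_
    filter_upwards [h.div_eq] with x hx
    rw [hx]
  linarith

end RTM

end

/-! ### Continuity across interior faces -/

noncomputable section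
namespace RTM
variable {d : ℕ}

open MvPolynomial

namespace Mesh

variable (T : Mesh d)

theorem sum_faces_comm {M : Type*} [AddCommMonoid M] (F : Finset (E d) → Finset (E d) → M) :
    ∑ K ∈ T.elements, ∑ e ∈ faces K, F K e =
      ∑ e ∈ T.allFaces, ∑ K ∈ T.elements with e ∈ faces K, F K e := by
  refine Finset.sum_comm' fun K e => ?_
  rw [Finset.mem_filter, T.mem_allFaces]
  exact ⟨fun h => ⟨⟨h.1, h.2⟩, K, h.1, h.2⟩, fun h => ⟨h.1.1, h.1.2⟩⟩

theorem memLp_surf_of_continuous (hd : 0 < d) {e : Finset (E d)} (he : e ∈ T.allFaces)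
    {f : E d → ℝ} (hf : Continuous f) (p : ENNReal) : MemLp f p (surf e) := by
  obtain ⟨K, hK, he⟩ := T.mem_allFaces.1 he
  obtain ⟨b, rfl⟩ := T.exists_basis hK
  obtain ⟨j, rfl⟩ := (mem_faces_iff b e).1 he
  exact RTM.memLp_surf_of_continuous hd b j hf p

/-- The normal traces of a field in `H(div)` agree on interior faces. -/
theorem flux_jump_ae_eq_zero (hd : 2 ≤ d) {Ω : Set (E d)} (hΩ : T.IsMeshOf Ω) {q : E d → E d}
    {f : E d → ℝ} (hq : ∀ i, MemLp (fun x => q x i) 2 (volume.restrict Ω))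
    (hf : MemLp f 2 (volume.restrict Ω)) (hdiv : IsWeakDiv Ω q f)
    {γ : Finset (E d) → Fin d → E d → ℝ} {G : Finset (E d) → Fin d → Fin d → E d → ℝ}
    (h : ∀ K ∈ T.elements, ∀ i, HasTrace K (fun x => q x i) (G K i) (γ K i))
    (hG : ∀ K ∈ T.elements, (fun x => ∑ i, G K i i x) =ᵐ[volume.restrict (cell K)] f)
    {e : Finset (E d)} (he : e ∈ T.allFaces) (hb : ¬ OnBoundary Ω e) :
    ∀ᵐ x ∂surf e, ∑ K ∈ T.elements with e ∈ faces K, ∑ i, γ K i x * normal K e i = 0 := by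
  refine T.jump_ae_eq_zero hd hΩ (g := fun K e x => ∑ i, γ K i x * normal K e i)
    (fun K hK e he => memLp_finsetSum _ fun i _ => ((h K hK i).memLp_trace e he).mul_const _)
    (fun φ hφ => ?_) he hb
  have hφ2 : MemLp φ 2 (volume.restrict Ω) :=
    (hφ.1.continuous.memLp_of_hasCompactSupport hφ.2.1).restrict Ω
  have hpd : ∀ i, MemLp (pd i φ) 2 (volume.restrict Ω) := fun i =>
    ((continuous_pd hφ.1 (by simp)).memLp_of_hasCompactSupport
      (hφ.2.1.mono' ((subset_tsupport _).trans (tsupport_pd_subset i φ)))).restrict Ω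
  have h1 : ∀ K ∈ T.elements, ∑ e ∈ faces K, ∫ x, (∑ i, γ K i x * normal K e i) * φ x ∂surf e =
      (∫ x in cell K, ∑ i, q x i * pd i φ x) + ∫ x in cell K, f x * φ x := by
    intro K hK
    have h2 := h K hK
    have h3 := hG K hK
    obtain ⟨b, rfl⟩ := T.exists_basis hK
    rw [← green_div (by omega) b h2 hφ.1]
    congr 1
    refine integral_congr_ae ?_
    filter_upwards [h3] with x hx
    rw [← hx]
  -- Summed over the elements, Green's formula becomes the definition of the weak divergence on the
  -- whole domain.
  rw [Finset.sum_congr rfl h1, Finset.sum_add_distrib,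
    T.sum_integral_cell hΩ (integrable_finsetSum _ fun i _ => integrable_mul (hq i) (hpd i)),
    T.sum_integral_cell hΩ (integrable_mul hf hφ2), hdiv φ hφ, neg_add_cancel]

/-- The traces of a function in `H¹` from the two sides of an interior face agree. -/
theorem trace_eq_of_interior (hd : 2 ≤ d) {Ω : Set (E d)} (hΩ : T.IsMeshOf Ω) {u : E d → ℝ}
    {D : Fin d → E d → ℝ} (hu : MemLp u 2 (volume.restrict Ω))
    (hD : ∀ i, MemLp (D i) 2 (volume.restrict Ω)) (hw : ∀ i, IsWeakPartial Ω i u (D i))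
    {g : Finset (E d) → E d → ℝ} (h : ∀ K ∈ T.elements, HasTrace K u D (g K))
    {e : Finset (E d)} (he : e ∈ T.allFaces) (hb : ¬ OnBoundary Ω e) {K L : Finset (E d)}
    (hKL : K ≠ L) (hf : T.elements.filter (fun K => e ∈ faces K) = {K, L})
    (hn : normal L e = -normal K e) : g K =ᵐ[surf e] g L := by
  have h0 : ∀ i, ∀ᵐ x ∂surf e, ∑ K ∈ T.elements with e ∈ faces K, g K x * normal K e i = 0 := by
    intro i
    refine T.jump_ae_eq_zero hd hΩ (g := fun K e x => g K x * normal K e i)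
      (fun K hK e he => ((h K hK).memLp_trace e he).mul_const _) (fun φ hφ => ?_) he hb
    have hφ2 : MemLp φ 2 (volume.restrict Ω) :=
      (hφ.1.continuous.memLp_of_hasCompactSupport hφ.2.1).restrict Ω
    have hpd : MemLp (pd i φ) 2 (volume.restrict Ω) :=
      ((continuous_pd hφ.1 (by simp)).memLp_of_hasCompactSupport
        (hφ.2.1.mono' ((subset_tsupport _).trans (tsupport_pd_subset i φ)))).restrict Ω
    have h1 : ∀ K ∈ T.elements, ∑ e ∈ faces K, ∫ x, (g K x * normal K e i) * φ x ∂surf e =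
        (∫ x in cell K, u x * pd i φ x) + ∫ x in cell K, D i x * φ x := by
      intro K hK
      rw [(h K hK).green i φ hφ.1]
      exact Finset.sum_congr rfl fun e _ => integral_congr_ae (.of_forall fun x => by ring)
    rw [Finset.sum_congr rfl h1, Finset.sum_add_distrib,
      T.sum_integral_cell hΩ (integrable_mul hu hpd),
      T.sum_integral_cell hΩ (integrable_mul (hD i) hφ2), hw i φ hφ, neg_add_cancel]
  have hK : K ∈ T.elements ∧ e ∈ faces K := by
    have : K ∈ T.elements.filter (fun K => e ∈ faces K) := by rw [hf]; simp
    simpa using this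
  have hne : normal K e ≠ 0 := T.normal_ne_zero (by omega) hK.1 hK.2
  -- With opposite normals the jump relation is the difference of the traces times a component of
  -- the normal; one nonzero component suffices.
  obtain ⟨i, hi⟩ : ∃ i, normal K e i ≠ 0 := by
    by_contra! hall
    exact hne (by ext i; simpa using hall i)
  filter_upwards [h0 i] with x hx
  rw [hf, Finset.sum_pair hKL, hn] at hx
  have : (g K x - g L x) * normal K e i = 0 := by
    rw [PiLp.neg_apply] at hx; linarith
  rcases mul_eq_zero.1 this with h | h
  · linarith
  · exact absurd h hi

/-- Polynomials that represent the normal components of a Raviart-Thomas field on the faces. -/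
theorem exists_normal_polys (hd : 0 < d) {k : ℕ} {r : Finset (E d) → PolyField d}
    (hr : r ∈ Vh T k) : ∃ m : Finset (E d) → Finset (E d) → MvPolynomial (Fin d) ℝ,
      ∀ K ∈ T.elements, ∀ e ∈ faces K, m K e ∈ polyLT d (k + 1) ∧
        ∀ x ∈ cell e, ev (m K e) x = inner ℝ (evF (r K) x) (normal K e) := by
  have : ∀ K e, ∃ m : MvPolynomial (Fin d) ℝ, K ∈ T.elements → e ∈ faces K →
      m ∈ polyLT d (k + 1) ∧ ∀ x ∈ cell e, ev m x = inner ℝ (evF (r K) x) (normal K e) := by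
    intro K e
    by_cases hK : K ∈ T.elements
    swap; · exact ⟨0, fun h => absurd h hK⟩
    by_cases he : e ∈ faces K
    swap; · exact ⟨0, fun _ h => absurd h he⟩
    have hrK := hr K hK
    obtain ⟨b, rfl⟩ := T.exists_basis hK
    obtain ⟨c, hc⟩ := inner_normal_eq_const hd b he
    obtain ⟨m, hm, hm'⟩ := exists_normal_component hrK (normal (vset b) e) c
    exact ⟨m, fun _ _ => ⟨hm, fun x hx => hm' x (hc x hx)⟩⟩
  choose m hm using this
  exact ⟨m, fun K hK e he => hm K e hK he⟩

/-- The error of the flux has a continuous normal component. -/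
theorem normal_jump_eq_zero (hd : 2 ≤ d) {k : ℕ}
    {r : Finset (E d) → PolyField d} (hr : r ∈ Vh T k)
    {e : Finset (E d)} (he : e ∈ T.allFaces)
    (h : ∀ m ∈ polyLT d (k + 1), ∑ K ∈ T.elements with e ∈ faces K,
      ∫ x, inner ℝ (evF (r K) x) (normal K e) * ev m x ∂surf e = 0) :
    ∀ᵐ x ∂surf e, ∑ K ∈ T.elements with e ∈ faces K,
      inner ℝ (evF (r K) x) (normal K e) = 0 := by
  have hd0 : 0 < d := by omega
  obtain ⟨m, hm⟩ := T.exists_normal_polys hd0 hr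
  -- The jump itself, as a polynomial of degree at most `k`, is an admissible test function; its
  -- square then has integral zero.
  set M := ∑ K ∈ T.elements with e ∈ faces K, m K e with hM
  have hev : ∀ x ∈ cell e, ev M x = ∑ K ∈ T.elements with e ∈ faces K,
      inner ℝ (evF (r K) x) (normal K e) := by
    intro x hx
    rw [hM, ev_sum]
    refine Finset.sum_congr rfl fun K hK => ?_
    rw [Finset.mem_filter] at hK
    exact (hm K hK.1 e hK.2).2 x hx
  have h1 := h M (Submodule.sum_mem _ fun K hK => by
    rw [Finset.mem_filter] at hK
    exact (hm K hK.1 e hK.2).1)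
  have hmL : ∀ p : MvPolynomial (Fin d) ℝ, MemLp (ev p) 2 (surf e) := fun p =>
    T.memLp_surf_of_continuous hd0 he (continuous_ev p) 2
  rw [← integral_finsetSum _ fun K _ => integrable_mul
    (T.memLp_surf_of_continuous hd0 he ((continuous_evF _).inner continuous_const) 2)
    (hmL M)] at h1
  have h2 : ∫ x, ev M x ^ 2 ∂surf e = 0 := by
    rw [← h1]
    refine integral_congr_ae ?_
    filter_upwards [ae_mem_cell_surf e] with x hx
    rw [← Finset.sum_mul, ← hev x hx, sq]
  filter_upwards [sq_integral_eq_zero (hmL M) h2, ae_mem_cell_surf e] with x hx hxe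
  rw [← hev x hxe, hx, Pi.zero_apply]

end Mesh
end RTM

end

/-! ### The error equation and the estimate by the projection error -/

noncomputable section
namespace RTM
variable {d : ℕ}

open MvPolynomial

theorem pdiv_sub (p q : PolyField d) : pdiv (p - q) = pdiv p - pdiv q := by
  simp [pdiv]

theorem inner_evF_sub (p q : PolyField d) (x v : E d) :
    inner ℝ (evF (p - q) x) v = inner ℝ (evF p x) v - inner ℝ (evF q x) v := by
  rw [evF_sub, inner_sub_left]

theorem integrable_inv_mul {μ : Measure (E d)} {κ F : E d → ℝ} {κ₀ κ₁ : ℝ} (hκ₀ : 0 < κ₀)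
    (hκm : AEMeasurable κ μ) (hκ : ∀ᵐ x ∂μ, κ₀ ≤ κ x ∧ κ x ≤ κ₁) (hF : Integrable F μ) :
    Integrable (fun x => (κ x)⁻¹ * F x) μ := by
  refine hF.bdd_mul (c := κ₀⁻¹) hκm.inv.aestronglyMeasurable ?_
  filter_upwards [hκ] with x hx
  have : 0 < κ x := hκ₀.trans_le hx.1
  rw [Real.norm_of_nonneg (by positivity)]
  exact inv_anti₀ hκ₀ hx.1

namespace Mesh

variable (T : Mesh d)

/-- The divergence of the error has degree at most `k` and may be used as the test function: by
`integral_pdiv_projection` and the discrete balance, both divergences have the moments of `f`. -/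
theorem pdiv_error_eq_zero (hd : 0 < d) {Ω : Set (E d)} {k : ℕ} {κ f u₀ : E d → ℝ}
    {q : E d → E d} {qh Pq : Finset (E d) → PolyField d}
    {uh uhat : Finset (E d) → MvPolynomial (Fin d) ℝ}
    (hdisc : IsDiscreteSolution T Ω k κ f u₀ qh uh uhat)
    (hP : ∀ K ∈ T.elements, IsRTProjection k K q (Pq K)) {γ : Finset (E d) → Fin d → E d → ℝ}
    {G : Finset (E d) → Fin d → Fin d → E d → ℝ}
    (hγ : ∀ K ∈ T.elements, FluxData k K q f (Pq K) (γ K) (G K))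
    {K : Finset (E d)} (hK : K ∈ T.elements) : pdiv (Pq K - qh K) = 0 := by
  classical
  have hPK := hP K hK
  have hγK := hγ K hK
  set w := pdiv (Pq K - qh K) with hw
  have hwm : w ∈ polyLT d (k + 1) :=
    pdiv_mem_polyLT (Submodule.sub_mem _ hPK.mem (hdisc.q_mem K hK))
  have h1 := hdisc.balance (fun L => if L = K then w else 0) fun L _ => by
    dsimp only; split_ifs
    exacts [hwm, Submodule.zero_mem _]
  rw [Finset.sum_eq_single_of_mem K hK (fun L _ hne => by simp [hne]),
    Finset.sum_eq_single_of_mem K hK (fun L _ hne => by simp [hne])] at h1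
  simp only [if_true] at h1
  obtain ⟨b, rfl⟩ := T.exists_basis hK
  have h2 := integral_pdiv_projection hd hPK hγK hwm
  refine eq_zero_of_integral_sq_eq_zero b ?_
  have hm : ∀ p : MvPolynomial (Fin d) ℝ, MemLp (ev p) 2 (volume.restrict (cell (vset b))) :=
    fun p => memLp_cell_of_continuous _ (continuous_ev p) 2
  have h3 : ∀ x, ev w x ^ 2 = ev (pdiv (Pq (vset b))) x * ev w x -
      ev (pdiv (qh (vset b))) x * ev w x := by
    intro x
    rw [← sub_mul, ← ev_sub, ← pdiv_sub, sq]
  simp only [h3]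
  rw [integral_sub (integrable_mul (hm _) (hm _)) (integrable_mul (hm _) (hm _)), h1, h2, sub_self]

theorem continuity_face {Ω : Set (E d)} {k : ℕ} {κ f u₀ : E d → ℝ}
    {qh : Finset (E d) → PolyField d} {uh uhat : Finset (E d) → MvPolynomial (Fin d) ℝ}
    (hdisc : IsDiscreteSolution T Ω k κ f u₀ qh uh uhat) {e : Finset (E d)}
    (hb : ¬ OnBoundary Ω e) {m : MvPolynomial (Fin d) ℝ} (hm : m ∈ polyLT d (k + 1)) :
    ∑ K ∈ T.elements with e ∈ faces K,
      ∫ x, inner ℝ (evF (qh K) x) (normal K e) * ev m x ∂surf e = 0 := by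
  classical
  have h := hdisc.continuity (fun e' => if e' = e then m else 0) ⟨fun e' _ => by
      dsimp only; split_ifs
      exacts [hm, Submodule.zero_mem _], fun e' _ he' => by
      dsimp only
      rw [if_neg]
      rintro rfl
      exact hb he'⟩
  rw [← h, Finset.sum_filter]
  refine Finset.sum_congr rfl fun K _ => ?_
  split_ifs with he
  · rw [Finset.sum_eq_single_of_mem e (Finset.mem_filter.2 ⟨he, hb⟩)
      (fun e' _ hne => by simp [hne])]
    simp
  · refine (Finset.sum_eq_zero fun e' he' => ?_).symm
    rw [if_neg (by rintro rfl; exact he (Finset.mem_filter.1 he').1)]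
    simp

open Classical in
/-- The error equation tested with a divergence-free field with continuous normal component. -/
theorem flux_orthogonality (hd : 2 ≤ d) {Ω : Set (E d)} (hΩ : T.IsMeshOf Ω) {k : ℕ}
    {κ f u₀ : E d → ℝ} {q : E d → E d} {u : E d → ℝ}
    (hex : IsExactSolution T Ω κ f u₀ q u) {qh : Finset (E d) → PolyField d}
    {uh uhat : Finset (E d) → MvPolynomial (Fin d) ℝ}
    (hdisc : IsDiscreteSolution T Ω k κ f u₀ qh uh uhat) {r : Finset (E d) → PolyField d}
    (hr : r ∈ Vh T k) (hr0 : ∀ K ∈ T.elements, pdiv (r K) = 0)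
    (hjump : ∀ e ∈ T.allFaces, ¬ OnBoundary Ω e → ∀ᵐ x ∂surf e,
      ∑ K ∈ T.elements with e ∈ faces K, inner ℝ (evF (r K) x) (normal K e) = 0) :
    ∑ K ∈ T.elements, ∫ x in cell K, (κ x)⁻¹ * inner ℝ (q x) (evF (r K) x) =
      ∑ K ∈ T.elements, ∫ x in cell K, (κ x)⁻¹ * inner ℝ (evF (qh K) x) (evF (r K) x) := by
  have hd0 : 0 < d := by omega
  obtain ⟨D, hD, hflux⟩ := hex.flux
  have hDm : ∀ i, MemLp (D (Pi.single i 1)) 2 (volume.restrict Ω) := fun i =>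
    hD.memLp _ (by simp)
  have hwp : ∀ i, IsWeakPartial Ω i u (D (Pi.single i 1)) := fun i => by
    have := hD.succ 0 i (by simp)
    rw [zero_add] at this
    exact this.congr hD.zero .rfl
  have hu : MemLp u 2 (volume.restrict Ω) := (hD.memLp 0 (by simp)).ae_eq hD.zero
  have hle := fun K (hK : K ∈ T.elements) => T.restrict_cell_le hΩ hK
  -- Traces of `u` from every element, all with the same global gradient; the boundary condition of
  -- the exact solution only speaks of elements that have a boundary face.
  have hg : ∀ K, ∃ g, K ∈ T.elements → HasTrace K u (fun i => D (Pi.single i 1)) g := by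
    intro K
    by_cases hK : K ∈ T.elements
    swap; · exact ⟨0, fun h => absurd h hK⟩
    have hleK := hle K hK
    have hsub := T.interior_subset_domain hΩ hK
    obtain ⟨b, rfl⟩ := T.exists_basis hK
    obtain ⟨g, hg⟩ := exists_hasTrace hd0 b (hu.mono_measure hleK)
      (fun i => (hDm i).mono_measure hleK) fun i => (hwp i).mono (T.isOpen_domain hΩ) hsub
    exact ⟨g, fun _ => hg⟩
  choose g hg using hg
  have hgb : ∀ K ∈ T.elements, ∀ e ∈ faces K, OnBoundary Ω e → g K =ᵐ[surf e] u₀ := by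
    intro K hK e he hb
    obtain ⟨g', hg', hgu⟩ := hex.boundary K hK e he hb
    obtain ⟨G', hG'⟩ := isTrace_iff.1 hg'
    have hgK := hg K hK
    have hleK := hle K hK
    have hsub := T.interior_subset_domain hΩ hK
    obtain ⟨b, rfl⟩ := T.exists_basis hK
    -- The trace in the boundary condition carries its own weak gradient; once this is identified
    -- with that of `u`, uniqueness of traces applies.
    have h1 := hG'.congr .rfl fun i => hG'.grad_ae_eq ((hDm i).mono_measure hleK)
      ((hwp i).mono (T.isOpen_domain hΩ) hsub)
    exact (hgK.trace_ae_eq hd0 h1 he).trans hgu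
  obtain ⟨m, hm⟩ := T.exists_normal_polys hd0 hr
  have hnL : ∀ e ∈ T.allFaces, ∀ K, MemLp (fun x => inner ℝ (evF (r K) x) (normal K e)) 2
      (surf e) := fun e he K =>
    T.memLp_surf_of_continuous hd0 he ((continuous_evF _).inner continuous_const) 2
  -- the continuous equation
  have hA : ∑ K ∈ T.elements, ∫ x in cell K, (κ x)⁻¹ * inner ℝ (q x) (evF (r K) x) =
      -∑ e ∈ T.allFaces with OnBoundary Ω e, ∑ K ∈ T.elements with e ∈ faces K,
        ∫ x, u₀ x * inner ℝ (evF (r K) x) (normal K e) ∂surf e := by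
    have h1 : ∀ K ∈ T.elements, ∫ x in cell K, (κ x)⁻¹ * inner ℝ (q x) (evF (r K) x) =
        -∑ e ∈ faces K, ∫ x, g K x * inner ℝ (evF (r K) x) (normal K e) ∂surf e := by
      intro K hK
      have hae : ∀ᵐ x ∂volume.restrict (cell K), ∀ i,
          (κ x)⁻¹ * q x i + D (Pi.single i 1) x = 0 :=
        ae_mono (hle K hK) (ae_all_iff.2 hflux)
      have hgK := hg K hK
      have hrK := hr0 K hK
      obtain ⟨b, rfl⟩ := T.exists_basis hK
      -- Since `r` is divergence-free, only the gradient term and the boundary terms of Green's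
      -- formula remain.
      have h2 := hgK.green_evF hd0 (r (vset b))
      rw [hrK] at h2
      simp only [ev_zero, mul_zero, integral_zero, zero_add] at h2
      rw [← h2, ← integral_neg]
      refine integral_congr_ae ?_
      filter_upwards [hae] with x hx
      rw [inner_eq_sum, Finset.mul_sum, ← Finset.sum_neg_distrib]
      refine Finset.sum_congr rfl fun i _ => ?_
      rw [evF_apply]
      linear_combination ev (r (vset b) i) x * hx i
    rw [Finset.sum_congr rfl h1, Finset.sum_neg_distrib, T.sum_faces_comm, Finset.sum_filter]
    congr 1
    refine Finset.sum_congr rfl fun e he => ?_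
    split_ifs with hb
    · refine Finset.sum_congr rfl fun K hK => integral_congr_ae ?_
      rw [Finset.mem_filter] at hK
      filter_upwards [hgb K hK.1 e hK.2 hb] with x hx
      rw [hx]
    -- On an interior face the two traces of `u` agree and the normal components of `r` cancel.
    · obtain ⟨K, L, hKL, hf, hn, -⟩ := T.exists_pair hd hΩ he hb
      have h3 := T.trace_eq_of_interior hd hΩ hu hDm hwp hg he hb hKL hf hn
      have h4 := hjump e he hb
      have hmem : ∀ M ∈ T.elements.filter (fun K => e ∈ faces K), Integrable
          (fun x => g M x * inner ℝ (evF (r M) x) (normal M e)) (surf e) := fun M hM => by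
        rw [Finset.mem_filter] at hM
        exact integrable_mul ((hg M hM.1).memLp_trace e hM.2) (hnL e he M)
      rw [← integral_finsetSum _ hmem]
      refine integral_eq_zero_of_ae ?_
      filter_upwards [h3, h4] with x hx3 hx4
      rw [hf, Finset.sum_pair hKL] at hx4 ⊢
      rw [← hx3, ← mul_add, hx4, mul_zero, Pi.zero_apply]
  -- the discrete equation
  have hB := hdisc.flux r hr
  have hB2 : ∑ K ∈ T.elements, ∫ x in cell K, ev (uh K) x * ev (pdiv (r K)) x = 0 :=
    Finset.sum_eq_zero fun K hK => by simp [hr0 K hK]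
  have hB3 : ∑ K ∈ T.elements, ∑ e ∈ faces K,
        ∫ x, ev (uhat e) x * inner ℝ (evF (r K) x) (normal K e) ∂surf e =
      ∑ e ∈ T.allFaces with OnBoundary Ω e, ∑ K ∈ T.elements with e ∈ faces K,
        ∫ x, ev (uhat e) x * inner ℝ (evF (r K) x) (normal K e) ∂surf e := by
    rw [T.sum_faces_comm, Finset.sum_filter]
    refine Finset.sum_congr rfl fun e he => ?_
    split_ifs with hb
    · rfl
    -- The discrete trace has one value per face, so it factors out of the vanishing jump.
    · rw [← integral_finsetSum _ fun M _ => integrable_mul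
        (T.memLp_surf_of_continuous hd0 he (continuous_ev (uhat e)) 2) (hnL e he M)]
      refine integral_eq_zero_of_ae ?_
      filter_upwards [hjump e he hb] with x hx
      rw [← Finset.mul_sum, hx, mul_zero, Pi.zero_apply]
  -- The normal component of `r` on boundary faces, written as a polynomial, is an admissible test
  -- function; it exchanges the discrete trace for `u₀`.
  have hB4 := hdisc.boundary
    (fun e => if OnBoundary Ω e then ∑ K ∈ T.elements with e ∈ faces K, m K e else 0)
    ⟨fun e _ => by
      dsimp only
      split_ifs
      · refine Submodule.sum_mem _ fun K hK => ?_
        rw [Finset.mem_filter] at hK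
        exact (hm K hK.1 e hK.2).1
      · exact Submodule.zero_mem _, fun e _ he => by dsimp only; rw [if_neg he]⟩
  have hC : ∀ (e : Finset (E d)) (v : E d → ℝ), e ∈ T.allFaces → OnBoundary Ω e →
      MemLp v 2 (surf e) →
      ∫ x, v x * ev (if OnBoundary Ω e then ∑ K ∈ T.elements with e ∈ faces K, m K e else 0) x
        ∂surf e = ∑ K ∈ T.elements with e ∈ faces K,
        ∫ x, v x * inner ℝ (evF (r K) x) (normal K e) ∂surf e := by
    intro e v he hb hv
    rw [← integral_finsetSum _ fun M _ => integrable_mul hv (hnL e he M)]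
    refine integral_congr_ae ?_
    filter_upwards [ae_mem_cell_surf e] with x hx
    rw [if_pos hb, ev_sum, Finset.mul_sum]
    refine Finset.sum_congr rfl fun K hK => ?_
    rw [Finset.mem_filter] at hK
    rw [(hm K hK.1 e hK.2).2 x hx]
  -- Square integrability of `u₀` on boundary faces is inherited from the trace of `u`.
  have hu₀ : ∀ e ∈ T.allFaces, OnBoundary Ω e → MemLp u₀ 2 (surf e) := by
    intro e he hb
    obtain ⟨K, hK, heK⟩ := T.mem_allFaces.1 he
    exact ((hg K hK).memLp_trace e heK).ae_eq (hgb K hK e heK hb)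
  rw [Finset.sum_congr rfl fun e he => hC e (ev (uhat e)) (Finset.mem_filter.1 he).1
      (Finset.mem_filter.1 he).2 (T.memLp_surf_of_continuous hd0 (Finset.mem_filter.1 he).1
        (continuous_ev _) 2),
    Finset.sum_congr rfl fun e he => hC e u₀ (Finset.mem_filter.1 he).1
      (Finset.mem_filter.1 he).2 (hu₀ e (Finset.mem_filter.1 he).1 (Finset.mem_filter.1 he).2)]
    at hB4
  linarith

/-- The flux error is bounded by the error of the Raviart-Thomas projection. -/
theorem wNorm_flux_error_le (hd : 2 ≤ d) {Ω : Set (E d)} (hΩ : T.IsMeshOf Ω) {k : ℕ}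
    {κ₀ κ₁ : ℝ} (hκ₀ : 0 < κ₀) {κ f u₀ : E d → ℝ} (hκm : AEMeasurable κ (volume.restrict Ω))
    (hκ : ∀ᵐ x ∂volume.restrict Ω, κ₀ ≤ κ x ∧ κ x ≤ κ₁) (hf : MemLp f 2 (volume.restrict Ω))
    {q : E d → E d} {u : E d → ℝ}
    (hex : IsExactSolution T Ω κ f u₀ q u) {qh : Finset (E d) → PolyField d}
    {uh uhat : Finset (E d) → MvPolynomial (Fin d) ℝ}
    (hdisc : IsDiscreteSolution T Ω k κ f u₀ qh uh uhat) {Pq : Finset (E d) → PolyField d}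
    (hP : ∀ K ∈ T.elements, IsRTProjection k K q (Pq K)) :
    wNorm T (fun x => (κ x)⁻¹) (fun K x => evF (Pq K) x - evF (qh K) x) ≤
      wNorm T (fun x => (κ x)⁻¹) (fun K x => evF (Pq K) x - q x) := by
  have hd0 : 0 < d := by omega
  have hex' : ∀ K, ∃ γ G, K ∈ T.elements → FluxData k K q f (Pq K) γ G := by
    intro K
    by_cases hK : K ∈ T.elements
    · obtain ⟨γ, G, h⟩ := T.exists_fluxData hΩ hK hf hex.div_eq (hP K hK)
      exact ⟨γ, G, fun _ => h⟩
    · exact ⟨0, 0, fun h => absurd h hK⟩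
  choose γ G hγ using hex'
  set r : Finset (E d) → PolyField d := fun K => Pq K - qh K with hrdef
  have hr : r ∈ Vh T k := fun K hK => Submodule.sub_mem _ (hP K hK).mem (hdisc.q_mem K hK)
  have hr0 : ∀ K ∈ T.elements, pdiv (r K) = 0 := fun K hK =>
    T.pdiv_error_eq_zero hd0 hdisc hP hγ hK
  have hjump : ∀ e ∈ T.allFaces, ¬ OnBoundary Ω e → ∀ᵐ x ∂surf e,
      ∑ K ∈ T.elements with e ∈ faces K, inner ℝ (evF (r K) x) (normal K e) = 0 := by
    intro e he hb
    refine T.normal_jump_eq_zero hd hr he fun m hm => ?_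
    have h1 := T.flux_jump_ae_eq_zero hd hΩ hex.q_memLp hf hex.div_eq
      (fun K hK => (hγ K hK).trace) (fun K hK => (hγ K hK).div_eq) he hb
    have hmL := T.memLp_surf_of_continuous hd0 he (continuous_ev m) 2
    -- The moments of the projection are those of `q`, whose normal traces cancel almost everywhere
    -- on `e`.
    have h2 : ∑ K ∈ T.elements with e ∈ faces K,
        ∫ x, inner ℝ (evF (Pq K) x) (normal K e) * ev m x ∂surf e = 0 := by
      rw [Finset.sum_congr rfl fun K hK => (hγ K (Finset.mem_filter.1 hK).1).normal_eq e
        (Finset.mem_filter.1 hK).2 m hm, ← integral_finsetSum _ fun K hK => integrable_mul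
          (memLp_finsetSum _ fun i _ => (((hγ K (Finset.mem_filter.1 hK).1).trace i).memLp_trace e
            (Finset.mem_filter.1 hK).2).mul_const _) hmL]
      refine integral_eq_zero_of_ae ?_
      filter_upwards [h1] with x hx
      rw [← Finset.sum_mul, hx, zero_mul, Pi.zero_apply]
    have h3 := T.continuity_face hdisc hb hm
    have hL : ∀ p : PolyField d, ∀ v, Integrable (fun x => inner ℝ (evF p x) v * ev m x)
        (surf e) := fun p v => integrable_mul
      (T.memLp_surf_of_continuous hd0 he ((continuous_evF p).inner continuous_const) 2) hmL
    rw [← sub_zero (0 : ℝ)]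
    nth_rewrite 1 [← h2]
    rw [← h3, ← Finset.sum_sub_distrib]
    refine Finset.sum_congr rfl fun K _ => ?_
    rw [← integral_sub (hL _ _) (hL _ _)]
    refine integral_congr_ae (.of_forall fun x => ?_)
    simp only [hrdef, inner_evF_sub]; ring
  have horth := T.flux_orthogonality hd hΩ hex hdisc hr hr0 hjump
  refine Real.sqrt_le_sqrt ?_
  have hle := fun K (hK : K ∈ T.elements) => T.restrict_cell_le hΩ hK
  have hqL : ∀ K ∈ T.elements, ∀ i, MemLp (fun x => q x i) 2 (volume.restrict (cell K)) :=
    fun K hK i => (hex.q_memLp i).mono_measure (hle K hK)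
  have hI : ∀ K ∈ T.elements, ∀ v w : E d → E d,
      (∀ i, MemLp (fun x => v x i) 2 (volume.restrict (cell K))) →
      (∀ i, MemLp (fun x => w x i) 2 (volume.restrict (cell K))) →
      Integrable (fun x => (κ x)⁻¹ * inner ℝ (v x) (w x)) (volume.restrict (cell K)) :=
    fun K hK v w hv hw => integrable_inv_mul hκ₀ (hκm.mono_measure (hle K hK))
      (ae_mono (hle K hK) hκ) (integrable_inner hv hw)
  have hI2 : ∀ K ∈ T.elements, ∀ v : E d → E d,
      (∀ i, MemLp (fun x => v x i) 2 (volume.restrict (cell K))) →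
      Integrable (fun x => (κ x)⁻¹ * ‖v x‖ ^ 2) (volume.restrict (cell K)) :=
    fun K hK v hv => by simpa only [real_inner_self_eq_norm_sq] using hI K hK v v hv hv
  have hrL : ∀ K, ∀ i, MemLp (fun x => (evF (Pq K) x - evF (qh K) x) i) 2
      (volume.restrict (cell K)) := fun K i => by
    have := memLp_evF_cell K (r K) i
    simpa only [hrdef, evF_sub] using this
  have hPL : ∀ K ∈ T.elements, ∀ i, MemLp (fun x => (evF (Pq K) x - q x) i) 2
      (volume.restrict (cell K)) := fun K hK i => (memLp_evF_cell K (Pq K) i).sub (hqL K hK i)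
  -- Pointwise, `|r|²` is `(Πq - q)·r + (q - q_h)·r`. Young's inequality with factor one half on the
  -- first product replaces Cauchy–Schwarz; the second sums to zero by orthogonality, and half of
  -- the left side is absorbed.
  have key : ∑ K ∈ T.elements, ∫ x in cell K, (κ x)⁻¹ * ‖evF (Pq K) x - evF (qh K) x‖ ^ 2 ≤
      ∑ K ∈ T.elements, ((1 / 2) *
        (∫ x in cell K, (κ x)⁻¹ * ‖evF (Pq K) x - evF (qh K) x‖ ^ 2) +
        ((1 / 2) * ∫ x in cell K, (κ x)⁻¹ * ‖evF (Pq K) x - q x‖ ^ 2) +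
        ((∫ x in cell K, (κ x)⁻¹ * inner ℝ (q x) (evF (r K) x)) -
          ∫ x in cell K, (κ x)⁻¹ * inner ℝ (evF (qh K) x) (evF (r K) x))) := by
    refine Finset.sum_le_sum fun K hK => ?_
    have hi1 := hI2 K hK _ (hrL K)
    have hi2 := hI2 K hK _ (hPL K hK)
    have hi3 := hI K hK _ _ (hqL K hK) (memLp_evF_cell K (r K))
    have hi4 := hI K hK _ _ (memLp_evF_cell K (qh K)) (memLp_evF_cell K (r K))
    have hi5 : Integrable (fun x => 1 / 2 * ((κ x)⁻¹ * ‖evF (Pq K) x - evF (qh K) x‖ ^ 2) +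
        1 / 2 * ((κ x)⁻¹ * ‖evF (Pq K) x - q x‖ ^ 2)) (volume.restrict (cell K)) :=
      (hi1.const_mul _).add (hi2.const_mul _)
    have hi6 : Integrable (fun x => (κ x)⁻¹ * inner ℝ (q x) (evF (r K) x) -
        (κ x)⁻¹ * inner ℝ (evF (qh K) x) (evF (r K) x)) (volume.restrict (cell K)) := hi3.sub hi4
    rw [← integral_const_mul, ← integral_const_mul, ← integral_sub hi3 hi4,
      ← integral_add (hi1.const_mul _) (hi2.const_mul _), ← integral_add hi5 hi6]
    refine integral_mono_ae hi1 (hi5.add hi6) ?_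
    filter_upwards [ae_mono (hle K hK) hκ] with x hx
    have hpos : 0 ≤ (κ x)⁻¹ := inv_nonneg.2 (hκ₀.le.trans hx.1)
    simp only [hrdef, evF_sub]
    set a := evF (Pq K) x
    set c := evF (qh K) x
    have h1 : ‖a - c‖ ^ 2 = inner ℝ (a - q x) (a - c) + inner ℝ (q x) (a - c) -
        inner ℝ c (a - c) := by
      rw [← inner_add_left, ← inner_sub_left, ← real_inner_self_eq_norm_sq]
      congr 1; abel
    have h2 : inner ℝ (a - q x) (a - c) ≤ (1 / 2) * ‖a - c‖ ^ 2 + (1 / 2) * ‖a - q x‖ ^ 2 := by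
      have := real_inner_le_norm (a - q x) (a - c)
      nlinarith [sq_nonneg (‖a - q x‖ - ‖a - c‖)]
    nlinarith [mul_le_mul_of_nonneg_left h2 hpos]
  rw [Finset.sum_add_distrib, Finset.sum_sub_distrib, horth, sub_self, add_zero,
    Finset.sum_add_distrib, ← Finset.mul_sum, ← Finset.mul_sum] at key
  linarith

end Mesh
end RTM

end

/-! ### The Poincaré inequality for smooth functions on convex bodies -/

noncomputable section
namespace RTM
variable {d : ℕ}

open scoped ENNReal Topology
open Filter

/-- A change of variables with Jacobian factor `t ^ (-d)`, at most `2 ^ d`; convexity keeps the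
contracted points in `S`, and nonnegativity allows the domain to be enlarged. -/
theorem setIntegral_comp_homothety_le {S : Set (E d)} (hS : Convex ℝ S) (hSm : MeasurableSet S)
    {ψ : E d → ℝ} (hψ : IntegrableOn ψ S) (h0 : ∀ x, 0 ≤ ψ x) {y : E d} (hy : y ∈ S) {t : ℝ}
    (ht : 1 / 2 ≤ t) (ht1 : t ≤ 1) :
    ∫ x in S, ψ (y + t • (x - y)) ≤ 2 ^ d * ∫ x in S, ψ x := by
  have ht0 : 0 < t := by linarith
  set F := S.indicator ψ with hF
  have hFi : Integrable F := hψ.integrable_indicator hSm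
  have hF0 : ∀ x, 0 ≤ F x := fun x => indicator_nonneg (fun x _ => h0 x) x
  have h1 : ∫ x, F (y + t • (x - y)) = (t ^ d)⁻¹ * ∫ x in S, ψ x := by
    rw [integral_sub_right_eq_self (fun x => F (y + t • x)) y,
      Measure.integral_comp_smul volume (fun x => F (y + x)) t,
      integral_add_left_eq_self F y, hF, integral_indicator hSm, finrank_euclideanSpace,
      Fintype.card_fin, abs_of_nonneg (by positivity), smul_eq_mul]
  have hi : Integrable fun x => F (y + t • (x - y)) := by
    have h2 : Integrable fun x => F (y + x) := hFi.comp_add_left y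
    exact ((integrable_comp_smul_iff volume (fun x => F (y + x)) ht0.ne').2 h2).comp_sub_right y
  have h3 : ∫ x in S, ψ (y + t • (x - y)) ≤ ∫ x, F (y + t • (x - y)) := by
    rw [← integral_indicator hSm]
    refine integral_mono_of_nonneg (.of_forall fun x => indicator_nonneg (fun x _ => h0 _) x) hi
      (.of_forall fun x => ?_)
    by_cases hx : x ∈ S
    · have : y + t • (x - y) ∈ S := hS.add_smul_sub_mem hy hx ⟨ht0.le, ht1⟩
      simp only [indicator_of_mem hx, hF, indicator_of_mem this, le_refl]
    · simp only [indicator_of_notMem hx]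
      exact hF0 _
  have h4 : (t ^ d)⁻¹ ≤ 2 ^ d := by
    rw [← inv_pow]
    refine pow_le_pow_left₀ (by positivity) ?_ d
    rw [inv_le_comm₀ ht0 two_pos]; linarith
  have h5 : 0 ≤ ∫ x in S, ψ x := integral_nonneg h0
  calc _ ≤ _ := h3
    _ = _ := h1
    _ ≤ _ := mul_le_mul_of_nonneg_right h4 h5

theorem integrable_prod_of_continuous {X Y : Type*} [TopologicalSpace X] [TopologicalSpace Y]
    [MeasurableSpace X] [MeasurableSpace Y] [OpensMeasurableSpace (X × Y)] [T2Space (X × Y)]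
    [SecondCountableTopologyEither X Y]
    {μ : Measure X} {ν : Measure Y} [SFinite μ] [SFinite ν] [IsFiniteMeasureOnCompacts μ]
    [IsFiniteMeasureOnCompacts ν] {S : Set X} {S' : Set Y} (hS : IsCompact S) (hS' : IsCompact S')
    {f : X × Y → ℝ} (hf : Continuous f) : Integrable f ((μ.restrict S).prod (ν.restrict S')) := by
  rw [Measure.prod_restrict]
  have : IsFiniteMeasure ((μ.prod ν).restrict (S ×ˢ S')) := by
    constructor
    rw [Measure.restrict_apply_univ, Measure.prod_prod]
    exact ENNReal.mul_lt_top hS.measure_lt_top hS'.measure_lt_top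
  obtain ⟨C, hC⟩ := (hS.prod hS').exists_bound_of_continuousOn hf.continuousOn
  refine Integrable.of_bound hf.aestronglyMeasurable C ?_
  exact (ae_restrict_iff' (hS.prod hS').measurableSet).2 (.of_forall fun x hx => hC x hx)

/-- For `t` at least one half, the change of variables is made in `x`. For smaller `t` the end
points exchange roles, since contraction towards `y` would then have an unbounded Jacobian factor.
-/
theorem integral_comp_segment_le {S : Set (E d)} (hS : Convex ℝ S) (hSc : IsCompact S)
    {ψ : E d → ℝ} (hψ : Continuous ψ) (h0 : ∀ x, 0 ≤ ψ x) {t : ℝ} (ht : t ∈ Icc (0 : ℝ) 1) :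
    ∫ y in S, ∫ x in S, ψ (y + t • (x - y)) ≤
      2 ^ d * volume.real S * ∫ x in S, ψ x := by
  have hSm := hSc.measurableSet
  have hψi : IntegrableOn ψ S := hψ.continuousOn.integrableOn_compact hSc
  have hint : ∀ f : E d × E d → ℝ, Continuous f → Integrable f
      ((volume.restrict S).prod (volume.restrict S)) := fun f hf =>
    integrable_prod_of_continuous hSc hSc hf
  have hc : IntegrableOn (fun _ : E d => 2 ^ d * ∫ x in S, ψ x) S :=
    integrableOn_const hSc.measure_lt_top.ne
  have key : ∀ s : ℝ, 1 / 2 ≤ s → s ≤ 1 → ∫ y in S, ∫ x in S, ψ (y + s • (x - y)) ≤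
      2 ^ d * volume.real S * ∫ x in S, ψ x := by
    intro s hs hs1
    have := setIntegral_mono_on (f := fun y => ∫ x in S, ψ (y + s • (x - y)))
      (hint (fun p => ψ (p.1 + s • (p.2 - p.1))) (by fun_prop)).integral_prod_left hc hSm
      fun y hy => setIntegral_comp_homothety_le hS hSm hψi h0 hy hs hs1
    refine this.trans_eq ?_
    rw [setIntegral_const, smul_eq_mul]; ring
  rcases le_total (1 / 2) t with h | h
  · exact key t h ht.2
  · rw [integral_integral_swap (f := fun y x => ψ (y + t • (x - y)))
      (hint (fun p => ψ (p.1 + t • (p.2 - p.1))) (by fun_prop))]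
    have := key (1 - t) (by linarith) (by linarith [ht.1])
    have e : ∀ x y : E d, y + t • (x - y) = x + (1 - t) • (y - x) := fun x y => by module
    simpa only [e] using this

theorem sq_sub_le_integral_segment {φ : E d → ℝ} (hφ : ContDiff ℝ 1 φ) (x y : E d) :
    (φ x - φ y) ^ 2 ≤ ‖x - y‖ ^ 2 * ∫ t in Icc (0 : ℝ) 1, ∑ i, pd i φ (y + t • (x - y)) ^ 2 := by
  have hpd : ∀ i, Continuous (pd i φ) := fun i => continuous_pd (n := 1) hφ (by simp)
  have hline : Continuous fun t : ℝ => y + t • (x - y) := by fun_prop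
  have hd : ∀ t : ℝ, HasDerivAt (fun t : ℝ => φ (y + t • (x - y)))
      (∑ i, (x - y) i * pd i φ (y + t • (x - y))) t := by
    intro t
    rw [← fderiv_eq_sum_pd]
    have h1 : HasDerivAt (fun t : ℝ => y + t • (x - y)) (x - y) t := by
      simpa using ((hasDerivAt_id t).smul_const (x - y)).const_add y
    exact ((hφ.differentiable (by simp)) _).hasFDerivAt.comp_hasDerivAt t h1
  have hc : Continuous fun t : ℝ => ∑ i, (x - y) i * pd i φ (y + t • (x - y)) :=
    continuous_finsetSum _ fun i _ => continuous_const.mul ((hpd i).comp hline)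
  have h2 : φ x - φ y = ∫ t in Icc (0 : ℝ) 1, ∑ i, (x - y) i * pd i φ (y + t • (x - y)) := by
    have := intervalIntegral.integral_eq_sub_of_hasDerivAt (fun t _ => hd t)
      (hc.intervalIntegrable 0 1)
    rw [integral_Icc_eq_integral_Ioc, ← intervalIntegral.integral_of_le zero_le_one, this]
    simp
  have : IsFiniteMeasure ((volume : Measure ℝ).restrict (Icc 0 1)) :=
    ⟨by rw [Measure.restrict_apply_univ]; exact isCompact_Icc.measure_lt_top⟩
  have hm : ∀ f : ℝ → ℝ, Continuous f → MemLp f 2 (volume.restrict (Icc 0 1)) := by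
    intro f hf
    obtain ⟨C, hC⟩ := (isCompact_Icc (a := (0 : ℝ)) (b := 1)).exists_bound_of_continuousOn
      hf.continuousOn
    exact MemLp.of_bound hf.aestronglyMeasurable C
      ((ae_restrict_iff' measurableSet_Icc).2 (.of_forall fun x hx => hC x hx))
  have h3 := sq_integral_mul_le (hm _ hc) (hm _ (continuous_const (y := (1 : ℝ))))
  simp only [mul_one, one_pow, setIntegral_const, Real.volume_real_Icc, sub_zero, smul_eq_mul,
    zero_le_one, max_eq_left] at h3
  rw [h2]
  refine h3.trans ?_
  rw [← integral_const_mul]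
  refine integral_mono (integrable_sq (hm _ hc)) ?_ fun t => ?_
  · refine (Continuous.integrableOn_Icc ?_)
    exact continuous_const.mul (continuous_finsetSum _ fun i _ => ((hpd i).comp hline).pow 2)
  · have := Finset.sum_mul_sq_le_sq_mul_sq Finset.univ (fun i => (x - y) i)
      (fun i => pd i φ (y + t • (x - y)))
    rw [EuclideanSpace.real_norm_sq_eq]
    exact this

/-- The Poincaré inequality for smooth functions on a convex set. -/
theorem poincare_smooth {S : Set (E d)} (hS : Convex ℝ S) (hSc : IsCompact S) {φ : E d → ℝ}
    (hφ : ContDiff ℝ 1 φ) :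
    volume.real S * (∫ x in S, φ x ^ 2) - (∫ x in S, φ x) ^ 2 ≤
      2 ^ d * Metric.diam S ^ 2 * volume.real S * ∑ i, ∫ x in S, pd i φ x ^ 2 := by
  have hpd : ∀ i, Continuous (pd i φ) := fun i => continuous_pd (n := 1) hφ (by simp)
  have hφc : Continuous φ := hφ.continuous
  have hfin : IsFiniteMeasure ((volume : Measure (E d)).restrict S) :=
    ⟨by rw [Measure.restrict_apply_univ]; exact hSc.measure_lt_top⟩
  have hint : ∀ f : E d × E d → ℝ, Continuous f → Integrable f
      ((volume.restrict S).prod (volume.restrict S)) := fun f hf =>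
    integrable_prod_of_continuous hSc hSc hf
  have hi1 : ∀ f : E d → ℝ, Continuous f → IntegrableOn f S := fun f hf =>
    hf.continuousOn.integrableOn_compact hSc
  set ψ : E d → ℝ := fun x => ∑ i, pd i φ x ^ 2 with hψ
  have hψc : Continuous ψ := continuous_finsetSum _ fun i _ => (hpd i).pow 2
  have hψ0 : ∀ x, 0 ≤ ψ x := fun x => Finset.sum_nonneg fun i _ => sq_nonneg _
  have hψs : ∫ x in S, ψ x = ∑ i, ∫ x in S, pd i φ x ^ 2 :=
    integral_finsetSum _ fun i _ => hi1 _ ((hpd i).pow 2)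
  -- The double integral of squared differences is twice the variance times the squared volume;
  -- differences along segments then bring in the gradient.
  have hexp : ∫ y in S, ∫ x in S, (φ x - φ y) ^ 2 =
      2 * (volume.real S * (∫ x in S, φ x ^ 2) - (∫ x in S, φ x) ^ 2) := by
    have h1 : ∀ y, ∫ x in S, (φ x - φ y) ^ 2 = (∫ x in S, φ x ^ 2) -
        (2 * ∫ x in S, φ x) * φ y + volume.real S * φ y ^ 2 := by
      intro y
      have e : ∀ x, (φ x - φ y) ^ 2 = φ x ^ 2 - 2 * φ y * φ x + φ y ^ 2 := fun x => by ring
      simp only [e]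
      have ha : Integrable (fun x => φ x ^ 2 - 2 * φ y * φ x) (volume.restrict S) :=
        hi1 _ (by fun_prop)
      rw [integral_add ha (integrable_const _),
        integral_sub (hi1 _ (by fun_prop)) (hi1 _ (by fun_prop)), integral_const_mul,
        integral_const, smul_eq_mul, measureReal_restrict_apply_univ]
      ring
    simp only [h1]
    have ha : Integrable (fun y => (∫ x in S, φ x ^ 2) - (2 * ∫ x in S, φ x) * φ y)
      (volume.restrict S) := hi1 _ (by fun_prop)
    rw [integral_add ha (hi1 _ (by fun_prop)), integral_sub (integrable_const _)
      (hi1 _ (by fun_prop)), integral_const_mul, integral_const_mul, integral_const, smul_eq_mul,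
      measureReal_restrict_apply_univ]
    ring
  have hdiam : ∀ x ∈ S, ∀ y ∈ S, ‖x - y‖ ^ 2 ≤ Metric.diam S ^ 2 := fun x hx y hy => by
    rw [← dist_eq_norm]
    exact pow_le_pow_left₀ dist_nonneg (Metric.dist_le_diam_of_mem hSc.isBounded hx hy) 2
  have hJ0 : ∀ x y, 0 ≤ ∫ t in Icc (0 : ℝ) 1, ψ (y + t • (x - y)) := fun x y =>
    integral_nonneg fun t => hψ0 _
  -- the integral along the segments, as a function of both end points
  have hseg : Integrable (fun p : (E d × E d) × ℝ => ψ (p.1.1 + p.2 • (p.1.2 - p.1.1)))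
      (((volume.restrict S).prod (volume.restrict S)).prod (volume.restrict (Icc 0 1))) := by
    rw [Measure.prod_restrict]
    exact integrable_prod_of_continuous (hSc.prod hSc) isCompact_Icc (by fun_prop)
  have h2 : ∫ y in S, ∫ x in S, (φ x - φ y) ^ 2 ≤
      ∫ p : E d × E d, Metric.diam S ^ 2 * (∫ t in Icc (0 : ℝ) 1, ψ (p.1 + t • (p.2 - p.1)))
        ∂((volume.restrict S).prod (volume.restrict S)) := by
    rw [← integral_prod (fun p : E d × E d => (φ p.2 - φ p.1) ^ 2) (hint _ (by fun_prop))]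
    refine integral_mono_ae (hint _ (by fun_prop)) (hseg.integral_prod_left.const_mul _) ?_
    rw [Measure.prod_restrict]
    refine (ae_restrict_iff' (hSc.prod hSc).measurableSet).2 (.of_forall fun p hp => ?_)
    exact (sq_sub_le_integral_segment hφ p.2 p.1).trans
      (mul_le_mul_of_nonneg_right (hdiam _ hp.2 _ hp.1) (hJ0 _ _))
  have h3 : ∫ p : E d × E d, (∫ t in Icc (0 : ℝ) 1, ψ (p.1 + t • (p.2 - p.1)))
        ∂((volume.restrict S).prod (volume.restrict S)) ≤
      2 ^ d * volume.real S * ∫ x in S, ψ x := by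
    rw [integral_integral_swap hseg]
    have h4 : ∀ t ∈ Icc (0 : ℝ) 1, ∫ p : E d × E d, ψ (p.1 + t • (p.2 - p.1))
        ∂((volume.restrict S).prod (volume.restrict S)) ≤
          2 ^ d * volume.real S * ∫ x in S, ψ x := by
      intro t ht
      rw [integral_prod _ (hint (fun p => ψ (p.1 + t • (p.2 - p.1))) (by fun_prop))]
      exact integral_comp_segment_le hS hSc hψc hψ0 ht
    refine (setIntegral_mono_on hseg.integral_prod_right
      (integrableOn_const isCompact_Icc.measure_lt_top.ne) measurableSet_Icc h4).trans_eq ?_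
    simp
  rw [integral_const_mul] at h2
  have h5 := mul_le_mul_of_nonneg_left h3 (sq_nonneg (Metric.diam S))
  -- The factor two of the double integral is given away, which needs a nonnegative right-hand side.
  have hA : 0 ≤ Metric.diam S ^ 2 * (2 ^ d * volume.real S * ∫ x in S, ψ x) :=
    mul_nonneg (sq_nonneg _) (mul_nonneg (by positivity) (integral_nonneg hψ0))
  rw [← hψs]
  rw [hexp] at h2
  linarith

end RTM

end

/-! ### Polynomial approximation in Sobolev spaces on a simplex -/

noncomputable section
namespace RTM
variable {d : ℕ}

open scoped ENNReal Topology
open Filter MvPolynomial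

/-- The Poincaré inequality on a simplex. -/
theorem poincare (b : AffineBasis (Fin (d + 1)) ℝ (E d)) {w : E d → ℝ} {G : Fin d → E d → ℝ}
    (hw : MemLp w 2 (volume.restrict (cell (vset b))))
    (hG : ∀ i, MemLp (G i) 2 (volume.restrict (cell (vset b))))
    (h : ∀ i, IsWeakPartial (interior (cell (vset b))) i w (G i))
    (h0 : ∫ x in cell (vset b), w x = 0) :
    ∫ x in cell (vset b), w x ^ 2 ≤
      2 ^ d * Metric.diam (cell (vset b)) ^ 2 * ∑ i, ∫ x in cell (vset b), G i x ^ 2 := by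
  set S := cell (vset b) with hS
  have hSc : IsCompact S := isCompact_cell _
  obtain ⟨φ, hφ, hφw, hφG⟩ := exists_smooth_seq (convex_cell _) hSc
    (interior_cell_nonempty b) hw hG h
  have hc : ∀ f : E d → ℝ, Continuous f → MemLp f 2 (volume.restrict S) := fun f hf =>
    memLp_cell_of_continuous _ hf 2
  have hm : ∀ n, MemLp (φ n) 2 (volume.restrict S) := fun n => hc _ (hφ n).continuous
  have hpd : ∀ i n, MemLp (pd i (φ n)) 2 (volume.restrict S) := fun i n =>
    hc _ (continuous_pd (hφ n) (by simp))
  have l0 := tendsto_integral_sq hm hw hφw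
  have l1 := tendsto_integral_sq_right hm hw l0
  have l2 := tendsto_integral_mul hm hw (hc (fun _ => 1) continuous_const) l0
  simp only [mul_one] at l2
  have l3 : ∀ i, Tendsto (fun n => ∫ x in S, pd i (φ n) x ^ 2) atTop
      (𝓝 (∫ x in S, G i x ^ 2)) := fun i =>
    tendsto_integral_sq_right (hpd i) (hG i) (tendsto_integral_sq (hpd i) (hG i) (hφG i))
  -- The smooth inequality, mean term included, passes to the limit along smooth approximations of
  -- `w`; the vanishing mean is inserted afterwards.
  have key := le_of_tendsto_of_tendsto' ((l1.const_mul (volume.real S)).sub (l2.pow 2))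
    ((tendsto_finsetSum Finset.univ fun i _ => l3 i).const_mul
      (2 ^ d * Metric.diam S ^ 2 * volume.real S))
    fun n => poincare_smooth (convex_cell _) hSc ((hφ n).of_le (by simp))
  have hpos : 0 < volume.real S :=
    ENNReal.toReal_pos ((isOpen_interior.measure_pos volume (interior_cell_nonempty b)).trans_le
      (measure_mono interior_subset)).ne' hSc.measure_lt_top.ne
  rw [h0] at key
  refine le_of_mul_le_mul_left ?_ hpos
  linarith

theorem sum_add_single (α : Fin d → ℕ) (i : Fin d) :
    ∑ j, (α + Pi.single i 1 : Fin d → ℕ) j = (∑ j, α j) + 1 := by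
  simp [Finset.sum_add_distrib]

/-- All derivatives of lower order are controlled by those of the highest order when the means of
the former vanish. -/
theorem sobolev_bound (b : AffineBasis (Fin (d + 1)) ℝ (E d)) {m : ℕ}
    {D : (Fin d → ℕ) → E d → ℝ}
    (hD : ∀ α, ∑ i, α i ≤ m → MemLp (D α) 2 (volume.restrict (cell (vset b))))
    (hs : ∀ α i, ∑ j, α j < m →
      IsWeakPartial (interior (cell (vset b))) i (D α) (D (α + Pi.single i 1)))
    (h0 : ∀ α, ∑ i, α i < m → ∫ x in cell (vset b), D α x = 0) (j : ℕ) :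
    ∀ α, ∑ i, α i + j = m → ∫ x in cell (vset b), D α x ^ 2 ≤
      (2 ^ d * d * Metric.diam (cell (vset b)) ^ 2) ^ j *
        ∑ β ∈ Finset.piAntidiag Finset.univ m, ∫ x in cell (vset b), D β x ^ 2 := by
  induction j with
  | zero =>
    intro α hα
    rw [pow_zero, one_mul]
    exact Finset.single_le_sum
      (f := fun β => ∫ x in cell (vset b), D β x ^ 2)
      (fun β _ => integral_nonneg fun x => sq_nonneg _)
      (Finset.mem_piAntidiag.2 ⟨by simpa using hα, by simp⟩)
  | succ j ih =>
    intro α hα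
    -- One more order of derivatives costs the Poincaré constant and, through the sum over the `d`
    -- directions, a factor `d`.
    have h1 := poincare b (hD α (by omega))
      (fun i => hD (α + Pi.single i 1) (by rw [sum_add_single]; omega))
      (fun i => hs α i (by omega)) (h0 α (by omega))
    have h2 : ∑ i, ∫ x in cell (vset b), D (α + Pi.single i 1) x ^ 2 ≤
        d * ((2 ^ d * d * Metric.diam (cell (vset b)) ^ 2) ^ j *
        ∑ β ∈ Finset.piAntidiag Finset.univ m, ∫ x in cell (vset b), D β x ^ 2) := by
      refine (Finset.sum_le_card_nsmul _ _ _ fun i _ =>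
        ih (α + Pi.single i 1) (by rw [sum_add_single]; omega)).trans_eq ?_
      simp
    refine h1.trans ((mul_le_mul_of_nonneg_left h2 (by positivity)).trans_eq ?_)
    rw [pow_succ]; ring

/-- The derivative of a polynomial with multi-index `α`. -/
def mderiv (α : Fin d → ℕ) : MvPolynomial (Fin d) ℝ →ₗ[ℝ] MvPolynomial (Fin d) ℝ :=
  (basisMonomials (Fin d) ℝ).constr ℝ fun s =>
    -- Truncated subtraction of exponents is harmless: if `α i` exceeds `s i`, the descending
    -- factorial is zero.
    monomial (s - Finsupp.equivFunOnFinite.symm α) (∏ i, ((s i).descFactorial (α i) : ℝ))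

theorem mderiv_monomial (α : Fin d → ℕ) (s : Fin d →₀ ℕ) (a : ℝ) :
    mderiv α (monomial s a) = monomial (s - Finsupp.equivFunOnFinite.symm α)
      (a * ∏ i, ((s i).descFactorial (α i) : ℝ)) := by
  have h1 : mderiv α (monomial s 1) = monomial (s - Finsupp.equivFunOnFinite.symm α)
      (∏ i, ((s i).descFactorial (α i) : ℝ)) := by
    have := (basisMonomials (Fin d) ℝ).constr_basis ℝ (fun s =>
      monomial (s - Finsupp.equivFunOnFinite.symm α)
        (∏ i, ((s i).descFactorial (α i) : ℝ))) s
    rwa [coe_basisMonomials] at this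
  rw [show monomial s a = a • monomial s (1 : ℝ) by rw [smul_monomial, smul_eq_mul, mul_one],
    map_smul, h1, smul_monomial, smul_eq_mul]

theorem mderiv_zero (p : MvPolynomial (Fin d) ℝ) : mderiv 0 p = p := by
  induction p using MvPolynomial.induction_on' with
  | monomial s a =>
    rw [mderiv_monomial]
    have : (Finsupp.equivFunOnFinite.symm (0 : Fin d → ℕ)) = 0 := by ext; simp
    simp [this]
  | add p q hp hq => rw [map_add, hp, hq]

theorem pderiv_mderiv (α : Fin d → ℕ) (i : Fin d) (p : MvPolynomial (Fin d) ℝ) :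
    pderiv i (mderiv α p) = mderiv (α + Pi.single i 1) p := by
  induction p using MvPolynomial.induction_on' with
  | monomial s a =>
    rw [mderiv_monomial, mderiv_monomial, pderiv_monomial]
    have h1 : s - Finsupp.equivFunOnFinite.symm α - Finsupp.single i 1 =
        s - Finsupp.equivFunOnFinite.symm (α + Pi.single i 1) := by
      ext j
      simp only [Finsupp.tsub_apply, Finsupp.equivFunOnFinite_symm_apply_apply, Pi.add_apply,
        Finsupp.single_apply, Pi.single_apply, eq_comm (a := i)]
      omega
    rw [h1]
    congr 1
    rw [mul_assoc]
    congr 1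
    rw [← Finset.mul_prod_erase _ _ (Finset.mem_univ i),
      ← Finset.mul_prod_erase _ _ (Finset.mem_univ i)]
    have h2 : ∏ j ∈ Finset.univ.erase i, 
        ((s j).descFactorial ((α + Pi.single i 1 : Fin d → ℕ) j) : ℝ) =
        ∏ j ∈ Finset.univ.erase i, ((s j).descFactorial (α j) : ℝ) :=
      Finset.prod_congr rfl fun j hj => by
        rw [Pi.add_apply, Pi.single_eq_of_ne (Finset.ne_of_mem_erase hj), add_zero]
    rw [h2, Pi.add_apply, Pi.single_eq_same, Nat.descFactorial_succ]
    simp only [Finsupp.tsub_apply, Finsupp.equivFunOnFinite_symm_apply_apply, Nat.cast_mul]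
    ring
  | add p q hp hq => rw [map_add, map_add, hp, hq, map_add]

theorem mderiv_eq_zero {n : ℕ} {α : Fin d → ℕ} (hα : n ≤ ∑ i, α i)
    {p : MvPolynomial (Fin d) ℝ} (hp : p ∈ polyLT d n) : mderiv α p = 0 := by
  rw [p.as_sum, map_sum]
  refine Finset.sum_eq_zero fun s hs => ?_
  have h1 := mem_polyLT.1 hp s hs
  obtain ⟨i, hi⟩ : ∃ i, s i < α i := by
    by_contra! h
    have := Finset.sum_le_sum (s := Finset.univ) fun i _ => h i
    rw [Finsupp.degree_eq_sum] at h1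
    omega
  rw [mderiv_monomial, Finset.prod_eq_zero (Finset.mem_univ i)
    (by rw [Nat.descFactorial_of_lt hi, Nat.cast_zero]), mul_zero, monomial_zero]

instance finite_degree_lt (n : ℕ) : Finite {s : Fin d →₀ ℕ | s.degree < n} :=
  Finsupp.finite_of_degree_lt n

instance (n : ℕ) : FiniteDimensional ℝ (polyLT d n) :=
  Module.Finite.of_basis (basisRestrictSupport ℝ {s : Fin d →₀ ℕ | s.degree < n})

theorem isWeakPartial_ev (hd : 0 < d) (b : AffineBasis (Fin (d + 1)) ℝ (E d)) (i : Fin d)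
    (p : MvPolynomial (Fin d) ℝ) :
    IsWeakPartial (interior (cell (vset b))) i (ev p) (ev (pderiv i p)) := by
  have := (hasTrace_smooth hd b (contDiff_ev p)).isWeakPartial i
  rwa [pd_ev] at this

theorem integrable_ev (s : Finset (E d)) (p : MvPolynomial (Fin d) ℝ) :
    Integrable (ev p) (volume.restrict (cell s)) :=
  (continuous_ev p).continuousOn.integrableOn_compact (isCompact_cell s)

/-- By `sobolev_bound` with `m = n`, the polynomial is controlled by its derivatives of order `n`,
all of which vanish. -/
theorem eq_zero_of_means_eq_zero (hd : 0 < d) (b : AffineBasis (Fin (d + 1)) ℝ (E d)) {n : ℕ}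
    {p : MvPolynomial (Fin d) ℝ} (hp : p ∈ polyLT d n)
    (h : ∀ α : Fin d → ℕ, ∑ i, α i < n → ∫ x in cell (vset b), ev (mderiv α p) x = 0) : p = 0 := by
  have h1 := sobolev_bound b (m := n) (D := fun α => ev (mderiv α p))
    (fun α _ => memLp_cell_of_continuous _ (continuous_ev _) 2)
    (fun α i _ => by rw [← pderiv_mderiv]; exact isWeakPartial_ev hd b i _) h n 0 (by simp)
  refine eq_zero_of_integral_sq_eq_zero b (le_antisymm ?_ (integral_nonneg fun x => sq_nonneg _))
  simp only [mderiv_zero] at h1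
  refine h1.trans_eq ?_
  rw [Finset.sum_eq_zero, mul_zero]
  intro β hβ
  have : mderiv β p = 0 := mderiv_eq_zero (by simpa using (Finset.mem_piAntidiag.1 hβ).1.ge) hp
  simp [this]

/-- A polynomial of degree less than `n` whose derivatives of order less than `n` have prescribed
means. -/
theorem exists_poly_means (hd : 0 < d) (b : AffineBasis (Fin (d + 1)) ℝ (E d)) (n : ℕ)
    (c : (Fin d → ℕ) → ℝ) : ∃ p ∈ polyLT d n, ∀ α : Fin d → ℕ, ∑ i, α i < n →
      ∫ x in cell (vset b), ev (mderiv α p) x = c α := by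
  set A := {s : Fin d →₀ ℕ | s.degree < n}
  have : Fintype A := Fintype.ofFinite _
  let M : polyLT d n →ₗ[ℝ] (A → ℝ) :=
    { toFun := fun p s => ∫ x in cell (vset b), ev (mderiv (s : Fin d →₀ ℕ) p.1) x
      map_add' := fun p q => by
        funext s
        simp only [Submodule.coe_add, map_add, ev_add, Pi.add_apply]
        exact integral_add (integrable_ev _ _) (integrable_ev _ _)
      map_smul' := fun a p => by
        funext s
        simp only [Submodule.coe_smul, map_smul, ev_smul, Pi.smul_apply, RingHom.id_apply,
          smul_eq_mul]
        exact integral_const_mul _ _ }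
  -- There are as many means as monomials, so injectivity of the square system gives solvability.
  have hfr : Module.finrank ℝ (polyLT d n) = Module.finrank ℝ (A → ℝ) := by
    rw [Module.finrank_fintype_fun_eq_card]
    exact Module.finrank_eq_card_basis (basisRestrictSupport ℝ A)
  have hdeg : ∀ α : Fin d → ℕ, ∑ i, α i < n → Finsupp.equivFunOnFinite.symm α ∈ A := by
    intro α hα
    change Finsupp.degree _ < n
    simpa [Finsupp.degree_eq_sum] using hα
  have hinj : Function.Injective M := by
    rw [← LinearMap.ker_eq_bot, LinearMap.ker_eq_bot']
    intro p hp
    refine Subtype.ext (eq_zero_of_means_eq_zero hd b p.2 fun α hα => ?_)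
    exact congrFun hp ⟨_, hdeg α hα⟩
  obtain ⟨p, hp⟩ := (LinearMap.injective_iff_surjective_of_finrank_eq_finrank hfr).1 hinj
    fun s => c (s : Fin d →₀ ℕ)
  exact ⟨p, p.2, fun α hα => congrFun hp ⟨_, hdeg α hα⟩⟩

theorem IsWeakPartial.sub {U : Set (E d)} {i : Fin d} {w g w' g' : E d → ℝ}
    (h : IsWeakPartial U i w g) (h' : IsWeakPartial U i w' g')
    (hw : MemLp w 2 (volume.restrict U)) (hw' : MemLp w' 2 (volume.restrict U))
    (hg : MemLp g 2 (volume.restrict U)) (hg' : MemLp g' 2 (volume.restrict U)) :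
    IsWeakPartial U i (fun x => w x - w' x) (fun x => g x - g' x) := by
  intro φ hφ
  have hφ2 : MemLp φ 2 (volume.restrict U) :=
    (hφ.1.continuous.memLp_of_hasCompactSupport hφ.2.1).restrict U
  have hpd : MemLp (pd i φ) 2 (volume.restrict U) :=
    ((continuous_pd hφ.1 (by simp)).memLp_of_hasCompactSupport
      (hφ.2.1.mono' ((subset_tsupport _).trans (tsupport_pd_subset i φ)))).restrict U
  simp only [sub_mul]
  rw [integral_sub (integrable_mul hw hpd) (integrable_mul hw' hpd),
    integral_sub (integrable_mul hg hφ2) (integrable_mul hg' hφ2), h φ hφ, h' φ hφ]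
  ring

/-- The approximation of a function in `H^{k+1}` by polynomials of degree `k` on a simplex. -/
theorem exists_poly_approx (hd : 0 < d) (b : AffineBasis (Fin (d + 1)) ℝ (E d)) {k : ℕ}
    {D : (Fin d → ℕ) → E d → ℝ}
    (hD : ∀ α, ∑ i, α i ≤ k + 1 → MemLp (D α) 2 (volume.restrict (cell (vset b))))
    (hs : ∀ α i, ∑ j, α j < k + 1 →
      IsWeakPartial (interior (cell (vset b))) i (D α) (D (α + Pi.single i 1))) :
    ∃ p ∈ polyLT d (k + 1),
      ∫ x in cell (vset b), (D 0 x - ev p x) ^ 2 ≤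
        (2 ^ d * d * Metric.diam (cell (vset b)) ^ 2) ^ (k + 1) *
        ∑ β ∈ Finset.piAntidiag Finset.univ (k + 1), ∫ x in cell (vset b), D β x ^ 2 ∧
      ∀ i, ∫ x in cell (vset b), (D (Pi.single i 1) x - ev (pderiv i p) x) ^ 2 ≤
        (2 ^ d * d * Metric.diam (cell (vset b)) ^ 2) ^ k *
        ∑ β ∈ Finset.piAntidiag Finset.univ (k + 1), ∫ x in cell (vset b), D β x ^ 2 := by
  obtain ⟨p, hp, hpm⟩ := exists_poly_means hd b (k + 1) fun α => ∫ x in cell (vset b), D α x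
  have hm : ∀ p : MvPolynomial (Fin d) ℝ, MemLp (ev p) 2 (volume.restrict (cell (vset b))) :=
    fun p => memLp_cell_of_continuous _ (continuous_ev p) 2
  have hfin : IsFiniteMeasure ((volume : Measure (E d)).restrict (cell (vset b))) :=
    ⟨by rw [Measure.restrict_apply_univ]; exact (isCompact_cell _).measure_lt_top⟩
  -- All derivatives of `D 0 - p` of order at most `k` have mean zero by the choice of `p`.
  have hb := sobolev_bound b (m := k + 1) (D := fun α x => D α x - ev (mderiv α p) x)
    (fun α hα => (hD α hα).sub (hm _))
    (fun α i hα => by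
      rw [← pderiv_mderiv]
      have hr := restrict_interior_cell (vset b)
      exact (hs α i hα).sub (isWeakPartial_ev hd b i _) (hr ▸ hD α hα.le) (hr ▸ hm _)
        (hr ▸ hD _ (by rw [sum_add_single]; omega)) (hr ▸ hm _))
    (fun α hα => by
      rw [integral_sub ((hD α hα.le).integrable one_le_two) (integrable_ev _ _), hpm α hα,
        sub_self])
  -- Derivatives of order `k + 1` annihilate `p`, so subtracting it leaves the seminorm unchanged.
  have hsum : ∑ β ∈ Finset.piAntidiag (Finset.univ : Finset (Fin d)) (k + 1),
      ∫ x in cell (vset b), (D β x - ev (mderiv β p) x) ^ 2 =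
      ∑ β ∈ Finset.piAntidiag Finset.univ (k + 1), ∫ x in cell (vset b), D β x ^ 2 := by
    refine Finset.sum_congr rfl fun β hβ => ?_
    have : mderiv β p = 0 := mderiv_eq_zero (by simpa using (Finset.mem_piAntidiag.1 hβ).1.ge) hp
    simp [this]
  rw [hsum] at hb
  refine ⟨p, hp, ?_, fun i => ?_⟩
  · have := hb (k + 1) 0 (by simp)
    simpa only [mderiv_zero] using this
  · have := hb k (Pi.single i 1) (by simp; ring)
    have e : mderiv (Pi.single i 1) p = pderiv i p := by
      have := pderiv_mderiv 0 i p
      rw [mderiv_zero, zero_add] at this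
      exact this.symm
    simpa only [e] using this

end RTM

end

/-! ### The reference simplex and unisolvence -/

noncomputable section
namespace RTM
variable {d : ℕ}

open MvPolynomial

/-- Relatively open subsets of a face have positive surface measure. -/
theorem surf_ne_zero (hd : 0 < d) (b : AffineBasis (Fin (d + 1)) ℝ (E d)) (j : Fin (d + 1))
    {U : Set (E d)} (hU : IsOpen U) {y : E d} (hy : y ∈ cell (vface b j)) (hyU : y ∈ U) :
    surf (vface b j) U ≠ 0 := by
  intro h0
  obtain ⟨ε, hε, hb⟩ := Metric.isOpen_iff.1 hU y hyU
  set R := ‖grad b j‖ * Metric.diam (cell (vset b)) with hR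
  have hR0 : 0 ≤ R := by positivity
  -- A point of the ball of radius `δ` around `y` has `j`-th coordinate at most `‖grad b j‖ * δ`, so
  -- its projection from `b j` onto the face is displaced by at most `R * δ` and stays within `ε` of
  -- `y`. If the face part of `U` were null, this ball would meet the simplex in a null set.
  set δ := ε / (1 + R) with hδ
  have hδ0 : 0 < δ := by positivity
  have hδε : δ + R * δ = ε := by rw [hδ]; field_simp
  have hyj : b.coord j y = 0 := by rw [cell_vface] at hy; exact hy.2
  have hyK : y ∈ cell (vset b) := by
    rw [cell_vface] at hy; rw [cell_vset]; exact hy.1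
  have hvol := volume_cell_inter hd b j (A := Metric.ball y δ) Metric.isOpen_ball.measurableSet
  have hz : ∀ t ∈ Ioo (0 : ℝ) 1, surf (vface b j)
      (AffineMap.homothety (b j) t ⁻¹' Metric.ball y δ) = 0 := by
    intro t ht
    refine measure_mono_null ?_ (measure_union_null h0
      (ae_iff.1 (ae_mem_cell_surf (vface b j))))
    intro x hx
    by_cases hxe : x ∈ cell (vface b j)
    swap; · exact Or.inr hxe
    refine Or.inl (hb ?_)
    rw [mem_preimage, Metric.mem_ball, dist_eq_norm] at hx
    have hxe' := hxe
    rw [cell_vface] at hxe'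
    have h1 : b.coord j (AffineMap.homothety (b j) t x) = 1 - t := by
      rw [coord_homothety, hxe'.2]; simp
    have h2 : 1 - t ≤ ‖grad b j‖ * δ := by
      have := inner_grad_sub b j (AffineMap.homothety (b j) t x) y
      rw [h1, hyj, sub_zero] at this
      rw [← this]
      exact (real_inner_le_norm _ _).trans (mul_le_mul_of_nonneg_left hx.le (norm_nonneg _))
    have h3 : ‖x - AffineMap.homothety (b j) t x‖ ≤
        (1 - t) * Metric.diam (cell (vset b)) := by
      have e : x - AffineMap.homothety (b j) t x = (1 - t) • (x - b j) := by
        rw [AffineMap.homothety_apply, vsub_eq_sub, vadd_eq_add]; module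
      rw [e, norm_smul, Real.norm_of_nonneg (by linarith [ht.2]), ← dist_eq_norm]
      refine mul_le_mul_of_nonneg_left (Metric.dist_le_diam_of_mem (isCompact_cell _).isBounded
        ?_ (subset_convexHull ℝ _ ?_)) (by linarith [ht.2])
      · rw [cell_vset]; exact hxe'.1
      · simp [vset]
    rw [Metric.mem_ball, dist_eq_norm]
    calc ‖x - y‖ ≤ ‖x - AffineMap.homothety (b j) t x‖ +
          ‖AffineMap.homothety (b j) t x - y‖ := norm_sub_le_norm_sub_add_norm_sub _ _ _
      _ < R * δ + δ := by
        refine add_lt_add_of_le_of_lt (h3.trans ?_) hx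
        refine (mul_le_mul_of_nonneg_right h2 Metric.diam_nonneg).trans_eq ?_
        rw [hR]; ring
      _ = ε := by linarith
  rw [setLIntegral_congr_fun measurableSet_Ioo (fun t ht => by rw [hz t ht, mul_zero]),
    lintegral_zero, mul_zero] at hvol
  have hcl : y ∈ closure (interior (cell (vset b))) := by
    rw [(convex_cell _).closure_interior_eq_closure_of_nonempty_interior
      (interior_cell_nonempty b)]
    exact subset_closure hyK
  obtain ⟨x, hx1, hx2⟩ := mem_closure_iff.1 hcl _ Metric.isOpen_ball (Metric.mem_ball_self hδ0)
  exact (Metric.isOpen_ball.inter isOpen_interior).measure_ne_zero volume ⟨x, hx1, hx2⟩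
    (measure_mono_null (inter_subset_inter_right _ interior_subset) hvol)

theorem eq_zero_on_face (hd : 0 < d) (b : AffineBasis (Fin (d + 1)) ℝ (E d)) (j : Fin (d + 1))
    {f : E d → ℝ} (hf : Continuous f) (h : f =ᵐ[surf (vface b j)] 0) {y : E d}
    (hy : y ∈ cell (vface b j)) : f y = 0 := by
  by_contra hne
  exact surf_ne_zero hd b j (hf.isOpen_preimage _ isOpen_ne) hy hne (ae_iff.1 h)

/-! ### The reference simplex -/

theorem affineIndependent_ref : AffineIndependent ℝ
    (Fin.cons 0 fun i => EuclideanSpace.single i 1 : Fin (d + 1) → E d) := by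
  rw [affineIndependent_iff_linearIndependent_vsub ℝ _ (0 : Fin (d + 1)),
    ← linearIndependent_equiv (finSuccAboveEquiv (0 : Fin (d + 1)))]
  have h1 := (EuclideanSpace.basisFun (Fin d) ℝ).toBasis.linearIndependent
  have h2 : (fun i : Fin d => (EuclideanSpace.basisFun (Fin d) ℝ).toBasis i) =
      fun i => EuclideanSpace.single i 1 := by funext i; simp
  rw [show (⇑(EuclideanSpace.basisFun (Fin d) ℝ).toBasis) = _ from h2] at h1
  have h3 : ((fun i : {x : Fin (d + 1) // x ≠ 0} =>
      ((Fin.cons 0 fun i => EuclideanSpace.single i 1 : Fin (d + 1) → E d) i -ᵥ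
        (Fin.cons 0 fun i => EuclideanSpace.single i 1 : Fin (d + 1) → E d) 0)) ∘
      (finSuccAboveEquiv (0 : Fin (d + 1)))) = fun i => EuclideanSpace.single i 1 := by
    funext i
    change (Fin.cons 0 fun i => EuclideanSpace.single i 1 : Fin (d + 1) → E d)
      (Fin.succAbove 0 i) -ᵥ _ = _
    rw [Fin.zero_succAbove, Fin.cons_succ, Fin.cons_zero, vsub_eq_sub, sub_zero]
  rw [h3]
  exact h1

/-- The vertices of the standard simplex. -/
def refBasis (d : ℕ) : AffineBasis (Fin (d + 1)) ℝ (E d) where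
  toFun := Fin.cons 0 fun i => EuclideanSpace.single i 1
  ind' := affineIndependent_ref
  tot' := affineIndependent_ref.affineSpan_eq_top_iff_card_eq_finrank_add_one.2 (by simp)

theorem refBasis_zero : refBasis d 0 = 0 := rfl
theorem refBasis_succ (i : Fin d) : refBasis d i.succ = EuclideanSpace.single i 1 := rfl

theorem inner_single_right (v : E d) (i : Fin d) :
    inner ℝ v (EuclideanSpace.single i 1) = v i := by
  rw [EuclideanSpace.inner_single_right]; simp

theorem grad_refBasis_succ (i : Fin d) :
    grad (refBasis d) i.succ = EuclideanSpace.single i 1 := by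
  ext l
  have := inner_grad_vertex (refBasis d) i.succ l.succ 0
  rw [refBasis_zero, refBasis_succ, sub_zero, inner_single_right] at this
  rw [this]
  simp [eq_comm]

theorem coord_refBasis_succ (i : Fin d) (x : E d) : (refBasis d).coord i.succ x = x i := by
  have h := inner_grad_sub (refBasis d) i.succ x (refBasis d 0)
  rw [grad_refBasis_succ, refBasis_zero, sub_zero, real_inner_comm, inner_single_right] at h
  have h2 := (refBasis d).coord_apply_ne (Fin.succ_ne_zero i)
  rw [refBasis_zero] at h2
  rw [h, h2, sub_zero]

theorem coord_zero_eq (b : AffineBasis (Fin (d + 1)) ℝ (E d)) (x : E d) :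
    b.coord 0 x = 1 - ∑ i : Fin d, b.coord i.succ x := by
  have h := b.sum_coord_apply_eq_one x
  rw [Fin.sum_univ_succ] at h
  linarith

/-- The substitution sets the `i`-th variable to zero. A polynomial that vanishes on that coordinate
hyperplane is thus divisible by the variable. -/
theorem X_dvd_sub_aeval (i : Fin d) (p : MvPolynomial (Fin d) ℝ) :
    X i ∣ p - aeval (fun l => if l = i then 0 else (X l : MvPolynomial (Fin d) ℝ)) p := by
  induction p using MvPolynomial.induction_on with
  | C a => simp
  | add p q hp hq =>
    rw [map_add, add_sub_add_comm]; exact dvd_add hp hq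
  | mul_X p l hp =>
    rw [map_mul, aeval_X]
    split_ifs with h
    · rw [h]; simp
    · rw [← sub_mul]; exact hp.mul_right _

theorem mem_polyLT_of_X_mul {n : ℕ} {i : Fin d} {p : MvPolynomial (Fin d) ℝ}
    (h : X i * p ∈ polyLT d (n + 1)) : p ∈ polyLT d n := by
  rw [mem_polyLT] at h ⊢
  intro s hs
  have h1 := h (Finsupp.single i 1 + s) (by
    rw [mem_support_iff, coeff_X_mul]; exact mem_support_iff.1 hs)
  rw [map_add, Finsupp.degree_single] at h1
  omega

/-- A Raviart-Thomas field without divergence has components of degree `k`. -/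
theorem mem_polyLT_of_pdiv_eq_zero (hd : 0 < d) {k : ℕ} {z : PolyField d} (hz : z ∈ RTSpace d k)
    (h : pdiv z = 0) (i : Fin d) : z i ∈ polyLT d (k + 1) := by
  obtain ⟨a, p, ha, hp, hzi⟩ := exists_of_mem_RTSpace hz
  -- By Euler's identity the divergence of `x ↦ p(x) x` is `(d + k) p`; as the total is zero, `p`
  -- has degree below `k`.
  have h1 : pdiv z = (∑ i, pderiv i (a i)) + C ((d : ℝ) + k) * p := by
    simp only [pdiv, hzi, map_add, pderiv_mul, pderiv_X_self, one_mul, Finset.sum_add_distrib,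
      hp.sum_X_mul_pderiv]
    simp only [Finset.sum_const, Finset.card_univ, Fintype.card_fin, add_mul,
      nsmul_eq_mul, map_natCast]
  have h2 : C ((d : ℝ) + k) * p ∈ polyLT d k := by
    rw [h, eq_comm, add_eq_zero_iff_neg_eq] at h1
    rw [← h1]
    exact Submodule.neg_mem _ (Submodule.sum_mem _ fun i _ => pderiv_mem_polyLT i (ha i))
  have h3 : p ∈ polyLT d k := by
    have h4 := C_mul_mem_polyLT ((d : ℝ) + k)⁻¹ h2
    have h5 : (d : ℝ) + k ≠ 0 := by positivity
    rwa [← mul_assoc, ← C_mul, inv_mul_cancel₀ h5, C_1, one_mul] at h4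
  rw [hzi]
  exact Submodule.add_mem _ (ha i) (X_mul_mem_polyLT i h3)

/-- The component of a polynomial field along a barycentric gradient. -/
def gradComp (b : AffineBasis (Fin (d + 1)) ℝ (E d)) (j : Fin (d + 1)) :
    PolyField d →ₗ[ℝ] MvPolynomial (Fin d) ℝ :=
  ∑ l, (grad b j l) • LinearMap.proj l

/-- The divergence of the field `x ↦ p(x) (x - b j)`. -/
def coneDiv (b : AffineBasis (Fin (d + 1)) ℝ (E d)) (j : Fin (d + 1)) :
    MvPolynomial (Fin d) ℝ →ₗ[ℝ] MvPolynomial (Fin d) ℝ :=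
  (d : ℝ) • LinearMap.id +
    ∑ i, (LinearMap.mulRight ℝ (X i - C (b j i))).comp (pderiv i).toLinearMap

theorem ev_gradComp (b : AffineBasis (Fin (d + 1)) ℝ (E d)) (j : Fin (d + 1)) (z : PolyField d)
    (x : E d) : ev (gradComp b j z) x = inner ℝ (evF z x) (grad b j) := by
  simp only [gradComp, LinearMap.sum_apply, LinearMap.smul_apply, LinearMap.proj_apply, ev_sum,
    ev_smul, inner_evF]
  exact Finset.sum_congr rfl fun l _ => mul_comm _ _

theorem ev_coneDiv (b : AffineBasis (Fin (d + 1)) ℝ (E d)) (j : Fin (d + 1))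
    (p : MvPolynomial (Fin d) ℝ) (x : E d) :
    ev (coneDiv b j p) x = d * ev p x + fderiv ℝ (ev p) x (x - b j) := by
  simp only [coneDiv, LinearMap.add_apply, LinearMap.smul_apply, LinearMap.id_apply,
    LinearMap.sum_apply, LinearMap.comp_apply, LinearMap.mulRight_apply, ev_add, ev_smul, ev_sum,
    ev_mul, ev_sub, ev_X, ev_C, fderiv_eq_sum_pd, pd_ev, PiLp.sub_apply]
  congr 1
  exact Finset.sum_congr rfl fun l _ => mul_comm _ _

theorem integral_surf_ev (hd : 0 < d) (b : AffineBasis (Fin (d + 1)) ℝ (E d)) (j : Fin (d + 1))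
    (p : MvPolynomial (Fin d) ℝ) :
    ∫ x, ev p x ∂surf (vface b j) =
      ‖grad b j‖ * ∫ x in cell (vset b), ev (coneDiv b j p) x := by
  rw [integral_surf_eq hd b j ((contDiff_ev p).of_le (by simp))]
  simp only [ev_coneDiv]

/-- The degrees of freedom determine a Raviart-Thomas field on the reference simplex. -/
theorem unisolvence (hd : 0 < d) {k : ℕ} {z : PolyField d} (hz : z ∈ RTSpace d k)
    (hr : ∀ r : PolyField d, (∀ i, r i ∈ polyLT d k) →
      ∫ x in cell (vset (refBasis d)), ev (∑ i, z i * r i) x = 0)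
    (hm : ∀ j, ∀ m ∈ polyLT d (k + 1),
      ∫ x in cell (vset (refBasis d)), ev (coneDiv (refBasis d) j
        (gradComp (refBasis d) j z * m)) x = 0) : z = 0 := by
  set b := refBasis d with hb
  -- The face degrees of freedom are stated as volume integrals over the cone, a form that is
  -- compatible with affine maps.
  have hface : ∀ j, ∀ m ∈ polyLT d (k + 1),
      ∫ x, inner ℝ (evF z x) (grad b j) * ev m x ∂surf (vface b j) = 0 := by
    intro j m hmm
    have := integral_surf_ev hd b j (gradComp b j z * m)
    simp only [ev_mul, ev_gradComp] at this
    rw [this, hm j m hmm, mul_zero]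
  -- On the face the normal component is a polynomial of degree at most `k`, so it can be tested
  -- with itself.
  have hzero : ∀ j, ∀ x ∈ cell (vface b j), inner ℝ (evF z x) (grad b j) = 0 := by
    intro j
    obtain ⟨m, hmm, hmx⟩ := exists_normal_component hz (grad b j) (inner ℝ (grad b j) 0 -
      b.coord j 0)
    have hc : ∀ x ∈ cell (vface b j), ev m x = inner ℝ (evF z x) (grad b j) := by
      intro x hx
      refine hmx x ?_
      rw [cell_vface] at hx
      have := inner_grad_sub b j x 0
      rw [hx.2, inner_sub_right] at this
      linarith
    have h1 := hface j m hmm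
    have h2 : ∫ x, ev m x ^ 2 ∂surf (vface b j) = 0 := by
      rw [← h1]
      refine integral_congr_ae ?_
      filter_upwards [ae_mem_cell_surf (vface b j)] with x hx
      rw [← hc x hx, sq]
    have h3 := sq_integral_eq_zero (memLp_surf_of_continuous hd b j (continuous_ev m) 2) h2
    intro x hx
    rw [← hc x hx]
    exact eq_zero_on_face hd b j (continuous_ev m) h3 hx
  -- Integration by parts of the squared divergence: the gradient of the divergence is an admissible
  -- interior test field, and the normal components are zero.
  have hdiv : pdiv z = 0 := by
    refine eq_zero_of_integral_sq_eq_zero b ?_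
    have h1 := green_evF hd b z (contDiff_ev (pdiv z))
    have h2 := hr (fun i => pderiv i (pdiv z)) fun i => pderiv_mem_polyLT i (pdiv_mem_polyLT hz)
    simp only [ev_sum, ev_mul] at h2
    simp only [pd_ev] at h1
    rw [h2, zero_add, sum_faces] at h1
    simp only [sq]
    rw [h1]
    refine Finset.sum_eq_zero fun j _ => integral_eq_zero_of_ae ?_
    filter_upwards [ae_mem_cell_surf (vface b j)] with x hx
    rw [normal_vface hd, inner_neg_right, inner_smul_right, hzero j x hx]
    simp
  -- The face opposite to vertex `i.succ` lies in the hyperplane `x i = 0`, where the `i`-th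
  -- component is the normal one. Projecting an interior point to this hyperplane lands on the face,
  -- so `z i` vanishes after setting the variable to zero.
  have hdvd : ∀ i, X i ∣ z i := by
    intro i
    have h1 : aeval (fun l => if l = i then 0 else (X l : MvPolynomial (Fin d) ℝ)) (z i) = 0 := by
      refine eq_zero_of_ev_eq_zero isOpen_interior (interior_cell_nonempty b) fun x hx => ?_
      rw [interior_cell_vset] at hx
      rw [ev_aeval]
      set y : E d := WithLp.toLp 2 fun l => ev (if l = i then 0 else X l) x with hy
      have hyl : ∀ l, y l = if l = i then 0 else x l := fun l => by
        simp only [hy]; split_ifs <;> simp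
      have hxs : ∀ l, 0 < x l := fun l => by
        have := hx l.succ; rwa [hb, coord_refBasis_succ] at this
      have h2 := hzero i.succ y (by
        rw [cell_vface]
        refine ⟨fun l => ?_, by rw [hb, coord_refBasis_succ, hyl, if_pos rfl]⟩
        refine Fin.cases ?_ (fun l => ?_) l
        · have h0 := hx 0
          rw [hb, coord_zero_eq] at h0 ⊢
          have : ∑ l : Fin d, (refBasis d).coord l.succ y ≤
              ∑ l : Fin d, (refBasis d).coord l.succ x :=
            Finset.sum_le_sum fun l _ => by
              rw [coord_refBasis_succ, coord_refBasis_succ, hyl]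
              split_ifs
              exacts [(hxs l).le, le_rfl]
          linarith
        · rw [hb, coord_refBasis_succ, hyl]
          split_ifs
          exacts [le_rfl, (hxs l).le])
      rwa [hb, grad_refBasis_succ, inner_single_right, evF_apply] at h2
    have := X_dvd_sub_aeval i (z i)
    rwa [h1, sub_zero] at this
  choose s hs using hdvd
  have hsm : ∀ i, s i ∈ polyLT d k := fun i =>
    mem_polyLT_of_X_mul (i := i) (hs i ▸ mem_polyLT_of_pdiv_eq_zero hd hz hdiv i)
  -- Without divergence, `z i` has degree at most `k`, so the cofactor `s i` has degree below `k`
  -- and is an admissible test. The integral of `∑ i, x i * s i ^ 2` is then zero while all `x i`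
  -- are positive inside.
  have h1 := hr s hsm
  have hnn : ∀ x ∈ interior (cell (vset b)), ∀ i, 0 < x i := by
    intro x hx i
    rw [interior_cell_vset] at hx
    have := hx i.succ
    rwa [hb, coord_refBasis_succ] at this
  have hev : ∀ x, ev (∑ i, z i * s i) x = ∑ i, x i * ev (s i) x ^ 2 := by
    intro x
    rw [ev_sum]
    refine Finset.sum_congr rfl fun i _ => ?_
    rw [ev_mul, hs i, ev_mul, ev_X]; ring
  have h2 : ev (∑ i, z i * s i) =ᵐ[volume.restrict (interior (cell (vset b)))] 0 := by
    rw [← restrict_interior_cell] at h1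
    refine (setIntegral_eq_zero_iff_of_nonneg_ae ?_ ?_).1 h1
    · refine (ae_restrict_iff' isOpen_interior.measurableSet).2 (.of_forall fun x hx => ?_)
      rw [hev]
      exact Finset.sum_nonneg fun i _ => mul_nonneg (hnn x hx i).le (sq_nonneg _)
    · rw [IntegrableOn, restrict_interior_cell]
      exact integrable_ev _ _
  have h3 := Measure.eqOn_open_of_ae_eq h2 isOpen_interior (continuous_ev _).continuousOn
    continuousOn_const
  funext i
  rw [hs i]
  have : s i = 0 := by
    refine eq_zero_of_ev_eq_zero isOpen_interior (interior_cell_nonempty b) fun x hx => ?_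
    have h4 := h3 hx
    rw [hev] at h4
    have h5 := (Finset.sum_eq_zero_iff_of_nonneg fun i _ =>
      mul_nonneg (hnn x hx i).le (sq_nonneg (ev (s i) x))).1 h4 i (Finset.mem_univ i)
    exact pow_eq_zero_iff two_ne_zero |>.1 ((mul_eq_zero.1 h5).resolve_left (hnn x hx i).ne')
  rw [this, mul_zero]; rfl

end RTM

end

/-! ### Dual test functions for the degrees of freedom -/

noncomputable section
namespace RTM
variable {d : ℕ}

open MvPolynomial

instance (k : ℕ) : FiniteDimensional ℝ (RTSpace d k) := by
  let φ : RTSpace d k →ₗ[ℝ] (Fin d → polyLT d (k + 2)) :=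
    LinearMap.pi fun i => LinearMap.codRestrict _
      ((LinearMap.proj i).comp (RTSpace d k).subtype) fun z => mem_polyLT_of_mem_RTSpace z.2 i
  refine Module.Finite.of_injective φ fun z w h => Subtype.ext (funext fun i => ?_)
  exact congrArg Subtype.val (congrFun h i)

/-- The integral of a polynomial over a simplex. -/
def polyInt (s : Finset (E d)) : MvPolynomial (Fin d) ℝ →ₗ[ℝ] ℝ where
  toFun p := ∫ x in cell s, ev p x
  map_add' p q := by
    simp only [ev_add]
    exact integral_add (integrable_ev _ _) (integrable_ev _ _)
  map_smul' a p := by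
    simp only [ev_smul, RingHom.id_apply, smul_eq_mul]
    exact integral_const_mul _ _

/-- The pointwise product of polynomial fields. -/
def dotPoly {ι : Type*} [Fintype ι] (z w : ι → MvPolynomial (Fin d) ℝ) : MvPolynomial (Fin d) ℝ :=
  ∑ i, z i * w i

theorem ev_dotPoly {ι : Type*} [Fintype ι] (z w : ι → MvPolynomial (Fin d) ℝ) (x : E d) :
    ev (dotPoly z w) x = ∑ i, ev (z i) x * ev (w i) x := by
  simp only [dotPoly, ev_sum, ev_mul]

theorem dotPoly_comm {ι : Type*} [Fintype ι] (z w : ι → MvPolynomial (Fin d) ℝ) :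
    dotPoly z w = dotPoly w z := Finset.sum_congr rfl fun _ _ => mul_comm _ _

theorem dotPoly_add_left {ι : Type*} [Fintype ι] (z z' w : ι → MvPolynomial (Fin d) ℝ) :
    dotPoly (z + z') w = dotPoly z w + dotPoly z' w := by
  simp only [dotPoly, Pi.add_apply, add_mul, Finset.sum_add_distrib]

theorem dotPoly_smul_left {ι : Type*} [Fintype ι] (c : ℝ) (z w : ι → MvPolynomial (Fin d) ℝ) :
    dotPoly (c • z) w = c • dotPoly z w := by
  simp only [dotPoly, Pi.smul_apply, smul_mul_assoc, Finset.smul_sum]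

/-- The `L²` inner product of polynomial fields on a simplex, restricted to a subspace. -/
def innerForm (b : AffineBasis (Fin (d + 1)) ℝ (E d)) (V : Submodule ℝ (PolyField d)) :
    V →ₗ[ℝ] V →ₗ[ℝ] ℝ :=
  LinearMap.mk₂ ℝ (fun z w => polyInt (vset b) (dotPoly z.1 w.1))
    (fun z z' w => by rw [Submodule.coe_add, dotPoly_add_left, map_add])
    (fun c z w => by rw [Submodule.coe_smul, dotPoly_smul_left, map_smul])
    (fun w z z' => by
      rw [dotPoly_comm, Submodule.coe_add, dotPoly_add_left, map_add, dotPoly_comm,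
        dotPoly_comm z'.1])
    (fun c w z => by
      rw [dotPoly_comm, Submodule.coe_smul, dotPoly_smul_left, map_smul, dotPoly_comm])

theorem innerForm_apply (b : AffineBasis (Fin (d + 1)) ℝ (E d)) (V : Submodule ℝ (PolyField d))
    (z w : V) : innerForm b V z w = ∫ x in cell (vset b), ev (dotPoly z.1 w.1) x := rfl

theorem innerForm_self_nonneg (b : AffineBasis (Fin (d + 1)) ℝ (E d))
    (V : Submodule ℝ (PolyField d)) (z : V) : 0 ≤ innerForm b V z z := by
  rw [innerForm_apply]
  refine integral_nonneg fun x => ?_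
  rw [ev_dotPoly]
  exact Finset.sum_nonneg fun i _ => mul_self_nonneg _

theorem eq_zero_of_integral_dotPoly {b : AffineBasis (Fin (d + 1)) ℝ (E d)} {z : PolyField d}
    (h : ∫ x in cell (vset b), ev (dotPoly z z) x = 0) : z = 0 := by
  have hi : ∀ i, Integrable (fun x => ev (z i) x ^ 2) (volume.restrict (cell (vset b))) :=
    fun i => integrable_sq (memLp_cell_of_continuous _ (continuous_ev _) 2)
  have h1 : ∀ x, ev (dotPoly z z) x = ∑ i, ev (z i) x ^ 2 := fun x => by
    rw [ev_dotPoly]; exact Finset.sum_congr rfl fun i _ => (sq _).symm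
  simp only [h1] at h
  rw [integral_finsetSum _ fun i _ => hi i] at h
  funext i
  exact eq_zero_of_integral_sq_eq_zero b
    ((Finset.sum_eq_zero_iff_of_nonneg fun i _ => integral_nonneg fun x => sq_nonneg _).1 h i
      (Finset.mem_univ i))

/-- Linear functionals on a finite-dimensional space of polynomial fields are bounded in `L²`. -/
theorem exists_functional_bound (b : AffineBasis (Fin (d + 1)) ℝ (E d))
    (V : Submodule ℝ (PolyField d)) [FiniteDimensional ℝ V] (l : V →ₗ[ℝ] ℝ) :
    ∃ C, 0 ≤ C ∧ ∀ z : V, |l z| ≤ C * √(innerForm b V z z) := by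
  have hinj : Function.Injective (innerForm b V) := by
    rw [← LinearMap.ker_eq_bot, LinearMap.ker_eq_bot']
    intro z hz
    refine Subtype.ext (eq_zero_of_integral_dotPoly (b := b) ?_)
    rw [← innerForm_apply, hz]; rfl
  -- Riesz representation in finite dimension; the bound is the Cauchy–Schwarz inequality, obtained
  -- from the discriminant below.
  obtain ⟨y, hy⟩ := (LinearMap.injective_iff_surjective_of_finrank_eq_finrank
    (Subspace.dual_finrank_eq (K := ℝ) (V := V)).symm).1 hinj l
  refine ⟨√(innerForm b V y y), Real.sqrt_nonneg _, fun z => ?_⟩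
  rw [← hy, ← Real.sqrt_mul (innerForm_self_nonneg b V y)]
  refine Real.abs_le_sqrt ?_
  have hquad : ∀ t : ℝ, 0 ≤ innerForm b V z z * (t * t) + 2 * innerForm b V y z * t +
      innerForm b V y y := by
    intro t
    have h := innerForm_self_nonneg b V (t • z + y)
    have hsymm : innerForm b V z y = innerForm b V y z := by
      rw [innerForm_apply, innerForm_apply, dotPoly_comm]
    simp only [map_add, map_smul, LinearMap.add_apply, LinearMap.smul_apply, smul_eq_mul,
      hsymm] at h
    linarith
  have := discrim_le_zero hquad
  rw [discrim] at this
  nlinarith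

/-- Linear maps from a finite-dimensional space of polynomial fields to polynomials are bounded
from `L²` to `L^∞`. -/
theorem exists_sup_bound (b : AffineBasis (Fin (d + 1)) ℝ (E d))
    (V : Submodule ℝ (PolyField d)) [FiniteDimensional ℝ V]
    (L : V →ₗ[ℝ] MvPolynomial (Fin d) ℝ) :
    ∃ C, 0 ≤ C ∧ ∀ z : V, ∀ x ∈ cell (vset b), |ev (L z) x| ≤ C * √(innerForm b V z z) := by
  let B := Module.finBasis ℝ V
  choose A hA hAz using fun i => exists_functional_bound b V (B.coord i)
  choose M hM using fun i =>
    (isCompact_cell (vset b)).exists_bound_of_continuousOn (continuous_ev (L (B i))).continuousOn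
  refine ⟨∑ i, A i * |M i|, Finset.sum_nonneg fun i _ => mul_nonneg (hA i) (abs_nonneg _),
    fun z x hx => ?_⟩
  have h1 : L z = ∑ i, B.coord i z • L (B i) := by
    conv_lhs => rw [← B.sum_repr z]
    rw [map_sum]
    simp only [map_smul, Module.Basis.coord_apply]
  rw [h1, ev_sum, Finset.sum_mul]
  refine (Finset.abs_sum_le_sum_abs _ _).trans (Finset.sum_le_sum fun i _ => ?_)
  rw [ev_smul, abs_mul]
  calc |B.coord i z| * |ev (L (B i)) x| ≤ (A i * √(innerForm b V z z)) * |M i| :=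
        mul_le_mul (hAz i z) ((hM i x hx).trans (le_abs_self _)) (abs_nonneg _)
          (mul_nonneg (hA i) (Real.sqrt_nonneg _))
    _ = A i * |M i| * √(innerForm b V z z) := by ring

/-- The test functions of the degrees of freedom of the Raviart-Thomas space. -/
abbrev DofSpace (d k : ℕ) : Type :=
  (Fin d → polyLT d k) × (Fin (d + 1) → polyLT d (k + 1))

/-- The polynomial whose integral pairs a field with the degrees of freedom. -/
def dofPoly (b : AffineBasis (Fin (d + 1)) ℝ (E d)) {k : ℕ} (z : PolyField d)
    (y : DofSpace d k) : MvPolynomial (Fin d) ℝ :=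
  (∑ i, z i * (y.1 i : MvPolynomial (Fin d) ℝ)) +
    ∑ j, coneDiv b j (gradComp b j z * (y.2 j : MvPolynomial (Fin d) ℝ))

/-- The pairing of Raviart-Thomas fields with the degrees of freedom. -/
def dofForm (b : AffineBasis (Fin (d + 1)) ℝ (E d)) (k : ℕ) :
    RTSpace d k →ₗ[ℝ] DofSpace d k →ₗ[ℝ] ℝ :=
  LinearMap.mk₂ ℝ (fun z y => polyInt (vset b) (dofPoly b z.1 y))
    (fun z z' y => by
      rw [← map_add]; congr 1
      simp only [dofPoly, Submodule.coe_add, Pi.add_apply, map_add, add_mul,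
        Finset.sum_add_distrib]
      abel)
    (fun c z y => by
      rw [← map_smul]; congr 1
      simp only [dofPoly, Submodule.coe_smul, Pi.smul_apply, map_smul, smul_mul_assoc, smul_add,
        Finset.smul_sum])
    (fun z y y' => by
      rw [← map_add]; congr 1
      simp only [dofPoly, Prod.fst_add, Prod.snd_add, Submodule.coe_add, Pi.add_apply, map_add,
        mul_add, Finset.sum_add_distrib]
      abel)
    (fun c z y => by
      rw [← map_smul]; congr 1
      simp only [dofPoly, Prod.smul_fst, Prod.smul_snd, Submodule.coe_smul, Pi.smul_apply,
        map_smul, mul_smul_comm, smul_add, Finset.smul_sum])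

theorem dofForm_apply (b : AffineBasis (Fin (d + 1)) ℝ (E d)) (k : ℕ) (z : RTSpace d k)
    (y : DofSpace d k) : dofForm b k z y = ∫ x in cell (vset b), ev (dofPoly b z.1 y) x := rfl

theorem dofForm_injective (hd : 0 < d) (k : ℕ) :
    Function.Injective (dofForm (refBasis d) k) := by
  classical
  rw [← LinearMap.ker_eq_bot, LinearMap.ker_eq_bot']
  intro z hz
  refine Subtype.ext (unisolvence hd z.2 (fun r hr => ?_) fun j m hm => ?_)
  · have := LinearMap.congr_fun hz (fun i => ⟨r i, hr i⟩, 0)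
    rw [dofForm_apply] at this
    simpa [dofPoly] using this
  · have := LinearMap.congr_fun hz (0, Pi.single j ⟨m, hm⟩)
    rw [dofForm_apply] at this
    have e : dofPoly (refBasis d) z.1 ((0, Pi.single j ⟨m, hm⟩) : DofSpace d k) =
        coneDiv (refBasis d) j (gradComp (refBasis d) j z.1 * m) := by
      rw [dofPoly, Finset.sum_eq_single_of_mem j (Finset.mem_univ j)]
      · simp
      · intro l _ hl
        simp [Pi.single_eq_of_ne hl]
    rw [e] at this
    simpa using this

/-- Test functions that reproduce the `L²` norm of a Raviart-Thomas field on the reference simplex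
are bounded by that norm. -/
theorem exists_dual (hd : 0 < d) (k : ℕ) : ∃ C, 0 ≤ C ∧ ∀ z ∈ RTSpace d k,
    ∃ y : DofSpace d k,
      ∫ x in cell (vset (refBasis d)), ev (dofPoly (refBasis d) z y) x =
        ∫ x in cell (vset (refBasis d)), ev (dotPoly z z) x ∧
      ∀ x ∈ cell (vset (refBasis d)),
        (∀ i, |ev (y.1 i).1 x| ≤ C * √(∫ x in cell (vset (refBasis d)), ev (dotPoly z z) x)) ∧
        ∀ j, |ev (y.2 j).1 x| ≤ C * √(∫ x in cell (vset (refBasis d)), ev (dotPoly z z) x) ∧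
          |ev (coneDiv (refBasis d) j (y.2 j).1) x| ≤
            C * √(∫ x in cell (vset (refBasis d)), ev (dotPoly z z) x) := by
  set b := refBasis d with hb
  -- By unisolvence, the degrees of freedom separate fields, so every linear functional on the
  -- Raviart–Thomas space is a pairing with some test function.
  have hsurj : Function.Surjective (dofForm b k).flip :=
    LinearMap.flip_surjective_iff₁.2 (dofForm_injective hd k)
  obtain ⟨R, hR⟩ := LinearMap.exists_rightInverse_of_surjective (dofForm b k).flip
    (LinearMap.range_eq_top.2 hsurj)
  -- A linear choice of the test function that represents the inner product with `z`. Linearity is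
  -- what lets finite dimensionality supply the bounds.
  let Λ : RTSpace d k →ₗ[ℝ] DofSpace d k := R.comp (innerForm b (RTSpace d k))
  have hΛ : ∀ z w : RTSpace d k, dofForm b k w (Λ z) = innerForm b _ z w := by
    intro z w
    have := LinearMap.congr_fun (LinearMap.congr_fun hR (innerForm b _ z)) w
    exact this
  let L1 : ∀ _ : Fin d, RTSpace d k →ₗ[ℝ] MvPolynomial (Fin d) ℝ := fun i =>
    (polyLT d k).subtype.comp ((LinearMap.proj i).comp ((LinearMap.fst ℝ _ _).comp Λ))
  let L2 : ∀ _ : Fin (d + 1), RTSpace d k →ₗ[ℝ] MvPolynomial (Fin d) ℝ := fun j =>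
    (polyLT d (k + 1)).subtype.comp ((LinearMap.proj j).comp ((LinearMap.snd ℝ _ _).comp Λ))
  choose C1 hC1 hC1' using fun i => exists_sup_bound b (RTSpace d k) (L1 i)
  choose C2 hC2 hC2' using fun j => exists_sup_bound b (RTSpace d k) (L2 j)
  choose C3 hC3 hC3' using fun j => exists_sup_bound b (RTSpace d k) ((coneDiv b j).comp (L2 j))
  set C := (∑ i, C1 i) + (∑ j, C2 j) + ∑ j, C3 j with hC
  have hs1 : ∀ i, C1 i ≤ ∑ i, C1 i := fun i =>
    Finset.single_le_sum (fun i _ => hC1 i) (Finset.mem_univ i)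
  have hs2 : ∀ i, C2 i ≤ ∑ i, C2 i := fun i =>
    Finset.single_le_sum (fun i _ => hC2 i) (Finset.mem_univ i)
  have hs3 : ∀ i, C3 i ≤ ∑ i, C3 i := fun i =>
    Finset.single_le_sum (fun i _ => hC3 i) (Finset.mem_univ i)
  have h1 : 0 ≤ ∑ i, C1 i := Finset.sum_nonneg fun i _ => hC1 i
  have h2 : 0 ≤ ∑ i, C2 i := Finset.sum_nonneg fun i _ => hC2 i
  have h3 : 0 ≤ ∑ i, C3 i := Finset.sum_nonneg fun i _ => hC3 i
  refine ⟨C, by positivity, fun z hz => ⟨Λ ⟨z, hz⟩, hΛ ⟨z, hz⟩ ⟨z, hz⟩, fun x hx =>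
    ⟨fun i => ?_, fun j => ⟨?_, ?_⟩⟩⟩⟩
  · exact (hC1' i ⟨z, hz⟩ x hx).trans (mul_le_mul_of_nonneg_right
      (by linarith [hs1 i]) (Real.sqrt_nonneg _))
  · exact (hC2' j ⟨z, hz⟩ x hx).trans (mul_le_mul_of_nonneg_right
      (by linarith [hs2 j]) (Real.sqrt_nonneg _))
  · exact (hC3' j ⟨z, hz⟩ x hx).trans (mul_le_mul_of_nonneg_right
      (by linarith [hs3 j]) (Real.sqrt_nonneg _))

end RTM

end

/-! ### Affine pullback to the reference simplex -/

noncomputable section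
namespace RTM
variable {d : ℕ}

open MvPolynomial

/-- The affine map of a simplex onto the reference simplex. -/
def toRef (b : AffineBasis (Fin (d + 1)) ℝ (E d)) (x : E d) : E d :=
  WithLp.toLp 2 fun i => b.coord i.succ x

/-- The affine map of the reference simplex onto a simplex. -/
def ofRef (b : AffineBasis (Fin (d + 1)) ℝ (E d)) (y : E d) : E d :=
  b 0 + ∑ i : Fin d, y i • (b i.succ - b 0)

theorem toRef_apply (b : AffineBasis (Fin (d + 1)) ℝ (E d)) (x : E d) (i : Fin d) :
    toRef b x i = b.coord i.succ x := rfl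

theorem coord_toRef (b : AffineBasis (Fin (d + 1)) ℝ (E d)) (j : Fin (d + 1)) (x : E d) :
    (refBasis d).coord j (toRef b x) = b.coord j x := by
  refine Fin.cases ?_ (fun i => ?_) j
  · rw [coord_zero_eq, coord_zero_eq]
    simp only [coord_refBasis_succ, toRef_apply]
  · rw [coord_refBasis_succ, toRef_apply]

theorem toRef_ofRef (b : AffineBasis (Fin (d + 1)) ℝ (E d)) (y : E d) :
    toRef b (ofRef b y) = y := by
  ext i
  rw [toRef_apply, ofRef, coord_add, b.coord_apply_ne (Fin.succ_ne_zero i), zero_add, inner_sum,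
    Finset.sum_eq_single_of_mem i (Finset.mem_univ i)]
  · rw [inner_smul_right, inner_grad_vertex]; simp [Fin.succ_ne_zero]
  · intro l _ hl
    rw [inner_smul_right, inner_grad_vertex]
    simp [Fin.succ_ne_zero, hl.symm]

theorem toRef_injective (b : AffineBasis (Fin (d + 1)) ℝ (E d)) :
    Function.Injective (toRef b) := by
  intro x y h
  refine b.ext_elem fun j => ?_
  rw [← coord_toRef b j x, ← coord_toRef b j y, h]

theorem ofRef_toRef (b : AffineBasis (Fin (d + 1)) ℝ (E d)) (x : E d) :
    ofRef b (toRef b x) = x :=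
  toRef_injective b (toRef_ofRef b _)

theorem toRef_mem_cell (b : AffineBasis (Fin (d + 1)) ℝ (E d)) (x : E d) :
    toRef b x ∈ cell (vset (refBasis d)) ↔ x ∈ cell (vset b) := by
  rw [cell_vset, cell_vset]
  simp only [mem_ofPred_eq, coord_toRef]

theorem toRef_image_cell (b : AffineBasis (Fin (d + 1)) ℝ (E d)) :
    toRef b '' cell (vset b) = cell (vset (refBasis d)) := by
  ext y
  constructor
  · rintro ⟨x, hx, rfl⟩
    exact (toRef_mem_cell b x).2 hx
  · intro hy
    exact ⟨ofRef b y, (toRef_mem_cell b _).1 (by rwa [toRef_ofRef]), toRef_ofRef b y⟩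

theorem toRef_vertex (b : AffineBasis (Fin (d + 1)) ℝ (E d)) (j : Fin (d + 1)) :
    toRef b (b j) = refBasis d j := by
  refine (refBasis d).ext_elem fun i => ?_
  rw [coord_toRef, AffineBasis.coord_apply, AffineBasis.coord_apply]

/-- The linear part of `toRef`. -/
def toRefL (b : AffineBasis (Fin (d + 1)) ℝ (E d)) : E d →L[ℝ] E d :=
  ∑ i : Fin d, (innerSL ℝ (grad b i.succ)).smulRight (EuclideanSpace.single i 1)

theorem toRefL_apply (b : AffineBasis (Fin (d + 1)) ℝ (E d)) (v : E d) (i : Fin d) :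
    toRefL b v i = inner ℝ (grad b i.succ) v := by
  simp [toRefL, Pi.single_apply]

theorem toRef_sub (b : AffineBasis (Fin (d + 1)) ℝ (E d)) (x y : E d) :
    toRefL b (x - y) = toRef b x - toRef b y := by
  ext i
  rw [toRefL_apply, inner_grad_sub, PiLp.sub_apply, toRef_apply, toRef_apply]

theorem hasFDerivAt_toRef (b : AffineBasis (Fin (d + 1)) ℝ (E d)) (x : E d) :
    HasFDerivAt (toRef b) (toRefL b) x := by
  have h : toRef b = fun x => toRefL b x + toRef b 0 := by
    funext x
    have := toRef_sub b x 0
    rw [sub_zero] at this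
    rw [this, sub_add_cancel]
  rw [h]
  exact (toRefL b).hasFDerivAt.add_const _

theorem exists_integral_toRef (b : AffineBasis (Fin (d + 1)) ℝ (E d)) :
    ∃ c : ℝ, 0 < c ∧ ∀ g : E d → ℝ,
      ∫ x in cell (vset b), g (toRef b x) = c * ∫ y in cell (vset (refBasis d)), g y := by
  have h := fun g : E d → ℝ => integral_image_eq_integral_abs_det_fderiv_smul volume
    (measurableSet_cell (vset b)) (fun x _ => (hasFDerivAt_toRef b x).hasFDerivWithinAt)
    (toRef_injective b).injOn g
  simp only [toRef_image_cell, smul_eq_mul, integral_const_mul] at h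
  -- A vanishing determinant would give the reference simplex volume zero. The value of the Jacobian
  -- is never needed: it cancels in the stability estimate.
  have hne : |(toRefL b).det| ≠ 0 := by
    intro h0
    have h1 := h fun _ => 1
    rw [h0, zero_mul, setIntegral_const, smul_eq_mul, mul_one] at h1
    have hpos : 0 < volume.real (cell (vset (refBasis d))) :=
      ENNReal.toReal_pos ((isOpen_interior.measure_pos volume
        (interior_cell_nonempty (refBasis d))).trans_le
        (measure_mono interior_subset)).ne' (isCompact_cell _).measure_lt_top.ne
    exact hpos.ne' h1
  refine ⟨|(toRefL b).det|⁻¹, by positivity, fun g => ?_⟩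
  rw [h g, ← mul_assoc, inv_mul_cancel₀ hne, one_mul]

/-- The components of `toRef` as polynomials. -/
def toRefPoly (b : AffineBasis (Fin (d + 1)) ℝ (E d)) (i : Fin d) : MvPolynomial (Fin d) ℝ :=
  C (b.coord i.succ 0) + ∑ l, C (grad b i.succ l) * X l

/-- The components of `ofRef` as polynomials. -/
def ofRefPoly (b : AffineBasis (Fin (d + 1)) ℝ (E d)) (l : Fin d) : MvPolynomial (Fin d) ℝ :=
  C (b 0 l) + ∑ i : Fin d, C ((b i.succ - b 0) l) * X i

theorem ev_aeval_toRefPoly (b : AffineBasis (Fin (d + 1)) ℝ (E d)) (p : MvPolynomial (Fin d) ℝ)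
    (x : E d) : ev (aeval (toRefPoly b) p) x = ev p (toRef b x) := by
  rw [ev_aeval]
  congr 1
  ext i
  have h := coord_add b i.succ 0 x
  rw [zero_add, inner_eq_sum] at h
  simp only [toRefPoly, ev_add, ev_C, ev_sum, ev_mul, ev_X]
  rw [toRef_apply, h]

theorem ev_aeval_ofRefPoly (b : AffineBasis (Fin (d + 1)) ℝ (E d)) (p : MvPolynomial (Fin d) ℝ)
    (y : E d) : ev (aeval (ofRefPoly b) p) y = ev p (ofRef b y) := by
  rw [ev_aeval]
  congr 1
  ext l
  simp only [ofRefPoly, ev_add, ev_C, ev_sum, ev_mul, ev_X, ofRef, PiLp.add_apply,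
    WithLp.ofLp_sum, Finset.sum_apply, PiLp.smul_apply, smul_eq_mul]
  congr 1
  exact Finset.sum_congr rfl fun i _ => mul_comm _ _

theorem affine_mem_polyLT (c : ℝ) (a : Fin d → ℝ) :
    C c + ∑ l, C (a l) * X l ∈ polyLT d 2 :=
  Submodule.add_mem _ (C_mem_polyLT _ _)
    (Submodule.sum_mem _ fun l _ => C_mul_mem_polyLT _ (X_mem_polyLT l))

theorem ext_ev {p q : MvPolynomial (Fin d) ℝ} (h : ∀ x, ev p x = ev q x) : p = q :=
  MvPolynomial.funext fun x => h (WithLp.toLp 2 x)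

/-- The pullback of a field to the reference simplex (a multiple of the Piola transform). -/
def refField (b : AffineBasis (Fin (d + 1)) ℝ (E d)) (z : PolyField d) : PolyField d :=
  fun i => aeval (ofRefPoly b) (gradComp b i.succ z)

theorem ev_refField (b : AffineBasis (Fin (d + 1)) ℝ (E d)) (z : PolyField d) (i : Fin d)
    (x : E d) : ev (refField b z i) (toRef b x) = inner ℝ (evF z x) (grad b i.succ) := by
  rw [refField, ev_aeval_ofRefPoly, ofRef_toRef, ev_gradComp]

/-- The pullback is defined by matching components along the gradients of the coordinates `1, …, d`;
since all gradients sum to zero, the remaining one matches as well. Normal components are thereby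
preserved on every face, up to scaling. -/
theorem inner_refField (b : AffineBasis (Fin (d + 1)) ℝ (E d)) (z : PolyField d)
    (j : Fin (d + 1)) (x : E d) :
    inner ℝ (evF (refField b z) (toRef b x)) (grad (refBasis d) j) =
      inner ℝ (evF z x) (grad b j) := by
  have hs : ∀ i : Fin d, inner ℝ (evF (refField b z) (toRef b x)) (grad (refBasis d) i.succ) =
      inner ℝ (evF z x) (grad b i.succ) := fun i => by
    rw [grad_refBasis_succ, inner_single_right, evF_apply, ev_refField]
  refine Fin.cases ?_ hs j
  have h1 := sum_grad (refBasis d)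
  have h2 := sum_grad b
  rw [Fin.sum_univ_succ] at h1 h2
  rw [eq_neg_of_add_eq_zero_left h1, eq_neg_of_add_eq_zero_left h2, inner_neg_right,
    inner_neg_right, inner_sum, inner_sum]
  simp only [hs]

/-- Pairing `p(x) x` with a gradient gives `p` times an affine coordinate, that is, `p` times `y i`
plus a constant. Substitution destroys the homogeneity of `p`, which `mem_RTSpace` tolerates. -/
theorem refField_mem (b : AffineBasis (Fin (d + 1)) ℝ (E d)) {k : ℕ} {z : PolyField d}
    (hz : z ∈ RTSpace d k) : refField b z ∈ RTSpace d k := by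
  obtain ⟨a, p, ha, hp, h⟩ := exists_of_mem_RTSpace hz
  have hA : ∀ l, ofRefPoly b l ∈ polyLT d 2 := fun l => affine_mem_polyLT _ _
  have hpm := aeval_mem_polyLT (mem_polyLT_of_isHomogeneous hp) hA
  refine mem_RTSpace (a := fun i => aeval (ofRefPoly b) (gradComp b i.succ a) +
    C (inner ℝ (grad b i.succ) (b 0)) * aeval (ofRefPoly b) p) (p := aeval (ofRefPoly b) p)
    (fun i => Submodule.add_mem _ (aeval_mem_polyLT ?_ hA) (C_mul_mem_polyLT _ hpm)) hpm
    fun i => ext_ev fun y => ?_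
  · simp only [gradComp, LinearMap.sum_apply, LinearMap.smul_apply, LinearMap.proj_apply]
    exact Submodule.sum_mem _ fun l _ => Submodule.smul_mem _ _ (ha l)
  · simp only [refField, ev_add, ev_mul, ev_C, ev_X, ev_aeval_ofRefPoly, ev_gradComp]
    have h1 : evF z (ofRef b y) = evF a (ofRef b y) + ev p (ofRef b y) • ofRef b y := by
      ext l
      rw [evF_apply, h, PiLp.add_apply, PiLp.smul_apply, evF_apply, ev_add, ev_mul, ev_X,
        smul_eq_mul, mul_comm]
    have h2 : inner ℝ (ofRef b y) (grad b i.succ) = inner ℝ (grad b i.succ) (b 0) + y i := by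
      have := inner_grad_sub b i.succ (ofRef b y) (b 0)
      rw [inner_sub_right, ← toRef_apply, toRef_ofRef, b.coord_apply_ne (Fin.succ_ne_zero i)]
        at this
      rw [real_inner_comm]; linarith
    rw [h1, inner_add_left, real_inner_smul_left, h2]; ring

/-- Chain rule for an affine map that sends vertices to vertices, so that the direction towards `b
j` is preserved. -/
theorem ev_coneDiv_aeval (b : AffineBasis (Fin (d + 1)) ℝ (E d)) (j : Fin (d + 1))
    (p : MvPolynomial (Fin d) ℝ) (x : E d) :
    ev (coneDiv b j (aeval (toRefPoly b) p)) x = ev (coneDiv (refBasis d) j p) (toRef b x) := by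
  rw [ev_coneDiv, ev_coneDiv, ev_aeval_toRefPoly]
  have h : ev (aeval (toRefPoly b) p) = ev p ∘ toRef b := funext (ev_aeval_toRefPoly b p)
  rw [h, ((((contDiff_ev p).differentiable (by simp)) (toRef b x)).hasFDerivAt.comp x
    (hasFDerivAt_toRef b x)).fderiv, ContinuousLinearMap.comp_apply, toRef_sub, toRef_vertex]

theorem gradComp_eq (b : AffineBasis (Fin (d + 1)) ℝ (E d)) (j : Fin (d + 1)) (z : PolyField d) :
    aeval (toRefPoly b) (gradComp (refBasis d) j (refField b z)) = gradComp b j z :=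
  ext_ev fun x => by rw [ev_aeval_toRefPoly, ev_gradComp, ev_gradComp, inner_refField]

/-- A field is recovered from its pullback. -/
theorem evF_eq_sum (b : AffineBasis (Fin (d + 1)) ℝ (E d)) (z : PolyField d) (x : E d) :
    evF z x = ∑ i : Fin d, ev (refField b z i) (toRef b x) • (b i.succ - b 0) := by
  have h := sum_inner_grad_smul b (evF z x)
  rw [Fin.sum_univ_succ] at h
  have h0 : inner ℝ (grad b 0) (evF z x) = -∑ i : Fin d, inner ℝ (grad b i.succ) (evF z x) := by
    have h1 := sum_grad b
    rw [Fin.sum_univ_succ] at h1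
    rw [eq_neg_of_add_eq_zero_left h1, inner_neg_left, sum_inner]
  rw [h0, neg_smul, Finset.sum_smul, ← sub_eq_neg_add, ← Finset.sum_sub_distrib] at h
  conv_lhs => rw [← h]
  refine Finset.sum_congr rfl fun i _ => ?_
  rw [ev_refField, smul_sub, real_inner_comm]

end RTM

end

/-! ### Stability of the Raviart–Thomas projection -/

noncomputable section
namespace RTM
variable {d : ℕ}

open MvPolynomial

theorem abs_integral_mul_le_of_bound (s : Finset (E d)) {v f : E d → ℝ}
    (hv : MemLp v 2 (volume.restrict (cell s))) (hf : Continuous f) {B : ℝ} (hB : 0 ≤ B)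
    (h : ∀ x ∈ cell s, |f x| ≤ B) :
    |∫ x in cell s, v x * f x| ≤ B * √(volume.real (cell s)) * √(∫ x in cell s, v x ^ 2) := by
  have hfm := memLp_cell_of_continuous s hf 2
  have h1 : ∫ x in cell s, f x ^ 2 ≤ B ^ 2 * volume.real (cell s) := by
    have := setIntegral_mono_on (integrable_sq hfm)
      (integrableOn_const (isCompact_cell s).measure_lt_top.ne (C := B ^ 2)) (measurableSet_cell s)
      fun x hx => sq_le_sq' (neg_le_of_abs_le (h x hx)) (le_of_abs_le (h x hx))
    rwa [setIntegral_const, smul_eq_mul, mul_comm] at this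
  have h2 : √(∫ x in cell s, f x ^ 2) ≤ B * √(volume.real (cell s)) := by
    refine (Real.sqrt_le_sqrt h1).trans_eq ?_
    rw [Real.sqrt_mul (sq_nonneg B), Real.sqrt_sq hB]
  refine (abs_integral_mul_le hv hfm).trans ?_
  rw [mul_comm]
  exact mul_le_mul_of_nonneg_right h2 (Real.sqrt_nonneg _)

theorem vertex_mem_cell (b : AffineBasis (Fin (d + 1)) ℝ (E d)) (j : Fin (d + 1)) :
    b j ∈ cell (vset b) := subset_convexHull ℝ _ (by simp [vset])

theorem norm_sub_le_diam {b : AffineBasis (Fin (d + 1)) ℝ (E d)} {x y : E d}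
    (hx : x ∈ cell (vset b)) (hy : y ∈ cell (vset b)) :
    ‖x - y‖ ≤ Metric.diam (cell (vset b)) := by
  rw [← dist_eq_norm]
  exact Metric.dist_le_diam_of_mem (isCompact_cell _).isBounded hx hy

theorem coneDiv_eq_sum (b : AffineBasis (Fin (d + 1)) ℝ (E d)) (j : Fin (d + 1))
    (p : MvPolynomial (Fin d) ℝ) :
    coneDiv b j p = ∑ i, pderiv i (p * (X i - C (b j i))) := by
  simp only [coneDiv, LinearMap.add_apply, LinearMap.smul_apply, LinearMap.id_apply,
    LinearMap.sum_apply, LinearMap.comp_apply, LinearMap.mulRight_apply, pderiv_mul, map_sub,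
    pderiv_X_self, pderiv_C, sub_zero, mul_one, Finset.sum_add_distrib, Finset.sum_const,
    Finset.card_univ, Fintype.card_fin]
  rw [add_comm]
  congr 1
  rw [← Nat.cast_smul_eq_nsmul ℝ]

/-- The moments of a trace on a face as integrals over the simplex. -/
theorem integral_trace_ev (hd : 0 < d) {b : AffineBasis (Fin (d + 1)) ℝ (E d)} {w g : E d → ℝ}
    {G : Fin d → E d → ℝ} (h : HasTrace (vset b) w G g) (j : Fin (d + 1))
    (m : MvPolynomial (Fin d) ℝ) :
    ∫ x, g x * ev m x ∂surf (vface b j) = ‖grad b j‖ *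
      ((∫ x in cell (vset b), w x * ev (coneDiv b j m) x) +
        ∑ i, ∫ x in cell (vset b), G i x * (ev m x * (x - b j) i)) := by
  rw [integral_trace_mul hd h j (contDiff_ev m), Finset.sum_add_distrib]
  congr 2
  rw [coneDiv_eq_sum]
  simp only [ev_sum, Finset.mul_sum]
  rw [integral_finsetSum _ fun i _ => integrable_mul h.memLp
    (memLp_cell_of_continuous _ (continuous_ev _) 2)]
  refine Finset.sum_congr rfl fun i _ => ?_
  have e : (fun y : E d => ev m y * (y - b j) i) = ev (m * (X i - C (b j i))) := by
    funext y
    rw [ev_mul, ev_sub, ev_X, ev_C, PiLp.sub_apply]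
  rw [e, pd_ev]

/-- The face degrees of freedom of a field that shares its normal moments with a field `v` in
`H¹`. -/
theorem integral_coneDiv_gradComp (hd : 0 < d) {b : AffineBasis (Fin (d + 1)) ℝ (E d)}
    {v γ : Fin d → E d → ℝ} {G : Fin d → Fin d → E d → ℝ}
    (h : ∀ l, HasTrace (vset b) (v l) (G l) (γ l)) {z : PolyField d} {j : Fin (d + 1)}
    {m : MvPolynomial (Fin d) ℝ}
    (hm : ∫ x, inner ℝ (evF z x) (normal (vset b) (vface b j)) * ev m x ∂surf (vface b j) =
      ∫ x, (∑ i, γ i x * normal (vset b) (vface b j) i) * ev m x ∂surf (vface b j)) :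
    ∫ x in cell (vset b), ev (coneDiv b j (gradComp b j z * m)) x =
      ∑ l, grad b j l * ((∫ x in cell (vset b), v l x * ev (coneDiv b j m) x) +
        ∑ i, ∫ x in cell (vset b), G l i x * (ev m x * (x - b j) i)) := by
  have hne : ‖grad b j‖ ≠ 0 := norm_ne_zero_iff.2 (grad_ne_zero hd b j)
  have he : vface b j ∈ faces (vset b) := (mem_faces_iff b _).2 ⟨j, rfl⟩
  have h1 := integral_surf_ev hd b j (gradComp b j z * m)
  simp only [ev_mul, ev_gradComp] at h1
  -- Normal and gradient differ by the factor `-‖grad b j‖⁻¹`, common to both sides.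
  have h2 : ∫ x, inner ℝ (evF z x) (grad b j) * ev m x ∂surf (vface b j) =
      ∫ x, (∑ i, γ i x * grad b j i) * ev m x ∂surf (vface b j) := by
    have e1 : ∀ x, inner ℝ (evF z x) (normal (vset b) (vface b j)) * ev m x =
        -‖grad b j‖⁻¹ * (inner ℝ (evF z x) (grad b j) * ev m x) := fun x => by
      rw [normal_vface hd, inner_neg_right, inner_smul_right]; ring
    have e2 : ∀ x, (∑ i, γ i x * normal (vset b) (vface b j) i) * ev m x =
        -‖grad b j‖⁻¹ * ((∑ i, γ i x * grad b j i) * ev m x) := fun x => by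
      rw [normal_vface hd, ← mul_assoc, Finset.mul_sum]
      congr 1
      refine Finset.sum_congr rfl fun i _ => ?_
      rw [PiLp.neg_apply, PiLp.smul_apply, smul_eq_mul]; ring
    simp only [e1, e2, integral_const_mul] at hm
    exact mul_left_cancel₀ (neg_ne_zero.2 (inv_ne_zero hne)) hm
  have hmL := memLp_surf_of_continuous hd b j (continuous_ev m) 2
  have h3 : ∫ x, (∑ i, γ i x * grad b j i) * ev m x ∂surf (vface b j) =
      ∑ l, grad b j l * ∫ x, γ l x * ev m x ∂surf (vface b j) := by
    simp only [← integral_const_mul]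
    rw [← integral_finsetSum _ fun l _ =>
      (integrable_mul ((h l).memLp_trace _ he) hmL).const_mul _]
    refine integral_congr_ae (.of_forall fun x => ?_)
    simp only [Finset.sum_mul]
    exact Finset.sum_congr rfl fun i _ => by ring
  rw [h2, h3] at h1
  refine mul_left_cancel₀ hne (h1.symm.trans ?_)
  rw [Finset.mul_sum]
  refine Finset.sum_congr rfl fun l _ => ?_
  rw [integral_trace_ev hd (h l) j m]; ring

/-- Rewrites the pairing on the reference simplex as moments of `z` itself against pulled-back test
functions, so that the known moments of `z` on the actual simplex can be inserted. -/
theorem ev_dofPoly_refField (b : AffineBasis (Fin (d + 1)) ℝ (E d)) {k : ℕ} (z : PolyField d)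
    (y : DofSpace d k) (x : E d) :
    ev (dofPoly (refBasis d) (refField b z) y) (toRef b x) =
      (∑ l, ev (z l) x * ev (∑ i : Fin d, C (grad b i.succ l) *
        aeval (toRefPoly b) (y.1 i).1) x) +
        ∑ j, ev (coneDiv b j (gradComp b j z * aeval (toRefPoly b) (y.2 j).1)) x := by
  have h1 : ∀ i, ev (refField b z i * (y.1 i).1) (toRef b x) =
      ∑ l, ev (z l) x * (grad b i.succ l * ev (aeval (toRefPoly b) (y.1 i).1) x) := fun i => by
    rw [ev_mul, ev_refField, inner_evF, Finset.sum_mul, ev_aeval_toRefPoly]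
    exact Finset.sum_congr rfl fun l _ => mul_assoc _ _ _
  have h2 : ∀ j, ev (coneDiv (refBasis d) j
      (gradComp (refBasis d) j (refField b z) * (y.2 j).1)) (toRef b x) =
        ev (coneDiv b j (gradComp b j z * aeval (toRefPoly b) (y.2 j).1)) x := fun j => by
    rw [← ev_coneDiv_aeval, map_mul, gradComp_eq]
  rw [dofPoly, ev_add, ev_sum, ev_sum, Finset.sum_congr rfl fun i _ => h1 i,
    Finset.sum_congr rfl fun j _ => h2 j, Finset.sum_comm]
  congr 1
  refine Finset.sum_congr rfl fun l _ => ?_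
  rw [ev_sum, Finset.mul_sum]
  refine Finset.sum_congr rfl fun i _ => ?_
  rw [ev_mul, ev_C]

/-- Stability of the Raviart-Thomas projection on a simplex. -/
theorem rt_stability (hd : 0 < d) (k : ℕ) : ∃ A, 0 ≤ A ∧
    ∀ (b : AffineBasis (Fin (d + 1)) ℝ (E d)) (v γ : Fin d → E d → ℝ)
      (G : Fin d → Fin d → E d → ℝ), (∀ l, HasTrace (vset b) (v l) (G l) (γ l)) →
    ∀ z ∈ RTSpace d k,
      (∀ r : PolyField d, (∀ i, r i ∈ polyLT d k) →
        ∫ x in cell (vset b), ∑ i, ev (z i) x * ev (r i) x =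
          ∫ x in cell (vset b), ∑ i, v i x * ev (r i) x) →
      (∀ e ∈ faces (vset b), ∀ m ∈ polyLT d (k + 1),
        ∫ x, inner ℝ (evF z x) (normal (vset b) e) * ev m x ∂surf e =
          ∫ x, (∑ i, γ i x * normal (vset b) e i) * ev m x ∂surf e) →
    ∀ s, (∀ j, Metric.diam (cell (vset b)) * ‖grad b j‖ ≤ s) →
      √(∫ x in cell (vset b), ‖evF z x‖ ^ 2) ≤ A * s *
        ∑ l, (√(∫ x in cell (vset b), v l x ^ 2) + Metric.diam (cell (vset b)) *
          ∑ i, √(∫ x in cell (vset b), G l i x ^ 2)) := by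
  obtain ⟨A, hA, hdual⟩ := exists_dual hd k
  set V := volume.real (cell (vset (refBasis d))) with hV
  -- `2 * d + 1` counts the interior moments with weight `d` and the `d + 1` faces with weight one;
  -- `√d` comes from reassembling the field from its `d` pulled-back components.
  refine ⟨√d * ((2 * d + 1) * A * √V), by positivity, fun b v γ G h z hz hr hm s hs => ?_⟩
  set K := vset b with hK
  set δ := Metric.diam (cell K) with hδ
  have hδ0 : 0 ≤ δ := Metric.diam_nonneg
  set zr := refField b z with hzr
  -- The dual test function reproduces the squared norm `N ^ 2` of the pulled-back field while being
  -- bounded by `A * N`; one factor `N` cancels in the end.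
  obtain ⟨y, hy, hyb⟩ := hdual zr (refField_mem b hz)
  set N := √(∫ x in cell (vset (refBasis d)), ev (dotPoly zr zr) x) with hN
  have hN0 : 0 ≤ N := Real.sqrt_nonneg _
  have hdot0 : ∀ x, 0 ≤ ev (dotPoly zr zr) x := fun x => by
    rw [ev_dotPoly]; exact Finset.sum_nonneg fun i _ => mul_self_nonneg _
  have hN2 : N ^ 2 = ∫ x in cell (vset (refBasis d)), ev (dotPoly zr zr) x :=
    Real.sq_sqrt (integral_nonneg hdot0)
  obtain ⟨c, hc, hcg⟩ := exists_integral_toRef b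
  have hs0 : 0 ≤ s := (mul_nonneg hδ0 (norm_nonneg _)).trans (hs 0)
  set a : Fin d → ℝ := fun l => √(∫ x in cell K, v l x ^ 2) with ha
  set g : Fin d → Fin d → ℝ := fun l i => √(∫ x in cell K, G l i x ^ 2) with hg
  have ha0 : ∀ l, 0 ≤ a l := fun l => Real.sqrt_nonneg _
  have hg0 : ∀ l i, 0 ≤ g l i := fun l i => Real.sqrt_nonneg _
  set S := ∑ l, (a l + δ * ∑ i, g l i) with hS
  have hgs0 : ∀ l, 0 ≤ δ * ∑ i, g l i := fun l =>
    mul_nonneg hδ0 (Finset.sum_nonneg fun i _ => hg0 l i)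
  have hvol : volume.real (cell K) = c * V := by
    have := hcg fun _ => 1
    simpa using this
  have hcomp : ∀ j l, δ * |grad b j l| ≤ s := fun j l =>
    (mul_le_mul_of_nonneg_left (PiLp.norm_apply_le (grad b j) l) hδ0).trans (hs j)
  set R : PolyField d := fun l => ∑ i : Fin d, C (grad b i.succ l) * aeval (toRefPoly b) (y.1 i).1
    with hR
  set M : Fin (d + 1) → MvPolynomial (Fin d) ℝ := fun j => aeval (toRefPoly b) (y.2 j).1 with hM
  have hpoly : ∀ l, toRefPoly b l ∈ polyLT d 2 := fun l => affine_mem_polyLT _ _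
  have hRm : ∀ l, R l ∈ polyLT d k := fun l => Submodule.sum_mem _ fun i _ =>
    C_mul_mem_polyLT _ (aeval_mem_polyLT (y.1 i).2 hpoly)
  have hMm : ∀ j, M j ∈ polyLT d (k + 1) := fun j => aeval_mem_polyLT (y.2 j).2 hpoly
  have hRb : ∀ l, ∀ x ∈ cell K, |ev (R l) x| ≤ (∑ i : Fin d, |grad b i.succ l|) * (A * N) := by
    intro l x hx
    rw [hR, ev_sum, Finset.sum_mul]
    refine (Finset.abs_sum_le_sum_abs _ _).trans (Finset.sum_le_sum fun i _ => ?_)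
    rw [ev_mul, ev_C, abs_mul, ev_aeval_toRefPoly]
    exact mul_le_mul_of_nonneg_left ((hyb _ ((toRef_mem_cell b x).2 hx)).1 i) (abs_nonneg _)
  have hMb : ∀ j, ∀ x ∈ cell K, |ev (M j) x| ≤ A * N := by
    intro j x hx
    rw [hM, ev_aeval_toRefPoly]
    exact ((hyb _ ((toRef_mem_cell b x).2 hx)).2 j).1
  have hMcb : ∀ j, ∀ x ∈ cell K, |ev (coneDiv b j (M j)) x| ≤ A * N := by
    intro j x hx
    rw [hM, ev_coneDiv_aeval]
    exact ((hyb _ ((toRef_mem_cell b x).2 hx)).2 j).2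
  have hAN : 0 ≤ A * N := mul_nonneg hA hN0
  -- the square of the norm as the sum of the pairings with the dual test functions
  have hid : c * N ^ 2 = (∫ x in cell K, ∑ l, v l x * ev (R l) x) +
      ∑ j, ∫ x in cell K, ev (coneDiv b j (gradComp b j z * M j)) x := by
    rw [hN2, ← hy, ← hcg, ← hr R hRm]
    have e : ∀ x, ev (dofPoly (refBasis d) zr y) (toRef b x) =
        (∑ l, ev (z l) x * ev (R l) x) + ∑ j, ev (coneDiv b j (gradComp b j z * M j)) x :=
      ev_dofPoly_refField b z y
    rw [integral_congr_ae (.of_forall e)]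
    have hi : Integrable (fun x => ∑ l, ev (z l) x * ev (R l) x) (volume.restrict (cell K)) :=
      integrable_finsetSum _ fun l _ => integrable_mul
        (memLp_cell_of_continuous _ (continuous_ev _) 2)
        (memLp_cell_of_continuous _ (continuous_ev _) 2)
    rw [integral_add hi (integrable_finsetSum _ fun j _ => integrable_ev _ _),
      integral_finsetSum _ fun j _ => integrable_ev _ _]
  set W := A * N * √(volume.real (cell K)) with hW
  have hW0 : 0 ≤ W := mul_nonneg hAN (Real.sqrt_nonneg _)
  -- The factor `δ` pairs with the barycentric gradients in the test functions, and their product is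
  -- at most `s`.
  have hT1 : δ * |∫ x in cell K, ∑ l, v l x * ev (R l) x| ≤ d * (s * W * S) := by
    rw [integral_finsetSum _ fun l _ => integrable_mul (h l).memLp
      (memLp_cell_of_continuous _ (continuous_ev _) 2)]
    have h1 : ∀ l, δ * |∫ x in cell K, v l x * ev (R l) x| ≤ d * (s * W * a l) := by
      intro l
      have h2 := abs_integral_mul_le_of_bound K (h l).memLp (continuous_ev (R l))
        (mul_nonneg (Finset.sum_nonneg fun i _ => abs_nonneg _) hAN) (hRb l)
      have h3 : δ * ∑ i : Fin d, |grad b i.succ l| ≤ d * s := by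
        rw [Finset.mul_sum]
        refine (Finset.sum_le_card_nsmul _ _ _ fun i _ => hcomp i.succ l).trans_eq ?_
        simp
      calc δ * |∫ x in cell K, v l x * ev (R l) x|
          ≤ δ * ((∑ i : Fin d, |grad b i.succ l|) * (A * N) * √(volume.real (cell K)) * a l) :=
            mul_le_mul_of_nonneg_left h2 hδ0
        _ = (δ * ∑ i : Fin d, |grad b i.succ l|) * (W * a l) := by rw [hW]; ring
        _ ≤ (d * s) * (W * a l) := mul_le_mul_of_nonneg_right h3 (mul_nonneg hW0 (ha0 l))
        _ = d * (s * W * a l) := by ring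
    calc _ ≤ δ * ∑ l, |∫ x in cell K, v l x * ev (R l) x| :=
          mul_le_mul_of_nonneg_left (Finset.abs_sum_le_sum_abs _ _) hδ0
      _ = ∑ l, δ * |∫ x in cell K, v l x * ev (R l) x| := Finset.mul_sum _ _ _
      _ ≤ ∑ l, d * (s * W * a l) := Finset.sum_le_sum fun l _ => h1 l
      _ = d * (s * W * ∑ l, a l) := by rw [← Finset.mul_sum, ← Finset.mul_sum]
      _ ≤ d * (s * W * S) := by
          refine mul_le_mul_of_nonneg_left (mul_le_mul_of_nonneg_left ?_ (mul_nonneg hs0 hW0))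
            (Nat.cast_nonneg d)
          exact Finset.sum_le_sum fun l _ => le_add_of_nonneg_right (hgs0 l)
  -- The face moments become volume integrals of `v` and its gradient `G`; the latter carry `x - b
  -- j`, hence the weight `δ`.
  have hT2 : ∀ j, δ * |∫ x in cell K, ev (coneDiv b j (gradComp b j z * M j)) x| ≤
      s * W * S := by
    intro j
    rw [integral_coneDiv_gradComp hd h
      (hm (vface b j) ((mem_faces_iff b _).2 ⟨j, rfl⟩) (M j) (hMm j))]
    have h1 : ∀ l, |∫ x in cell K, v l x * ev (coneDiv b j (M j)) x| ≤ W * a l := fun l =>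
      abs_integral_mul_le_of_bound K (h l).memLp (continuous_ev _) hAN (hMcb j)
    have h2 : ∀ l i, |∫ x in cell K, G l i x * (ev (M j) x * (x - b j) i)| ≤ δ * W * g l i := by
      intro l i
      have hcont : Continuous fun x : E d => ev (M j) x * (x - b j) i :=
        (continuous_ev _).mul (by fun_prop)
      refine (abs_integral_mul_le_of_bound K ((h l).memLp_grad i) hcont (mul_nonneg hAN hδ0)
        fun x hx => ?_).trans_eq (by rw [hW, hg]; ring)
      rw [abs_mul]
      exact mul_le_mul (hMb j x hx) ((PiLp.norm_apply_le (x - b j) i).trans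
        (norm_sub_le_diam hx (vertex_mem_cell b j))) (abs_nonneg _) hAN
    have h3 : ∀ l, |(∫ x in cell K, v l x * ev (coneDiv b j (M j)) x) +
        ∑ i, ∫ x in cell K, G l i x * (ev (M j) x * (x - b j) i)| ≤
          W * (a l + δ * ∑ i, g l i) := by
      intro l
      refine (abs_add_le _ _).trans ?_
      have h4 : |∑ i, ∫ x in cell K, G l i x * (ev (M j) x * (x - b j) i)| ≤
          ∑ i, δ * W * g l i :=
        (Finset.abs_sum_le_sum_abs _ _).trans (Finset.sum_le_sum fun i _ => h2 l i)
      rw [← Finset.mul_sum] at h4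
      linarith [h1 l]
    calc _ ≤ δ * ∑ l, |grad b j l * ((∫ x in cell K, v l x * ev (coneDiv b j (M j)) x) +
          ∑ i, ∫ x in cell K, G l i x * (ev (M j) x * (x - b j) i))| :=
          mul_le_mul_of_nonneg_left (Finset.abs_sum_le_sum_abs _ _) hδ0
      _ ≤ ∑ l, s * W * (a l + δ * ∑ i, g l i) := by
          rw [Finset.mul_sum]
          refine Finset.sum_le_sum fun l _ => ?_
          rw [abs_mul, ← mul_assoc, mul_assoc s]
          exact mul_le_mul (hcomp j l) (h3 l) (abs_nonneg _) hs0
      _ = s * W * S := by rw [← Finset.mul_sum]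
  have hS0 : 0 ≤ S := Finset.sum_nonneg fun l _ => add_nonneg (ha0 l) (hgs0 l)
  have hmain : δ * (c * N ^ 2) ≤ (2 * d + 1) * (s * W * S) := by
    have h1 : δ * |∑ j, ∫ x in cell K, ev (coneDiv b j (gradComp b j z * M j)) x| ≤
        (d + 1) * (s * W * S) := by
      calc _ ≤ δ * ∑ j, |∫ x in cell K, ev (coneDiv b j (gradComp b j z * M j)) x| :=
            mul_le_mul_of_nonneg_left (Finset.abs_sum_le_sum_abs _ _) hδ0
        _ = ∑ j, δ * |∫ x in cell K, ev (coneDiv b j (gradComp b j z * M j)) x| :=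
            Finset.mul_sum _ _ _
        _ ≤ (d + 1) * (s * W * S) := by
            refine (Finset.sum_le_card_nsmul _ _ _ fun j _ => hT2 j).trans_eq ?_
            simp
    rw [hid, mul_add]
    have h2 := mul_le_mul_of_nonneg_left
      (le_abs_self (∫ x in cell K, ∑ l, v l x * ev (R l) x)) hδ0
    have h3 := mul_le_mul_of_nonneg_left
      (le_abs_self (∑ j, ∫ x in cell K, ev (coneDiv b j (gradComp b j z * M j)) x)) hδ0
    linarith
  have hsc : 0 < √c := Real.sqrt_pos.2 hc
  have hfin : δ * √c * N ≤ (2 * d + 1) * A * √V * s * S := by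
    rcases hN0.eq_or_lt with h0 | hpos
    · rw [← h0, mul_zero]; positivity
    · have hsq : √c * √c = c := Real.mul_self_sqrt hc.le
      rw [hW, hvol, Real.sqrt_mul hc.le] at hmain
      refine le_of_mul_le_mul_right ?_ (mul_pos hsc hpos)
      calc δ * √c * N * (√c * N) = δ * ((√c * √c) * N ^ 2) := by ring
        _ = δ * (c * N ^ 2) := by rw [hsq]
        _ ≤ (2 * d + 1) * (s * (A * N * (√c * √V)) * S) := hmain
        _ = _ := by ring
  -- The field is a combination of edge vectors, of length at most `δ`, with the pulled-back
  -- components as coefficients.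
  have hz2 : ∫ x in cell K, ‖evF z x‖ ^ 2 ≤ d * δ ^ 2 * (c * N ^ 2) := by
    rw [hN2, ← hcg, ← integral_const_mul]
    have hcz : Continuous fun x => ‖evF z x‖ ^ 2 := (continuous_evF z).norm.pow 2
    have hct : Continuous (toRef b) :=
      continuous_iff_continuousAt.2 fun x => (hasFDerivAt_toRef b x).continuousAt
    refine setIntegral_mono_on (hcz.continuousOn.integrableOn_compact (isCompact_cell _))
      ((continuous_const.mul ((continuous_ev _).comp hct)).continuousOn.integrableOn_compact
        (isCompact_cell _)) (measurableSet_cell _) fun x _ => ?_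
    have h1 : ‖evF z x‖ ≤ ∑ i, |ev (zr i) (toRef b x)| * δ := by
      rw [evF_eq_sum b z x]
      refine (norm_sum_le _ _).trans (Finset.sum_le_sum fun i _ => ?_)
      rw [norm_smul]
      exact mul_le_mul_of_nonneg_left
        (norm_sub_le_diam (vertex_mem_cell b _) (vertex_mem_cell b _)) (abs_nonneg _)
    rw [← Finset.sum_mul] at h1
    have h2 := sq_sum_le_card_mul_sum_sq (s := Finset.univ)
      (f := fun i => |ev (zr i) (toRef b x)|)
    simp only [Finset.card_univ, Fintype.card_fin, sq_abs] at h2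
    calc ‖evF z x‖ ^ 2 ≤ ((∑ i, |ev (zr i) (toRef b x)|) * δ) ^ 2 :=
          pow_le_pow_left₀ (norm_nonneg _) h1 2
      _ = (∑ i, |ev (zr i) (toRef b x)|) ^ 2 * δ ^ 2 := by ring
      _ ≤ (d * ∑ i, ev (zr i) (toRef b x) ^ 2) * δ ^ 2 :=
          mul_le_mul_of_nonneg_right h2 (sq_nonneg _)
      _ = d * δ ^ 2 * ev (dotPoly zr zr) (toRef b x) := by
          rw [ev_dotPoly]
          simp only [← sq]
          ring
  calc √(∫ x in cell K, ‖evF z x‖ ^ 2) ≤ √(d * δ ^ 2 * (c * N ^ 2)) := Real.sqrt_le_sqrt hz2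
    _ = √d * (δ * √c * N) := by
        rw [Real.sqrt_mul (by positivity), Real.sqrt_mul (by positivity), Real.sqrt_mul hc.le,
          Real.sqrt_sq hδ0, Real.sqrt_sq hN0]
        ring
    _ ≤ √d * ((2 * d + 1) * A * √V * s * S) :=
        mul_le_mul_of_nonneg_left hfin (Real.sqrt_nonneg _)
    _ = √d * ((2 * d + 1) * A * √V) * s * S := by ring

end RTM

end

/-! ### The projection error on shape-regular meshes -/

noncomputable section
namespace RTM
variable {d : ℕ}

open MvPolynomial

theorem inDiam_nonneg (K : Finset (E d)) : 0 ≤ inDiam K :=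
  Real.sSup_nonneg (by rintro δ ⟨x, r, hr, -, rfl⟩; positivity)

/-- Crossing an inscribed ball along the gradient changes the `j`-th coordinate by the diameter of
the ball times the norm of the gradient, but that coordinate stays in `[0, 1]`. -/
theorem inDiam_mul_norm_grad_le (hd : 0 < d) (b : AffineBasis (Fin (d + 1)) ℝ (E d))
    (j : Fin (d + 1)) : inDiam (vset b) * ‖grad b j‖ ≤ 1 := by
  have hpos : 0 < ‖grad b j‖ := norm_pos_iff.2 (grad_ne_zero hd b j)
  rw [← le_div_iff₀ hpos]
  refine csSup_le ?_ ?_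
  · exact ⟨0, b 0, 0, le_rfl, by
      rw [Metric.closedBall_zero]
      exact singleton_subset_iff.2 (vertex_mem_cell b 0), by simp⟩
  · rintro δ ⟨x, r, hr, hsub, rfl⟩
    rw [le_div_iff₀ hpos]
    set n := ‖grad b j‖⁻¹ • grad b j with hn
    have hn1 : ‖n‖ = 1 := norm_smul_inv_norm (𝕜 := ℝ) (norm_pos_iff.1 hpos)
    have h1 : x + r • n ∈ cell (vset b) := hsub (by
      rw [Metric.mem_closedBall, dist_eq_norm, add_sub_cancel_left, norm_smul, hn1, mul_one,
        Real.norm_of_nonneg hr])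
    have h2 : x - r • n ∈ cell (vset b) := hsub (by
      rw [Metric.mem_closedBall, dist_eq_norm, sub_sub_cancel_left, norm_neg, norm_smul, hn1,
        mul_one, Real.norm_of_nonneg hr])
    have h3 : b.coord j (x + r • n) ≤ 1 := by
      rw [cell_vset] at h1
      rw [← b.sum_coord_apply_eq_one (x + r • n)]
      exact Finset.single_le_sum (f := fun j => b.coord j (x + r • n)) (fun i _ => h1 i)
        (Finset.mem_univ j)
    have h4 : 0 ≤ b.coord j (x - r • n) := by rw [cell_vset] at h2; exact h2 j
    have h5 := inner_grad_sub b j (x + r • n) (x - r • n)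
    have h6 : inner ℝ (grad b j) n = ‖grad b j‖ := by
      rw [hn, inner_smul_right, real_inner_self_eq_norm_sq]; field_simp
    rw [show x + r • n - (x - r • n) = (2 * r) • n by module, inner_smul_right, h6] at h5
    linarith

/-- The way shape regularity enters the estimates. The maximum with zero keeps the constant
nonnegative for every real `σ`. -/
theorem diam_mul_norm_grad_le (hd : 0 < d) {b : AffineBasis (Fin (d + 1)) ℝ (E d)} {σ : ℝ}
    (h : Metric.diam (cell (vset b)) ≤ σ * inDiam (vset b)) (j : Fin (d + 1)) :
    Metric.diam (cell (vset b)) * ‖grad b j‖ ≤ max σ 0 := by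
  have h1 := inDiam_mul_norm_grad_le hd b j
  have h2 := inDiam_nonneg (vset b)
  calc _ ≤ max σ 0 * inDiam (vset b) * ‖grad b j‖ :=
        mul_le_mul_of_nonneg_right (h.trans (mul_le_mul_of_nonneg_right (le_max_left _ _) h2))
          (norm_nonneg _)
    _ = max σ 0 * (inDiam (vset b) * ‖grad b j‖) := mul_assoc _ _ _
    _ ≤ max σ 0 * 1 := mul_le_mul_of_nonneg_left h1 (le_max_right _ _)
    _ = _ := mul_one _

theorem polyField_mem_RTSpace {k : ℕ} {p : PolyField d} (hp : ∀ i, p i ∈ polyLT d (k + 1)) :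
    p ∈ RTSpace d k :=
  mem_RTSpace hp (Submodule.zero_mem _) fun i => by rw [mul_zero, add_zero]

theorem sqrt_pow_mul_le {P h E X : ℝ} {n : ℕ} (hP : 0 ≤ P) (hh : 0 ≤ h)
    (hX : X ≤ (P * h ^ 2) ^ n * E) : √X ≤ √P ^ n * h ^ n * √E := by
  refine (Real.sqrt_le_sqrt hX).trans_eq ?_
  have e : (P * h ^ 2) ^ n = ((√P * h) ^ n) ^ 2 := by
    rw [← pow_mul, mul_comm n, pow_mul, mul_pow (√P), Real.sq_sqrt hP]
  rw [Real.sqrt_mul (by positivity), e, Real.sqrt_sq (by positivity), mul_pow]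

/-- The error of the Raviart-Thomas projection on one element. -/
theorem exists_projection_bound (hd : 0 < d) (k : ℕ) (σ : ℝ) : ∃ A, 0 ≤ A ∧
    ∀ (b : AffineBasis (Fin (d + 1)) ℝ (E d)),
      Metric.diam (cell (vset b)) ≤ σ * inDiam (vset b) →
    ∀ (q : E d → E d) (f : E d → ℝ) (p : PolyField d) (γ : Fin d → E d → ℝ)
      (G : Fin d → Fin d → E d → ℝ), IsRTProjection k (vset b) q p →
      FluxData k (vset b) q f p γ G →
    ∀ D : Fin d → (Fin d → ℕ) → E d → ℝ,
      (∀ i, D i 0 =ᵐ[volume.restrict (cell (vset b))] fun x => q x i) →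
      (∀ i α, ∑ j, α j ≤ k + 1 → MemLp (D i α) 2 (volume.restrict (cell (vset b)))) →
      (∀ i α j, ∑ j, α j < k + 1 →
        IsWeakPartial (interior (cell (vset b))) j (D i α) (D i (α + Pi.single j 1))) →
      ∫ x in cell (vset b), ‖evF p x - q x‖ ^ 2 ≤
        A * (Metric.diam (cell (vset b)) ^ (k + 1)) ^ 2 *
          ∑ i, ∑ β ∈ Finset.piAntidiag Finset.univ (k + 1),
            ∫ x in cell (vset b), D i β x ^ 2 := by
  obtain ⟨A, hA, hstab⟩ := rt_stability hd k
  set P : ℝ := 2 ^ d * d with hP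
  have hP0 : 0 ≤ P := by positivity
  set s := max σ 0 with hs
  have hs0 : 0 ≤ s := le_max_right _ _
  set Q := √P ^ (k + 1) + d * √P ^ k with hQ
  -- From `‖Πq - q‖² ≤ 2 ‖Πq - w‖² + 2 ‖q - w‖²`: the first summand is stability applied to `q - w`,
  -- where `Q` adds the constants for the function and its `d` derivatives; the second is the
  -- approximation error.
  refine ⟨2 * (d * (A * s * Q) ^ 2) + 2 * P ^ (k + 1), by positivity,
    fun b hb q f p γ G hp hflux D hD0 hDm hDw => ?_⟩
  set K := vset b with hK
  set h := Metric.diam (cell K) with hh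
  have hh0 : 0 ≤ h := Metric.diam_nonneg
  set F : Fin d → ℝ := fun i => ∑ β ∈ Finset.piAntidiag Finset.univ (k + 1),
    ∫ x in cell K, D i β x ^ 2 with hF
  have hF0 : ∀ i, 0 ≤ F i := fun i =>
    Finset.sum_nonneg fun β _ => integral_nonneg fun x => sq_nonneg _
  choose w hwm hw0 hw1 using fun i => exists_poly_approx hd b (hDm i) (hDw i)
  have hev : ∀ m : MvPolynomial (Fin d) ℝ, MemLp (ev m) 2 (volume.restrict (cell K)) := fun m =>
    memLp_cell_of_continuous _ (continuous_ev m) 2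
  have hqm : ∀ i, MemLp (fun x => q x i) 2 (volume.restrict (cell K)) := fun i =>
    (hflux.trace i).memLp
  have htr := fun i => (hflux.trace i).sub hd (hasTrace_smooth hd b (contDiff_ev (w i)))
  have hGD : ∀ i j, G i j =ᵐ[volume.restrict (cell K)] D i (Pi.single j 1) := fun i j => by
    refine (hflux.trace i).grad_ae_eq (hDm i _ (by simp)) ?_
    have h1 := hDw i 0 j (by simp)
    rw [zero_add] at h1
    refine h1.congr ?_ .rfl
    rw [restrict_interior_cell]
    exact hD0 i
  -- As `w` lies in the Raviart–Thomas space, `z` has the moments of `q - w` and is its projection.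
  set z : PolyField d := p - w with hz
  have hzm : z ∈ RTSpace d k := Submodule.sub_mem _ hp.mem (polyField_mem_RTSpace hwm)
  have hV : ∀ i, ∫ x in cell K, (q x i - ev (w i) x) ^ 2 ≤ (P * h ^ 2) ^ (k + 1) * F i := by
    intro i
    refine (integral_congr_ae ?_).trans_le (hw0 i)
    filter_upwards [hD0 i] with x hx
    rw [hx]
  have hdV : ∀ i j, ∫ x in cell K, (G i j x - pd j (ev (w i)) x) ^ 2 ≤
      (P * h ^ 2) ^ k * F i := by
    intro i j
    refine (integral_congr_ae ?_).trans_le (hw1 i j)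
    filter_upwards [hGD i j] with x hx
    rw [hx, pd_ev]
  have hmain := hstab b _ _ _ htr z hzm (fun r hr => by
      have h1 := hp.inner_eq r hr
      simp only [inner_eq_sum, evF_apply] at h1
      have hi1 : Integrable (fun x => ∑ i, ev (p i) x * ev (r i) x) (volume.restrict (cell K)) :=
        integrable_finsetSum _ fun i _ => integrable_mul (hev _) (hev _)
      have hi2 : Integrable (fun x => ∑ i, ev (w i) x * ev (r i) x) (volume.restrict (cell K)) :=
        integrable_finsetSum _ fun i _ => integrable_mul (hev _) (hev _)
      have hi3 : Integrable (fun x => ∑ i, q x i * ev (r i) x) (volume.restrict (cell K)) :=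
        integrable_finsetSum _ fun i _ => integrable_mul (hqm i) (hev _)
      simp only [hz, Pi.sub_apply, ev_sub, sub_mul, Finset.sum_sub_distrib]
      rw [integral_sub hi1 hi2, integral_sub hi3 hi2, h1])
    (fun e he m hm => by
      have h1 := hflux.normal_eq e he m hm
      obtain ⟨j, rfl⟩ := (mem_faces_iff b e).1 he
      have hmL := memLp_surf_of_continuous hd b j (continuous_ev m) 2
      have hi1 : ∀ p : PolyField d, Integrable
          (fun x => inner ℝ (evF p x) (normal K (vface b j)) * ev m x) (surf (vface b j)) :=
        fun p => integrable_mul (memLp_surf_of_continuous hd b j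
          ((continuous_evF p).inner continuous_const) 2) hmL
      have hi2 : Integrable
          (fun x => (∑ i, γ i x * normal K (vface b j) i) * ev m x) (surf (vface b j)) :=
        integrable_mul (memLp_finsetSum _ fun i _ =>
          ((hflux.trace i).memLp_trace _ he).mul_const _) hmL
      simp only [hz, inner_evF_sub, sub_mul, Finset.sum_sub_distrib, ← inner_evF]
      rw [integral_sub (hi1 p) (hi1 w), integral_sub hi2 (hi1 w), h1])
    s (fun j => diam_mul_norm_grad_le hd hb j)
  -- The derivatives are approximated one order worse, which the weight `h` in the stability norm
  -- makes up for.
  have hsum : ∑ l, (√(∫ x in cell K, (q x l - ev (w l) x) ^ 2) + h *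
      ∑ i, √(∫ x in cell K, (G l i x - pd i (ev (w l)) x) ^ 2)) ≤
        Q * h ^ (k + 1) * ∑ l, √(F l) := by
    rw [Finset.mul_sum]
    refine Finset.sum_le_sum fun l _ => ?_
    have h1 := sqrt_pow_mul_le hP0 hh0 (hV l)
    have h2 : ∑ i, √(∫ x in cell K, (G l i x - pd i (ev (w l)) x) ^ 2) ≤
        d * (√P ^ k * h ^ k * √(F l)) := by
      refine (Finset.sum_le_card_nsmul _ _ _ fun i _ =>
        sqrt_pow_mul_le hP0 hh0 (hdV l i)).trans_eq ?_
      simp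
    calc _ ≤ √P ^ (k + 1) * h ^ (k + 1) * √(F l) + h * (d * (√P ^ k * h ^ k * √(F l))) :=
          add_le_add h1 (mul_le_mul_of_nonneg_left h2 hh0)
      _ = Q * h ^ (k + 1) * √(F l) := by rw [hQ]; ring
  have hcs : (∑ l, √(F l)) ^ 2 ≤ d * ∑ l, F l := by
    have := sq_sum_le_card_mul_sum_sq (s := Finset.univ) (f := fun l => √(F l))
    simpa only [Finset.card_univ, Fintype.card_fin, Real.sq_sqrt (hF0 _)] using this
  have hzi : ∫ x in cell K, ‖evF z x‖ ^ 2 ≤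
      d * (A * s * Q) ^ 2 * (h ^ (k + 1)) ^ 2 * ∑ l, F l := by
    have h1 : √(∫ x in cell K, ‖evF z x‖ ^ 2) ≤ A * s * (Q * h ^ (k + 1) * ∑ l, √(F l)) :=
      hmain.trans (mul_le_mul_of_nonneg_left hsum (mul_nonneg hA hs0))
    have h2 := pow_le_pow_left₀ (Real.sqrt_nonneg _) h1 2
    rw [Real.sq_sqrt (integral_nonneg fun x => sq_nonneg _)] at h2
    calc _ ≤ _ := h2
      _ = (A * s * Q) ^ 2 * (h ^ (k + 1)) ^ 2 * (∑ l, √(F l)) ^ 2 := by ring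
      _ ≤ (A * s * Q) ^ 2 * (h ^ (k + 1)) ^ 2 * (d * ∑ l, F l) :=
          mul_le_mul_of_nonneg_left hcs (by positivity)
      _ = _ := by ring
  have hvi : ∑ l, ∫ x in cell K, (q x l - ev (w l) x) ^ 2 ≤
      P ^ (k + 1) * (h ^ (k + 1)) ^ 2 * ∑ l, F l := by
    refine (Finset.sum_le_sum fun l _ => hV l).trans_eq ?_
    rw [← Finset.mul_sum, mul_pow, ← pow_mul, ← pow_mul, mul_comm 2]
  have hzc : Integrable (fun x => ‖evF z x‖ ^ 2) (volume.restrict (cell K)) :=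
    ((continuous_evF z).norm.pow 2).continuousOn.integrableOn_compact (isCompact_cell _)
  have hvI : ∀ l, Integrable (fun x => (q x l - ev (w l) x) ^ 2) (volume.restrict (cell K)) :=
    fun l => integrable_sq ((hqm l).sub (hev _))
  have hptw : ∀ x, ‖evF p x - q x‖ ^ 2 ≤
      2 * ‖evF z x‖ ^ 2 + 2 * ∑ l, (q x l - ev (w l) x) ^ 2 := by
    intro x
    have e1 : evF p x - q x = evF z x - (q x - evF w x) := by
      rw [hz, evF_sub]; abel
    have e2 : ∑ l, (q x l - ev (w l) x) ^ 2 = ‖q x - evF w x‖ ^ 2 := by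
      rw [EuclideanSpace.real_norm_sq_eq]; rfl
    rw [e1, e2]
    have h1 := norm_sub_le (evF z x) (q x - evF w x)
    have h2 := pow_le_pow_left₀ (norm_nonneg _) h1 2
    nlinarith [sq_nonneg (‖evF z x‖ - ‖q x - evF w x‖)]
  have hfin : ∫ x in cell K, ‖evF p x - q x‖ ^ 2 ≤
      2 * (∫ x in cell K, ‖evF z x‖ ^ 2) +
        2 * ∑ l, ∫ x in cell K, (q x l - ev (w l) x) ^ 2 := by
    rw [← integral_finsetSum _ fun l _ => hvI l, ← integral_const_mul, ← integral_const_mul,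
      ← integral_add (hzc.const_mul _) ((integrable_finsetSum _ fun l _ => hvI l).const_mul _)]
    exact integral_mono_of_nonneg (.of_forall fun x => sq_nonneg _)
      ((hzc.const_mul _).add ((integrable_finsetSum _ fun l _ => hvI l).const_mul _))
      (.of_forall hptw)
  calc _ ≤ _ := hfin
    _ ≤ 2 * (d * (A * s * Q) ^ 2 * (h ^ (k + 1)) ^ 2 * ∑ l, F l) +
        2 * (P ^ (k + 1) * (h ^ (k + 1)) ^ 2 * ∑ l, F l) := by linarith
    _ = _ := by ring

namespace Mesh

variable (T : Mesh d)

theorem diam_le_size {K : Finset (E d)} (hK : K ∈ T.elements) :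
    Metric.diam (cell K) ≤ T.size :=
  le_ciSup (f := fun K : T.elements => Metric.diam (cell K.1)) (Set.finite_range _).bddAbove
    ⟨K, hK⟩

theorem size_nonneg : 0 ≤ T.size := Real.iSup_nonneg fun _ => Metric.diam_nonneg

/-- The error of the Raviart-Thomas projection. -/
theorem exists_wNorm_projection_bound (hd : 0 < d) (k : ℕ) (σ : ℝ) : ∃ A, 0 ≤ A ∧
    ∀ (Ω : Set (E d)) (T : Mesh d), T.IsMeshOf Ω → T.ShapeRegular σ →
    ∀ (q : E d → E d) (f : E d → ℝ), MemLp f 2 (volume.restrict Ω) → IsWeakDiv Ω q f →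
    ∀ Pq : Finset (E d) → PolyField d, (∀ K ∈ T.elements, IsRTProjection k K q (Pq K)) →
    ∀ D : Fin d → (Fin d → ℕ) → E d → ℝ,
      (∀ i, IsSobolev Ω (k + 1) (fun x => q x i) (D i)) →
      wNorm T (fun _ => 1) (fun K x => evF (Pq K) x - q x) ≤
        A * T.size ^ (k + 1) * sobSeminorm Ω (k + 1) D := by
  obtain ⟨A, hA, hb⟩ := exists_projection_bound hd k σ
  refine ⟨√A, Real.sqrt_nonneg _, fun Ω T hΩ hσ q f hf hdiv Pq hP D hD => ?_⟩
  have hloc : ∀ K ∈ T.elements, ∫ x in cell K, ‖evF (Pq K) x - q x‖ ^ 2 ≤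
      A * (T.size ^ (k + 1)) ^ 2 * ∑ i, ∑ β ∈ Finset.piAntidiag Finset.univ (k + 1),
        ∫ x in cell K, D i β x ^ 2 := by
    intro K hK
    obtain ⟨γ, G, hflux⟩ := T.exists_fluxData hΩ hK hf hdiv (hP K hK)
    have hle := T.restrict_cell_le hΩ hK
    have hsub := T.interior_subset_domain hΩ hK
    have hPK := hP K hK
    have hσK := hσ K hK
    have hsz := T.diam_le_size hK
    obtain ⟨b, rfl⟩ := T.exists_basis hK
    refine (hb b hσK q f (Pq (vset b)) γ G hPK hflux D (fun i => ae_mono hle (hD i).zero)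
      (fun i α hα => ((hD i).memLp α hα).mono_measure hle)
      (fun i α j hα => ((hD i).succ α j hα).mono (T.isOpen_domain hΩ) hsub)).trans ?_
    refine mul_le_mul_of_nonneg_right (mul_le_mul_of_nonneg_left ?_ hA)
      (Finset.sum_nonneg fun i _ => Finset.sum_nonneg fun β _ =>
        integral_nonneg fun x => sq_nonneg _)
    exact pow_le_pow_left₀ (pow_nonneg Metric.diam_nonneg _)
      (pow_le_pow_left₀ Metric.diam_nonneg hsz _) 2
  have hsum : ∑ K ∈ T.elements, ∑ i, ∑ β ∈ Finset.piAntidiag Finset.univ (k + 1),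
        ∫ x in cell K, D i β x ^ 2 =
      ∑ i, ∑ β ∈ Finset.piAntidiag (Finset.univ : Finset (Fin d)) (k + 1),
        ∫ x in Ω, D i β x ^ 2 := by
    rw [Finset.sum_comm]
    refine Finset.sum_congr rfl fun i _ => ?_
    rw [Finset.sum_comm]
    refine Finset.sum_congr rfl fun β hβ => ?_
    exact T.sum_integral_cell hΩ (integrable_sq
      ((hD i).memLp β (by simpa using (Finset.mem_piAntidiag.1 hβ).1.le)))
  rw [wNorm, sobSeminorm, ← hsum]
  simp only [one_mul]
  refine (Real.sqrt_le_sqrt (Finset.sum_le_sum hloc)).trans_eq ?_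
  rw [← Finset.mul_sum, Real.sqrt_mul (by positivity), Real.sqrt_mul hA,
    Real.sqrt_sq (pow_nonneg T.size_nonneg _)]

theorem integrable_norm_sq {K : Finset (E d)} {v : E d → E d}
    (hv : ∀ i, MemLp (fun x => v x i) 2 (volume.restrict (cell K))) :
    Integrable (fun x => ‖v x‖ ^ 2) (volume.restrict (cell K)) := by
  simpa only [real_inner_self_eq_norm_sq] using integrable_inner hv hv

/-- Comparison of weighted norms. -/
theorem wNorm_le_mul {c c' : E d → ℝ} {v : Finset (E d) → E d → E d} {M : ℝ} (hM : 0 ≤ M)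
    (hc : ∀ K ∈ T.elements, ∀ᵐ x ∂volume.restrict (cell K), 0 ≤ c x ∧ c x ≤ M * c' x)
    (hi : ∀ K ∈ T.elements,
      Integrable (fun x => c' x * ‖v K x‖ ^ 2) (volume.restrict (cell K))) :
    wNorm T c v ≤ √M * wNorm T c' v := by
  rw [wNorm, wNorm, ← Real.sqrt_mul hM]
  refine Real.sqrt_le_sqrt ?_
  rw [Finset.mul_sum]
  refine Finset.sum_le_sum fun K hK => ?_
  rw [← integral_const_mul]
  refine integral_mono_of_nonneg ?_ ((hi K hK).const_mul M) ?_
  · filter_upwards [hc K hK] with x hx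
    exact mul_nonneg hx.1 (sq_nonneg _)
  · filter_upwards [hc K hK] with x hx
    calc c x * ‖v K x‖ ^ 2 ≤ (M * c' x) * ‖v K x‖ ^ 2 :=
          mul_le_mul_of_nonneg_right hx.2 (sq_nonneg _)
      _ = M * (c' x * ‖v K x‖ ^ 2) := mul_assoc _ _ _

/-- A crude triangle inequality from `‖v - w‖² ≤ 2 ‖v‖² + 2 ‖w‖²`; the factor two is irrelevant for
the final constant. -/
theorem wNorm_sub_le {v w : Finset (E d) → E d → E d}
    (hv : ∀ K ∈ T.elements, ∀ i, MemLp (fun x => v K x i) 2 (volume.restrict (cell K)))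
    (hw : ∀ K ∈ T.elements, ∀ i, MemLp (fun x => w K x i) 2 (volume.restrict (cell K))) :
    wNorm T (fun _ => 1) (fun K x => v K x - w K x) ≤
      2 * (wNorm T (fun _ => 1) v + wNorm T (fun _ => 1) w) := by
  have h0 : ∀ v : Finset (E d) → E d → E d,
      0 ≤ ∑ K ∈ T.elements, ∫ x in cell K, 1 * ‖v K x‖ ^ 2 := fun v =>
    Finset.sum_nonneg fun K _ => integral_nonneg fun x => by positivity
  rw [wNorm, wNorm, wNorm]
  refine Real.sqrt_le_iff.2 ⟨by positivity, ?_⟩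
  have h1 : ∑ K ∈ T.elements, ∫ x in cell K, 1 * ‖v K x - w K x‖ ^ 2 ≤
      2 * (∑ K ∈ T.elements, ∫ x in cell K, 1 * ‖v K x‖ ^ 2) +
        2 * ∑ K ∈ T.elements, ∫ x in cell K, 1 * ‖w K x‖ ^ 2 := by
    simp only [one_mul]
    rw [Finset.mul_sum, Finset.mul_sum, ← Finset.sum_add_distrib]
    refine Finset.sum_le_sum fun K hK => ?_
    have hiv := (integrable_norm_sq (hv K hK)).const_mul 2
    have hiw := (integrable_norm_sq (hw K hK)).const_mul 2
    rw [← integral_const_mul, ← integral_const_mul, ← integral_add hiv hiw]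
    refine integral_mono_of_nonneg (.of_forall fun x => sq_nonneg _) (hiv.add hiw)
      (.of_forall fun x => ?_)
    have h2 := pow_le_pow_left₀ (norm_nonneg _) (norm_sub_le (v K x) (w K x)) 2
    dsimp only [Pi.add_apply]
    nlinarith [sq_nonneg (‖v K x‖ - ‖w K x‖)]
  have ha := Real.sq_sqrt (h0 v)
  have hb := Real.sq_sqrt (h0 w)
  have ha0 := Real.sqrt_nonneg (∑ K ∈ T.elements, ∫ x in cell K, 1 * ‖v K x‖ ^ 2)
  have hb0 := Real.sqrt_nonneg (∑ K ∈ T.elements, ∫ x in cell K, 1 * ‖w K x‖ ^ 2)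
  nlinarith [mul_nonneg ha0 hb0]

end Mesh
end RTM

end

/-! ### Assembly of the two estimates -/

theorem mainTheorem4 (d k : ℕ) (hd : 2 ≤ d) (σ κ₀ κ₁ : ℝ) (hκ₀ : 0 < κ₀) :
    ∃ C : ℝ, 0 < C ∧
      ∀ (Ω : Set (RTM.E d)) (T : RTM.Mesh d), T.IsMeshOf Ω →
      ∀ κ f u₀ : RTM.E d → ℝ,
        AEMeasurable κ (MeasureTheory.volume.restrict Ω) →
        (∀ᵐ x ∂MeasureTheory.volume.restrict Ω, κ₀ ≤ κ x ∧ κ x ≤ κ₁) →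
        MeasureTheory.MemLp f 2 (MeasureTheory.volume.restrict Ω) →
      ∀ (q : RTM.E d → RTM.E d) (u : RTM.E d → ℝ),
        RTM.IsExactSolution T Ω κ f u₀ q u →
        (∀ i, RTM.MemSobolev Ω 1 (fun x => q x i)) →
      ∀ (qh : Finset (RTM.E d) → RTM.PolyField d)
        (uh uhat : Finset (RTM.E d) → MvPolynomial (Fin d) ℝ),
        RTM.IsDiscreteSolution T Ω k κ f u₀ qh uh uhat →
      ∀ Pq : Finset (RTM.E d) → RTM.PolyField d,
        (∀ K ∈ T.elements, RTM.IsRTProjection k K q (Pq K)) →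
        RTM.wNorm T (fun x => (κ x)⁻¹) (fun K x => RTM.evF (Pq K) x - RTM.evF (qh K) x) ≤
            RTM.wNorm T (fun x => (κ x)⁻¹) (fun K x => RTM.evF (Pq K) x - q x) ∧
        (T.ShapeRegular σ →
          ∀ D : Fin d → (Fin d → ℕ) → RTM.E d → ℝ,
            (∀ i, RTM.IsSobolev Ω (k + 1) (fun x => q x i) (D i)) →
            RTM.wNorm T (fun _ => 1) (fun K x => RTM.evF (Pq K) x - RTM.evF (qh K) x) ≤
                C * T.size ^ (k + 1) * RTM.sobSeminorm Ω (k + 1) D ∧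
            RTM.wNorm T (fun _ => 1) (fun K x => q x - RTM.evF (qh K) x) ≤
                C * T.size ^ (k + 1) * RTM.sobSeminorm Ω (k + 1) D) := by
  have hd0 : 0 < d := by omega
  obtain ⟨A, hA, hproj⟩ := RTM.Mesh.exists_wNorm_projection_bound hd0 k σ
  -- The maximum is positive without any assumption on `κ₁` and still bounds `κ` from above.
  set M := max κ₁ κ₀ with hM
  have hM0 : 0 < M := hκ₀.trans_le (le_max_right _ _)
  -- The price of passing from the `L²` norm to the weighted norm, where (i) holds, and back.
  set B := √M * √κ₀⁻¹ with hB
  have hB0 : 0 ≤ B := by positivity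
  -- `B * A` bounds `Πq - q_h` and `A` bounds `Πq - q`; the factor two is that of `wNorm_sub_le`,
  -- and adding one keeps the constant positive when `A` is zero.
  refine ⟨2 * (B * A + A) + 1, by positivity, fun Ω T hΩ κ f u₀ hκm hκ hf q u hex _ qh uh uhat
    hdisc Pq hP => ?_⟩
  have hi := T.wNorm_flux_error_le hd hΩ hκ₀ hκm hκ hf hex hdisc hP
  refine ⟨hi, fun hσ D hD => ?_⟩
  have hle := fun K (hK : K ∈ T.elements) => T.restrict_cell_le hΩ hK
  have hκK := fun K (hK : K ∈ T.elements) => MeasureTheory.ae_mono (hle K hK) hκ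
  have hqm : ∀ K ∈ T.elements, ∀ i, MeasureTheory.MemLp (fun x => q x i) 2
      (MeasureTheory.volume.restrict (RTM.cell K)) := fun K hK i =>
    (hex.q_memLp i).mono_measure (hle K hK)
  have hv : ∀ K ∈ T.elements, ∀ i, MeasureTheory.MemLp
      (fun x => (RTM.evF (Pq K) x - RTM.evF (qh K) x) i) 2
      (MeasureTheory.volume.restrict (RTM.cell K)) := fun K _ i =>
    (RTM.memLp_evF_cell K (Pq K) i).sub (RTM.memLp_evF_cell K (qh K) i)
  have hw : ∀ K ∈ T.elements, ∀ i, MeasureTheory.MemLp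
      (fun x => (RTM.evF (Pq K) x - q x) i) 2
      (MeasureTheory.volume.restrict (RTM.cell K)) := fun K hK i =>
    (RTM.memLp_evF_cell K (Pq K) i).sub (hqm K hK i)
  have h1 := hproj Ω T hΩ hσ q f hf hex.div_eq Pq hP D hD
  have h2 := T.wNorm_le_mul (c := fun _ => 1) (c' := fun x => (κ x)⁻¹)
    (v := fun K x => RTM.evF (Pq K) x - RTM.evF (qh K) x) hM0.le (fun K hK => by
      filter_upwards [hκK K hK] with x hx
      have hx0 : 0 < κ x := hκ₀.trans_le hx.1
      refine ⟨zero_le_one, ?_⟩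
      rw [← div_eq_mul_inv, one_le_div hx0]
      exact hx.2.trans (le_max_left _ _))
    (fun K hK => RTM.integrable_inv_mul hκ₀ (hκm.mono_measure (hle K hK)) (hκK K hK)
      (RTM.Mesh.integrable_norm_sq (hv K hK)))
  have h3 := T.wNorm_le_mul (c := fun x => (κ x)⁻¹) (c' := fun _ => 1)
    (v := fun K x => RTM.evF (Pq K) x - q x) (inv_nonneg.2 hκ₀.le) (fun K hK => by
      filter_upwards [hκK K hK] with x hx
      have hx0 : 0 < κ x := hκ₀.trans_le hx.1
      refine ⟨(inv_pos.2 hx0).le, ?_⟩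
      rw [mul_one]
      exact inv_anti₀ hκ₀ hx.1)
    (fun K hK => by simpa only [one_mul] using RTM.Mesh.integrable_norm_sq (hw K hK))
  set X := T.size ^ (k + 1) * RTM.sobSeminorm Ω (k + 1) D with hX
  have hX0 : 0 ≤ X := mul_nonneg (pow_nonneg T.size_nonneg _) (Real.sqrt_nonneg _)
  rw [mul_assoc, ← hX] at h1
  have h4 : RTM.wNorm T (fun _ => 1) (fun K x => RTM.evF (Pq K) x - RTM.evF (qh K) x) ≤
      B * A * X := by
    calc _ ≤ _ := h2
      _ ≤ √M * (√κ₀⁻¹ * (A * X)) := mul_le_mul_of_nonneg_left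
          (hi.trans (h3.trans (mul_le_mul_of_nonneg_left h1 (Real.sqrt_nonneg _))))
          (Real.sqrt_nonneg _)
      _ = B * A * X := by rw [hB]; ring
  have h5 : RTM.wNorm T (fun _ => 1) (fun K x => q x - RTM.evF (qh K) x) ≤
      2 * (B * A * X + A * X) := by
    have h6 := T.wNorm_sub_le hv hw
    have e : ∀ (K : Finset (RTM.E d)) x, RTM.evF (Pq K) x - RTM.evF (qh K) x -
        (RTM.evF (Pq K) x - q x) = q x - RTM.evF (qh K) x := fun K x => by abel
    simp only [e] at h6
    linarith
  have h7 : 0 ≤ B * A * X := mul_nonneg (mul_nonneg hB0 hA) hX0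
  have h8 : 0 ≤ A * X := mul_nonneg hA hX0
  rw [mul_assoc, ← hX]
  constructor <;> nlinarith
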